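/- Let $\Omega$ be the open unit disc of $\mathbb{R}^2=\mathbb{C}$, $m$ Lebesgue measure and $\sigma$ the one-dimensional Hausdorff measure (length). For an open set $X\subset\mathbb{R}^2$ let $W^{1,p}(X)$ be the complex-valued functions in $L^p(X)$ whose first distributional derivatives are in $L^p(X)$, with norm $\left(\|f\|_{L^p(X)}^p+\|\partial_1f\|_{L^p(X)}^p+\|\partial_2f\|_{L^p(X)}^p\right)^{1/p}$ if $p<\infty$, and the maximum of the three $L^\infty(X)$ norms if $p=\infty$. A Lipschitz partition of $\Omega$ is a finite family $\Omega_1,\dots,\Omega_N$ of pairwise disjoint open sets with Lipschitz boundary such that $\overline\Omega=\bigcup_j\overline{\Omega_j}$. A function $q\in L^p(\Omega)$ belongs to $W^{1,p}_\oplus(\Omega)$ with pieces $\Omega_j$ if $q|_{\Omega_j}\in W^{1,p}(\Omega_j)$ for all $j$; its norm is $\|q\|_{W^{1,p}_\oplus(\Omega)}=\left(\sum_j\|q\|_{W^{1,p}(\Omega_j)}^p\right)^{1/p}$ if $p<\infty$ and $\max_j\|q\|_{W^{1,\infty}(\Omega_j)}$ if $p=\infty$. Let $E_{p,j}$ be the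 least constant $E$ such that every $f\in W^{1,p}(\Omega_j)$ has a continuous representative on $\overline{\Omega_j}$ with $\|f\|_{C^{1-2/p}(\overline{\Omega_j})}\le E\|f\|_{W^{1,p}(\Omega_j)}$ (the left side is the supremum norm plus the Hölder seminorm of exponent $1-2/p$, which is the Lipschitz seminorm if $p=\infty$). Theorem. Let $2<p\le\infty$ and let $N$ be a natural number. There is a polynomial $P$ in $2N$ variables with non-negative coefficients, depending only on $p$ and $N$, such that the following holds for every Lipschitz partition $\Omega_1,\dots,\Omega_N$ of $\Omega$. The numbers $\sigma(\partial\Omega_j)$ and $E_{p,j}$ are finite. Moreover, let $q\in W^{1,p}_\oplus(\Omega)$ with pieces $\Omega_1,\dots,\Omega_N$, let $g_{z_0}\in W^{1,p}(\Omega)$, $z_0\in\Omega$, be a family of functions such that $(z,z_0)\mapsto g_{z_0}(z)$ is measurable, and let $n>0$ be real. Then the integral below exists for every $z_0\in\Omega$, is a measurable function of $z_0$, and $$\left\|\int_\Omega\frac{2n}{\pi}e^{in((z-z_0)^2+(\bar z-\bar z_0)^2)}q(z)g_{z_0}(z)\,dm(z)\right\|_{L^2(\Omega,z_0)}\le P\,\|q\|_{W^{1,p}_\oplus(\Omega)}\operatorname*{ess\,sup}_{z_0\in\Omega}\|g_{z_0}\|_{W^{1,p}(\Omega)},$$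 where $P$ is evaluated at $\sigma(\partial\Omega_1),\dots,\sigma(\partial\Omega_N),E_{p,1},\dots,E_{p,N}$; in particular the bound does not depend on $n$. -/

import Mathlib

open MeasureTheory Set
open scoped ENNReal NNReal

noncomputable section

namespace PiecewiseSobolev

/-- The open unit disc of the plane `ℝ² = ℂ`. -/
abbrev unitDisc : Set ℂ := Metric.ball (0 : ℂ) 1

/-- `h` is locally integrable on `X` and is the distributional derivative of `f` on the open set
`X` in the direction `v` (`v = 1` gives `∂₁`, `v = Complex.I` gives `∂₂`). -/
def HasWeakDeriv (X : Set ℂ) (v : ℂ) (f h : ℂ → ℂ) : Prop :=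
  LocallyIntegrableOn h X volume ∧
    ∀ φ : ℂ → ℝ, ContDiff ℝ (⊤ : ℕ∞) φ → HasCompactSupport φ → tsupport φ ⊆ X →
      ∫ z in X, fderiv ℝ φ z v • f z = -∫ z in X, φ z • h z

open Classical in
/-- The weak derivative of `f` on `X` in the direction `v` (unique almost everywhere on `X`);
zero if it does not exist. -/
def weakDeriv (X : Set ℂ) (v : ℂ) (f : ℂ → ℂ) : ℂ → ℂ :=
  if h : ∃ h, HasWeakDeriv X v f h then h.choose else 0

/-- `f ∈ L^p(X)`. -/
def MemLpOn (p : ℝ≥0∞) (X : Set ℂ) (f : ℂ → ℂ) : Prop :=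
  MemLp f p (volume.restrict X)

/-- `f ∈ W^{1,p}(X)`: `f` and its first order distributional derivatives belong to `L^p(X)`. -/
def MemSobolev (p : ℝ≥0∞) (X : Set ℂ) (f : ℂ → ℂ) : Prop :=
  MemLpOn p X f ∧
    (∃ h, HasWeakDeriv X 1 f h ∧ MemLpOn p X h) ∧
    (∃ h, HasWeakDeriv X Complex.I f h ∧ MemLpOn p X h)

/-- The `L^p(X)` norm. -/
def lpNormOn (p : ℝ≥0∞) (X : Set ℂ) (f : ℂ → ℂ) : ℝ≥0∞ :=
  eLpNorm f p (volume.restrict X)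

/-- The `W^{1,p}(X)` norm of a function `f ∈ W^{1,p}(X)`. -/
def sobolevNorm (p : ℝ≥0∞) (X : Set ℂ) (f : ℂ → ℂ) : ℝ≥0∞ :=
  if p = ∞ then
    max (lpNormOn ∞ X f)
      (max (lpNormOn ∞ X (weakDeriv X 1 f)) (lpNormOn ∞ X (weakDeriv X Complex.I f)))
  else
    (lpNormOn p X f ^ p.toReal + lpNormOn p X (weakDeriv X 1 f) ^ p.toReal
      + lpNormOn p X (weakDeriv X Complex.I f) ^ p.toReal) ^ (1 / p.toReal)

/-- `X` is an open subset of the plane with Lipschitz boundary: near each boundary point `x`, in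
suitable orthonormal coordinates `(s, t)` centred at `x`, the set `X` is the region strictly below
the graph of a Lipschitz function. -/
def IsOpenLipschitz (X : Set ℂ) : Prop :=
  IsOpen X ∧ ∀ x ∈ frontier X, ∃ u : ℂ, ‖u‖ = 1 ∧ ∃ r : ℝ, 0 < r ∧ ∃ (K : ℝ≥0) (γ : ℝ → ℝ),
    LipschitzWith K γ ∧ ∀ s t : ℝ, |s| < r → |t| < r →
      (x + u * (s + t * Complex.I) ∈ X ↔ t < γ s)

/-- `U 0, …, U (m - 1)` are pairwise disjoint open sets with Lipschitz boundary, the union of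
whose closures is the closed unit disc. -/
structure IsLipschitzPartition {m : ℕ} (U : Fin m → Set ℂ) : Prop where
  lipschitz : ∀ j, IsOpenLipschitz (U j)
  disjoint : ∀ j k, j ≠ k → Disjoint (U j) (U k)
  cover : closure unitDisc = ⋃ j, closure (U j)

/-- `q ∈ W_⊕^{1,p}(Ω)` with Lipschitz pieces `U j`. -/
structure MemPiecewiseSobolev (p : ℝ≥0∞) {m : ℕ} (U : Fin m → Set ℂ) (q : ℂ → ℂ) : Prop where
  memLp : MemLpOn p unitDisc q
  partition : IsLipschitzPartition U
  memSobolev : ∀ j, MemSobolev p (U j) q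

/-- The norm of `W_⊕^{1,p}(Ω)`, computed with the pieces `U j`. -/
def piecewiseSobolevNorm (p : ℝ≥0∞) {m : ℕ} (U : Fin m → Set ℂ) (q : ℂ → ℂ) : ℝ≥0∞ :=
  if p = ∞ then ⨆ j, sobolevNorm ∞ (U j) q
  else (∑ j, sobolevNorm p (U j) q ^ p.toReal) ^ (1 / p.toReal)

/-- The Hölder norm of `u` in `C^α(S)` (the Lipschitz norm if `α = 1`): the supremum of `|u|` plus
the Hölder seminorm. -/
def holderNormOn (α : ℝ≥0) (S : Set ℂ) (u : ℂ → ℂ) : ℝ≥0∞ :=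
  (⨆ z ∈ S, ‖u z‖ₑ) + eHolderNorm α (S.domRestrict u)

/-- `C` is a constant for the Sobolev embedding `W^{1,p}(X) ⊂ C^{1-2/p}(closure X)`: each
`f ∈ W^{1,p}(X)` has a continuous representative `u` on `closure X` whose Hölder norm is at most
`C` times the `W^{1,p}(X)` norm of `f`. -/
def IsEmbeddingConst (p : ℝ≥0∞) (X : Set ℂ) (C : ℝ≥0) : Prop :=
  ∀ f : ℂ → ℂ, MemSobolev p X f → ∃ u : ℂ → ℂ, u =ᵐ[volume.restrict X] f ∧
    ContinuousOn u (closure X) ∧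
    holderNormOn (1 - 2 / p).toNNReal (closure X) u ≤ C * sobolevNorm p X f

/-- The (least) constant of the Sobolev embedding `W^{1,p}(X) ⊂ C^{1-2/p}(closure X)`; it is `∞`
if there is no such embedding. -/
def embeddingConst (p : ℝ≥0∞) (X : Set ℂ) : ℝ≥0∞ :=
  ⨅ (C : ℝ≥0) (_ : IsEmbeddingConst p X C), (C : ℝ≥0∞)

/-- The length of the boundary of `X`. -/
def boundaryLength (X : Set ℂ) : ℝ≥0∞ := Measure.hausdorffMeasure 1 (frontier X)

/-- The kernel `(2n/π) exp(i n R)` with `R = (z - z₀)² + (z̄ - z̄₀)²`. -/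
def phaseKernel (n : ℝ) (z₀ z : ℂ) : ℂ :=
  (2 * n / Real.pi : ℝ) *
    Complex.exp (Complex.I * n *
      ((z - z₀) ^ 2 + ((starRingEnd ℂ) z - (starRingEnd ℂ) z₀) ^ 2))

end PiecewiseSobolev

end

/-!
The integral `T z₀ = ∫ K q g_{z₀}`, where `K = phaseKernel n z₀` oscillates, is estimated by
splitting off the value of the amplitude at the critical point `z₀` of the phase. Let `G` be the
continuous representative of `g_{z₀}`, which exists by Morrey's embedding
(`IsOpenLipschitz.exists_isEmbeddingConst`) because `p > 2`. Then
`T z₀ = G z₀ * ∫ K q + ∑ j, ∫_{U j} K q (G - G z₀)`.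

* The operator `q ↦ ∫ K q` is an isometry of `L²(ℂ)`: expanding the phase turns it into a Fourier
  transform between multiplications by unimodular functions
  (`eLpNorm_phaseKernel_integral_eq`). Since `q` is essentially bounded on each piece by its
  embedding constant times its Sobolev norm, this handles the first summand.
* On a piece, `K` is a numerical multiple of `(conj (z - z₀))⁻¹` times the Cauchy-Riemann derivative
  of the phase factor, which absorbs the factor `n` of `K`; one integration by parts therefore
  leaves no power of `n` (`enorm_integral_cutoff_phase_le`). The derivative of the singular factor
  is of size `|z - z₀|⁻²`, and remains integrable against `G - G z₀`, which is of size
  `|z - z₀| ^ (1 - 2/p)`.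
  The derivatives of `q` and `G` are paired with `|z - z₀|⁻¹` by Hölder's inequality, which again
  uses `p > 2`.
* The boundary terms come from a cutoff `χ` which is `1` outside the `2ε`-neighbourhood of
  the boundary of the piece and has gradient of size `ε⁻¹` (`exists_cutoff`). They are potentials of
  boundary layers of area at most a constant times `ε` times the length of the boundary
  (`IsOpenLipschitz.exists_volume_thickening_le`), and the `L²` norm of such a potential is bounded
  by a multiple of the area of the layer (`eLpNorm_potential_le`). The part of the integral
  removed by the cutoff is of size `n ε` and disappears as `ε → 0` with `n` fixed, so that a
  bound independent of `n` is left.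

Weak derivatives are handled by mollification. Morrey's embedding is proved by following mollified
averages of a function along paths inside the cones given by the local graph description of the
domain, and the product rule for two Sobolev functions (`integral_fderiv_mul_mul`) by doubling the
variables.
-/

namespace PiecewiseSobolev

/-! ### Weak derivatives and Sobolev norms -/

theorem HasWeakDeriv.mono {X Y : Set ℂ} {v : ℂ} {f h : ℂ → ℂ} (H : HasWeakDeriv X v f h)
    (hYX : Y ⊆ X) : HasWeakDeriv Y v f h := by
  refine ⟨H.1.mono_set hYX, fun φ hφ hc hs => ?_⟩
  have key : ∀ {Z : Set ℂ} {F : ℂ → ℂ}, tsupport φ ⊆ Z → (∀ z, z ∉ tsupport φ → F z = 0) →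
      ∫ z in Z, F z = ∫ z, F z := fun {Z F} hZ hF =>
    setIntegral_eq_integral_of_forall_compl_eq_zero fun z hz => hF z fun h => hz (hZ h)
  have h1 : ∀ z, z ∉ tsupport φ → fderiv ℝ φ z v • f z = 0 := fun z hz => by
    rw [fderiv_of_notMem_tsupport ℝ hz]; simp
  have h2 : ∀ z, z ∉ tsupport φ → φ z • h z = 0 := fun z hz => by
    rw [image_eq_zero_of_notMem_tsupport hz]; simp
  have := H.2 φ hφ hc (hs.trans hYX)
  rwa [key (hs.trans hYX) h1, key (hs.trans hYX) h2, ← key hs h1, ← key hs h2] at this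

theorem HasWeakDeriv.congr_left {X : Set ℂ} {v : ℂ} {f g h : ℂ → ℂ} (H : HasWeakDeriv X v f h)
    (hfg : g =ᵐ[volume.restrict X] f) : HasWeakDeriv X v g h := by
  refine ⟨H.1, fun φ hφ hc hs => ?_⟩
  rw [← H.2 φ hφ hc hs]
  refine integral_congr_ae ?_
  filter_upwards [hfg] with z hz using by rw [hz]

/-- Weak derivatives on an open set are unique almost everywhere. -/
theorem HasWeakDeriv.ae_eq {X : Set ℂ} (hX : IsOpen X) {v : ℂ} {f h₁ h₂ : ℂ → ℂ}
    (H₁ : HasWeakDeriv X v f h₁) (H₂ : HasWeakDeriv X v f h₂) :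
    h₁ =ᵐ[volume.restrict X] h₂ := by
  have hl : LocallyIntegrableOn (h₁ - h₂) X volume := H₁.1.sub H₂.1
  have := hX.ae_eq_zero_of_integral_contDiff_smul_eq_zero hl fun φ hφ hc hs => by
    have e : ∫ z in X, φ z • (h₁ - h₂) z = ∫ z, φ z • (h₁ - h₂) z :=
      setIntegral_eq_integral_of_forall_compl_eq_zero fun z hz => by
        rw [image_eq_zero_of_notMem_tsupport fun h => hz (hs h)]; simp
    have hint : ∀ {h : ℂ → ℂ}, LocallyIntegrableOn h X volume →
        Integrable (fun z => φ z • h z) (volume.restrict X) := fun {h} hh => by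
      have : IntegrableOn (fun z => φ z • h z) (tsupport φ) volume :=
        (hh.integrableOn_compact_subset hs hc).continuousOn_smul hφ.continuous.continuousOn hc
      have : Integrable (fun z => φ z • h z) volume :=
        (integrableOn_iff_integrable_of_support_subset (fun z hz => by
          by_contra h'
          exact hz (by simp [image_eq_zero_of_notMem_tsupport h']))).1 this
      exact this.integrableOn
    rw [← e]
    have h1 := H₁.2 φ hφ hc hs
    have h2 := H₂.2 φ hφ hc hs
    have h3 : ∫ z in X, φ z • h₁ z = ∫ z in X, φ z • h₂ z := by
      rw [← neg_inj, ← h1, ← h2]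
    simp only [Pi.sub_apply, smul_sub]
    rw [integral_sub (hint H₁.1) (hint H₂.1), h3, sub_self]
  rw [Filter.EventuallyEq, ae_restrict_iff' hX.measurableSet]
  filter_upwards [this] with z hz hzX
  simpa [sub_eq_zero] using hz hzX

/-- The defining identity of a weak derivative also holds for complex-valued test functions. -/
theorem HasWeakDeriv.integral_complex {X : Set ℂ} {v : ℂ} {f h : ℂ → ℂ} (H : HasWeakDeriv X v f h)
    (hf : IntegrableOn f X) (hh : IntegrableOn h X) {φ : ℂ → ℂ} (hφ : ContDiff ℝ (⊤ : ℕ∞) φ)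
    (hc : HasCompactSupport φ) (hs : tsupport φ ⊆ X) :
    ∫ z in X, fderiv ℝ φ z v * f z = -∫ z in X, φ z * h z := by
  have hd : Differentiable ℝ φ := hφ.differentiable (by simp)
  have hsub : ∀ L : ℂ →L[ℝ] ℝ, tsupport (fun z => L (φ z)) ⊆ tsupport φ := fun L =>
    tsupport_comp_subset (map_zero L) φ
  have hcL : ∀ L : ℂ →L[ℝ] ℝ, HasCompactSupport (fun z => L (φ z)) := fun L =>
    hc.comp_left (map_zero L)
  have hL : ∀ L : ℂ →L[ℝ] ℝ, ∫ z in X, (L (fderiv ℝ φ z v) : ℂ) * f z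
      = -∫ z in X, (L (φ z) : ℂ) * h z := fun L => by
    have := H.2 (fun z => L (φ z)) (L.contDiff.comp hφ) (hcL L) ((hsub L).trans hs)
    simp only [Complex.real_smul] at this
    rw [← this]
    congr 1; ext z
    have : fderiv ℝ (fun z => L (φ z)) z = L.comp (fderiv ℝ φ z) :=
      (L.hasFDerivAt.comp z (hd z).hasFDerivAt).fderiv
    rw [this]; rfl
  have hcont : ∀ L : ℂ →L[ℝ] ℝ, Continuous fun z => (L (φ z) : ℂ) := fun L =>
    Complex.continuous_ofReal.comp (L.continuous.comp hφ.continuous)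
  have hcont' : ∀ L : ℂ →L[ℝ] ℝ, Continuous fun z => (L (fderiv ℝ φ z v) : ℂ) := fun L =>
    Complex.continuous_ofReal.comp (L.continuous.comp
      ((hφ.continuous_fderiv (by simp)).clm_apply continuous_const))
  have hint : ∀ {c k : ℂ → ℂ}, Continuous c → HasCompactSupport c → IntegrableOn k X →
      Integrable (fun z => c z * k z) (volume.restrict X) := fun {c k} hcc hcs hk => by
    obtain ⟨C, hC⟩ := hcs.exists_bound_of_continuous hcc
    exact hk.bdd_mul hcc.aestronglyMeasurable (Filter.Eventually.of_forall hC)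
  have hs1 : ∀ L : ℂ →L[ℝ] ℝ, HasCompactSupport fun z => (L (φ z) : ℂ) := fun L =>
    (hcL L).comp_left Complex.ofReal_zero
  have hs2 : ∀ L : ℂ →L[ℝ] ℝ, HasCompactSupport fun z => (L (fderiv ℝ φ z v) : ℂ) := fun L =>
    (hc.fderiv_apply ℝ v).comp_left (g := fun w => (L w : ℂ)) (by simp)
  have e : ∀ w : ℂ, w = (Complex.reCLM w : ℂ) + Complex.I * (Complex.imCLM w : ℂ) := fun w => by
    rw [mul_comm]; exact (Complex.re_add_im w).symm
  calc ∫ z in X, fderiv ℝ φ z v * f z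
      = ∫ z in X, ((Complex.reCLM (fderiv ℝ φ z v) : ℂ) * f z
          + Complex.I * ((Complex.imCLM (fderiv ℝ φ z v) : ℂ) * f z)) := by
        congr 1; ext z
        conv_lhs => rw [e (fderiv ℝ φ z v)]
        ring
    _ = -∫ z in X, ((Complex.reCLM (φ z) : ℂ) * h z
          + Complex.I * ((Complex.imCLM (φ z) : ℂ) * h z)) := by
        rw [integral_add (hint (hcont' _) (hs2 _) hf) ((hint (hcont' _) (hs2 _) hf).const_mul _),
          integral_add (hint (hcont _) (hs1 _) hh) ((hint (hcont _) (hs1 _) hh).const_mul _),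
          integral_const_mul, integral_const_mul, hL, hL]
        ring
    _ = -∫ z in X, φ z * h z := by
        congr 2; ext z
        conv_rhs => rw [e (φ z)]
        ring

theorem MemSobolev.hasWeakDeriv_one {p : ℝ≥0∞} {X : Set ℂ} {f : ℂ → ℂ} (hf : MemSobolev p X f) :
    HasWeakDeriv X 1 f (weakDeriv X 1 f) := by
  have h : ∃ h, HasWeakDeriv X 1 f h := hf.2.1.imp fun _ h => h.1
  rw [weakDeriv, dif_pos h]; exact h.choose_spec

theorem MemSobolev.hasWeakDeriv_I {p : ℝ≥0∞} {X : Set ℂ} {f : ℂ → ℂ} (hf : MemSobolev p X f) :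
    HasWeakDeriv X Complex.I f (weakDeriv X Complex.I f) := by
  have h : ∃ h, HasWeakDeriv X Complex.I f h := hf.2.2.imp fun _ h => h.1
  rw [weakDeriv, dif_pos h]; exact h.choose_spec

theorem MemSobolev.memLp_one {p : ℝ≥0∞} {X : Set ℂ} (hX : IsOpen X) {f : ℂ → ℂ}
    (hf : MemSobolev p X f) : MemLp (weakDeriv X 1 f) p (volume.restrict X) := by
  obtain ⟨h, hw, hm⟩ := hf.2.1
  exact (memLp_congr_ae (hw.ae_eq hX hf.hasWeakDeriv_one)).1 hm

theorem MemSobolev.memLp_I {p : ℝ≥0∞} {X : Set ℂ} (hX : IsOpen X) {f : ℂ → ℂ}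
    (hf : MemSobolev p X f) : MemLp (weakDeriv X Complex.I f) p (volume.restrict X) := by
  obtain ⟨h, hw, hm⟩ := hf.2.2
  exact (memLp_congr_ae (hw.ae_eq hX hf.hasWeakDeriv_I)).1 hm

theorem le_rpow_sum_three {r : ℝ} (hr : 0 < r) (x y z : ℝ≥0∞) :
    x ≤ (x ^ r + y ^ r + z ^ r) ^ (1 / r) ∧ y ≤ (x ^ r + y ^ r + z ^ r) ^ (1 / r) ∧
      z ≤ (x ^ r + y ^ r + z ^ r) ^ (1 / r) := by
  simp only [one_div, ENNReal.le_rpow_inv_iff hr]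
  exact ⟨by rw [add_assoc]; exact le_self_add,
    by rw [add_assoc]; exact le_add_left le_self_add, le_add_self⟩

theorem lpNormOn_le_sobolevNorm {p : ℝ≥0∞} (hp : 0 < p) (X : Set ℂ) (f : ℂ → ℂ) :
    lpNormOn p X f ≤ sobolevNorm p X f ∧ lpNormOn p X (weakDeriv X 1 f) ≤ sobolevNorm p X f ∧
      lpNormOn p X (weakDeriv X Complex.I f) ≤ sobolevNorm p X f := by
  unfold sobolevNorm
  split_ifs with h
  · subst h
    exact ⟨le_max_left _ _, le_max_of_le_right (le_max_left _ _),
      le_max_of_le_right (le_max_right _ _)⟩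
  · exact le_rpow_sum_three (ENNReal.toReal_pos hp.ne' h) _ _ _

theorem MemSobolev.sobolevNorm_ne_top {p : ℝ≥0∞} {X : Set ℂ} (hX : IsOpen X)
    {f : ℂ → ℂ} (hf : MemSobolev p X f) : sobolevNorm p X f ≠ ∞ := by
  have h0 : lpNormOn p X f ≠ ∞ := hf.1.2.ne
  have h1 : lpNormOn p X (weakDeriv X 1 f) ≠ ∞ := (hf.memLp_one hX).2.ne
  have h2 : lpNormOn p X (weakDeriv X Complex.I f) ≠ ∞ := (hf.memLp_I hX).2.ne
  unfold sobolevNorm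
  split_ifs with h
  · subst h
    simp [h0, h1, h2]
  · refine ENNReal.rpow_ne_top_of_nonneg (by positivity) ?_
    have := fun x : ℝ≥0∞ => ENNReal.rpow_ne_top_of_nonneg (x := x) (y := p.toReal) (by positivity)
    simp [this _ h0, this _ h1, this _ h2]

/-! ### Smooth averages over discs -/

/-- A smooth non-negative function on the plane with integral `1`, vanishing outside the unit
disc. -/
noncomputable def rho : ℂ → ℝ :=
  (⟨1 / 2, 1, by norm_num, by norm_num⟩ : ContDiffBump (0 : ℂ)).normed volume

theorem rho_contDiff : ContDiff ℝ (⊤ : ℕ∞) rho := ContDiffBump.contDiff_normed _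

theorem rho_nonneg (w : ℂ) : 0 ≤ rho w := ContDiffBump.nonneg_normed _ w

theorem integral_rho : ∫ w, rho w = 1 := ContDiffBump.integral_normed _

theorem tsupport_rho : tsupport rho = Metric.closedBall 0 1 := ContDiffBump.tsupport_normed_eq _

theorem hasCompactSupport_rho : HasCompactSupport rho := ContDiffBump.hasCompactSupport_normed _

theorem rho_eq_zero {w : ℂ} (hw : 1 < ‖w‖) : rho w = 0 :=
  image_eq_zero_of_notMem_tsupport (by rw [tsupport_rho]; simpa using hw)

theorem fderiv_rho_eq_zero {w : ℂ} (hw : 1 < ‖w‖) : fderiv ℝ rho w = 0 :=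
  fderiv_of_notMem_tsupport ℝ (by rw [tsupport_rho]; simpa using hw)

theorem exists_bound_rho : ∃ C : ℝ, 0 < C ∧ (∀ w, rho w ≤ C) ∧ ∀ w, ‖fderiv ℝ rho w‖ ≤ C := by
  obtain ⟨C, hC⟩ := hasCompactSupport_rho.exists_bound_of_continuous rho_contDiff.continuous
  obtain ⟨D, hD⟩ := (hasCompactSupport_rho.fderiv (𝕜 := ℝ)).exists_bound_of_continuous
    (rho_contDiff.continuous_fderiv (by simp))
  exact ⟨max C (max D 1), by positivity,
    fun w => ((le_abs_self _).trans (hC w)).trans (le_max_left _ _),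
    fun w => (hD w).trans (le_max_of_le_right (le_max_left _ _))⟩

/-- A common bound for `rho` and its derivative. -/
noncomputable def rhoBound : ℝ := exists_bound_rho.choose

theorem rhoBound_pos : 0 < rhoBound := exists_bound_rho.choose_spec.1

theorem rho_le (w : ℂ) : rho w ≤ rhoBound := exists_bound_rho.choose_spec.2.1 w

theorem norm_fderiv_rho_le (w : ℂ) : ‖fderiv ℝ rho w‖ ≤ rhoBound :=
  exists_bound_rho.choose_spec.2.2 w

/-- The kernel `rho` transported to the disc with centre `c` and radius `d`. -/
noncomputable def mollifier (c : ℂ) (d : ℝ) (z : ℂ) : ℝ := (d ^ 2)⁻¹ * rho (d⁻¹ • (z - c))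

theorem mollifier_nonneg (c : ℂ) (d : ℝ) (z : ℂ) : 0 ≤ mollifier c d z :=
  mul_nonneg (by positivity) (rho_nonneg _)

theorem mollifier_le (c : ℂ) (d : ℝ) (z : ℂ) : mollifier c d z ≤ (d ^ 2)⁻¹ * rhoBound :=
  mul_le_mul_of_nonneg_left (rho_le _) (by positivity)

theorem norm_scaled_gt {c z : ℂ} {d : ℝ} (hd : 0 < d) (hz : z ∉ Metric.closedBall c d) :
    1 < ‖d⁻¹ • (z - c)‖ := by
  rw [norm_smul, norm_inv, Real.norm_of_nonneg hd.le, ← div_eq_inv_mul, one_lt_div hd]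
  simpa [dist_eq_norm] using hz

theorem mollifier_eq_zero {c z : ℂ} {d : ℝ} (hd : 0 < d) (hz : z ∉ Metric.closedBall c d) :
    mollifier c d z = 0 := by
  rw [mollifier, rho_eq_zero (norm_scaled_gt hd hz), mul_zero]

theorem tsupport_mollifier_subset {c : ℂ} {d : ℝ} (hd : 0 < d) :
    tsupport (mollifier c d) ⊆ Metric.closedBall c d :=
  closure_minimal (fun z hz => by
    by_contra h; exact hz (mollifier_eq_zero hd h)) Metric.isClosed_closedBall

theorem hasCompactSupport_mollifier {c : ℂ} {d : ℝ} (hd : 0 < d) :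
    HasCompactSupport (mollifier c d) :=
  HasCompactSupport.intro (isCompact_closedBall c d) fun _ hz => mollifier_eq_zero hd hz

theorem mollifier_contDiff (c : ℂ) (d : ℝ) : ContDiff ℝ (⊤ : ℕ∞) (mollifier c d) :=
  contDiff_const.mul (rho_contDiff.comp ((contDiff_id.sub contDiff_const).const_smul _))

theorem integral_mollifier {c : ℂ} {d : ℝ} (hd : 0 < d) : ∫ z, mollifier c d z = 1 := by
  unfold mollifier
  rw [integral_const_mul, integral_sub_right_eq_self (fun z => rho (d⁻¹ • z)) c,
    Measure.integral_comp_smul, integral_rho]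
  simp [hd.ne']

theorem hasFDerivAt_mollifier (c : ℂ) (d : ℝ) (z : ℂ) :
    HasFDerivAt (mollifier c d) (((d ^ 2)⁻¹ * d⁻¹) • fderiv ℝ rho (d⁻¹ • (z - c))) z := by
  have h1 : HasFDerivAt (fun z : ℂ => d⁻¹ • (z - c)) (d⁻¹ • ContinuousLinearMap.id ℝ ℂ) z :=
    ((hasFDerivAt_id z).sub_const c).const_smul d⁻¹
  have h2 := (((rho_contDiff.differentiable (by simp)) (d⁻¹ • (z - c))).hasFDerivAt.comp z
    h1).const_mul (d ^ 2)⁻¹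
  convert! h2 using 1
  ext
  simp
  ring

/-- The average of `f` over the disc with centre `c` and radius `d`, weighted by the kernel
`mollifier c d`; the values of `f` outside `X` are ignored. -/
noncomputable def discAverage (X : Set ℂ) (f : ℂ → ℂ) (c : ℂ) (d : ℝ) : ℂ :=
  ∫ z in X, (mollifier c d z : ℂ) * f z

theorem integrable_mollifier_mul {X : Set ℂ} {f : ℂ → ℂ} (hf : IntegrableOn f X) (c : ℂ) (d : ℝ) :
    Integrable (fun z => (mollifier c d z : ℂ) * f z) (volume.restrict X) :=
  hf.bdd_mul (c := (d ^ 2)⁻¹ * rhoBound)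
    (Complex.continuous_ofReal.comp (mollifier_contDiff c d).continuous).aestronglyMeasurable
    (Filter.Eventually.of_forall fun z => by
      rw [Complex.norm_real, Real.norm_of_nonneg (mollifier_nonneg _ _ _)]
      exact mollifier_le c d z)

/-- The derivative of the mollifier along an affine path of discs. -/
theorem hasDerivAt_mollifier_path (c₀ c₁ : ℂ) (d₀ d₁ : ℝ) (t : ℝ) (hd : 0 < d₀ + t * d₁) (z : ℂ) :
    HasDerivAt (fun t : ℝ => mollifier (c₀ + t • c₁) (d₀ + t * d₁) z)
      (-((d₀ + t * d₁) ^ 3)⁻¹ * (2 * d₁ * rho ((d₀ + t * d₁)⁻¹ • (z - (c₀ + t • c₁)))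
        + fderiv ℝ rho ((d₀ + t * d₁)⁻¹ • (z - (c₀ + t • c₁)))
            (c₁ + d₁ • ((d₀ + t * d₁)⁻¹ • (z - (c₀ + t • c₁)))))) t := by
  have hd' := hd.ne'
  have h1 : HasDerivAt (fun t : ℝ => d₀ + t * d₁) d₁ t := by
    simpa using ((hasDerivAt_id t).mul_const d₁).const_add d₀
  have h2 : HasDerivAt (fun t : ℝ => z - (c₀ + t • c₁)) (-c₁) t := by
    simpa using (((hasDerivAt_id t).smul_const c₁).const_add c₀).const_sub z
  have h3 : HasDerivAt (fun t : ℝ => (d₀ + t * d₁)⁻¹ • (z - (c₀ + t • c₁)))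
      (-((d₀ + t * d₁)⁻¹ • (c₁ + d₁ • ((d₀ + t * d₁)⁻¹ • (z - (c₀ + t • c₁)))))) t := by
    convert! (h1.inv hd').smul h2 using 1
    simp only [smul_add, smul_neg, smul_smul, neg_add, neg_div, neg_smul]
    congr 3
    field_simp
  have h4 := (rho_contDiff.differentiable (by simp)
    ((d₀ + t * d₁)⁻¹ • (z - (c₀ + t • c₁)))).hasFDerivAt.comp_hasDerivAt t h3
  have h5 : HasDerivAt (fun t : ℝ => ((d₀ + t * d₁) ^ 2)⁻¹)
      (-(2 * (d₀ + t * d₁) * d₁) / ((d₀ + t * d₁) ^ 2) ^ 2) t := by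
    convert! (h1.pow 2).inv (pow_ne_zero 2 hd') using 1
    simp
  convert! h5.mul h4 using 1
  simp only [map_neg, map_smul, smul_eq_mul, Function.comp]
  field_simp
  ring

/-- The product of a mollifier with an affine function is a test function; this is its
derivative. -/
theorem fderiv_mollifier_mul (L : ℂ →L[ℝ] ℝ) (c k : ℂ) (d s : ℝ) (z v : ℂ) :
    fderiv ℝ (fun z => mollifier c d z * L (k + s • (z - c))) z v
      = mollifier c d z * (s * L v) + L (k + s • (z - c)) *
        (((d ^ 2)⁻¹ * d⁻¹) * fderiv ℝ rho (d⁻¹ • (z - c)) v) := by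
  have h1 : HasFDerivAt (fun z : ℂ => L (k + s • (z - c))) (L.comp (s • ContinuousLinearMap.id ℝ ℂ))
      z := L.hasFDerivAt.comp z ((((hasFDerivAt_id z).sub_const c).const_smul s).const_add k)
  have h2 : HasFDerivAt (fun z => mollifier c d z * L (k + s • (z - c))) _ z :=
    (hasFDerivAt_mollifier c d z).mul h1
  rw [h2.fderiv]
  simp

/-- The derivative of the average of a Sobolev function along an affine path of discs. -/
theorem hasDerivAt_discAverage {X : Set ℂ} {f h₁ h₂ : ℂ → ℂ} (hf : IntegrableOn f X)
    (hh₁ : IntegrableOn h₁ X) (hh₂ : IntegrableOn h₂ X)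
    (H₁ : HasWeakDeriv X 1 f h₁) (H₂ : HasWeakDeriv X Complex.I f h₂) (c₀ c₁ : ℂ) (d₀ d₁ t : ℝ)
    (hd : 0 < d₀ + t * d₁) (hX : Metric.closedBall (c₀ + t • c₁) (d₀ + t * d₁) ⊆ X) :
    HasDerivAt (fun t : ℝ => discAverage X f (c₀ + t • c₁) (d₀ + t * d₁))
      (∫ z in X, (mollifier (c₀ + t • c₁) (d₀ + t * d₁) z : ℂ) *
        (((c₁ + (d₁ / (d₀ + t * d₁)) • (z - (c₀ + t • c₁))).re : ℂ) * h₁ z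
          + ((c₁ + (d₁ / (d₀ + t * d₁)) • (z - (c₀ + t • c₁))).im : ℂ) * h₂ z)) t := by
  set D : ℝ → ℂ → ℝ := fun t z => -((d₀ + t * d₁) ^ 3)⁻¹ *
    (2 * d₁ * rho ((d₀ + t * d₁)⁻¹ • (z - (c₀ + t • c₁)))
      + fderiv ℝ rho ((d₀ + t * d₁)⁻¹ • (z - (c₀ + t • c₁)))
          (c₁ + d₁ • ((d₀ + t * d₁)⁻¹ • (z - (c₀ + t • c₁))))) with hD
  set d := d₀ + t * d₁ with hdd
  set c := c₀ + t • c₁ with hcc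
  set B : ℝ := ((d / 2) ^ 3)⁻¹ * (2 * |d₁| * rhoBound + rhoBound * (‖c₁‖ + |d₁|)) with hB
  have hcontD : ∀ s, Continuous (D s) := fun s => by
    have := rho_contDiff.continuous
    have h2 := rho_contDiff.continuous_fderiv (n := (⊤ : ℕ∞)) (by simp)
    refine continuous_const.mul ((continuous_const.mul (this.comp (by fun_prop))).add ?_)
    exact (h2.comp (by fun_prop)).clm_apply (by fun_prop)
  have hnear : {s : ℝ | d / 2 < d₀ + s * d₁} ∈ nhds t :=
    (isOpen_lt continuous_const (by fun_prop)).mem_nhds (by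
      change d / 2 < d; linarith)
  have hbound : ∀ s, d / 2 < d₀ + s * d₁ → ∀ z, |D s z| ≤ B := fun s hs z => by
    have hs0 : 0 < d₀ + s * d₁ := (by positivity : 0 < d / 2).trans hs
    rw [hD, hB]
    simp only [abs_mul, abs_neg, abs_inv, abs_pow]
    refine mul_le_mul ?_ ?_ (abs_nonneg _) (by positivity)
    · rw [abs_of_pos hs0]
      gcongr
    · refine (abs_add_le _ _).trans (add_le_add ?_ ?_)
      · rw [abs_mul, abs_mul, abs_two, abs_of_nonneg (rho_nonneg _)]
        gcongr
        exact rho_le _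
      · set w := (d₀ + s * d₁)⁻¹ • (z - (c₀ + s • c₁))
        by_cases hw : 1 < ‖w‖
        · rw [fderiv_rho_eq_zero hw]
          have := rhoBound_pos
          simp only [zero_apply, abs_zero]; positivity
        · refine ((fderiv ℝ rho w).le_opNorm _).trans ?_
          gcongr
          · exact rhoBound_pos.le
          · exact norm_fderiv_rho_le w
          · refine (norm_add_le _ _).trans (add_le_add le_rfl ?_)
            rw [norm_smul, Real.norm_eq_abs]
            exact mul_le_of_le_one_right (abs_nonneg _) (not_lt.1 hw)
  have main : HasDerivAt (fun t : ℝ => discAverage X f (c₀ + t • c₁) (d₀ + t * d₁))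
      (∫ z in X, (D t z : ℂ) * f z) t := by
    refine (hasDerivAt_integral_of_dominated_loc_of_deriv_le (F' := fun t z => (D t z : ℂ) * f z)
      (bound := fun z => B * ‖f z‖) hnear
      (Filter.Eventually.of_forall fun s => (integrable_mollifier_mul hf _ _).1)
      (integrable_mollifier_mul hf _ _)
      ((Complex.continuous_ofReal.comp (hcontD t)).aestronglyMeasurable.mul hf.1) ?_
      (hf.norm.const_mul B) ?_).2
    · refine Filter.Eventually.of_forall fun z s hs => ?_
      rw [norm_mul, Complex.norm_real, Real.norm_eq_abs]
      gcongr
      exact hbound s hs z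
    · refine Filter.Eventually.of_forall fun z s hs => ?_
      have hs0 : 0 < d₀ + s * d₁ := (by positivity : 0 < d / 2).trans hs
      exact ((hasDerivAt_mollifier_path c₀ c₁ d₀ d₁ s hs0 z).ofReal_comp).mul_const (f z)
  convert! main using 1
  -- the derivative of the kernel is minus the divergence of the kernel times the velocity field
  have htest : ∀ L : ℂ →L[ℝ] ℝ,
      ContDiff ℝ (⊤ : ℕ∞) (fun z => mollifier c d z * L (c₁ + (d₁ / d) • (z - c))) ∧
      HasCompactSupport (fun z => mollifier c d z * L (c₁ + (d₁ / d) • (z - c))) ∧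
      tsupport (fun z => mollifier c d z * L (c₁ + (d₁ / d) • (z - c))) ⊆ X := fun L => by
    refine ⟨(mollifier_contDiff c d).mul (L.contDiff.comp
      (contDiff_const.add ((contDiff_id.sub contDiff_const).const_smul _))),
      (hasCompactSupport_mollifier hd).mul_right, ?_⟩
    exact (tsupport_mul_subset_left (f := mollifier c d)).trans
      ((tsupport_mollifier_subset hd).trans hX)
  have e1 := H₁.2 _ (htest Complex.reCLM).1 (htest Complex.reCLM).2.1 (htest Complex.reCLM).2.2
  have e2 := H₂.2 _ (htest Complex.imCLM).1 (htest Complex.imCLM).2.1 (htest Complex.imCLM).2.2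
  have hb : ∀ {φ : ℂ → ℝ} {k : ℂ → ℂ}, Continuous φ → HasCompactSupport φ → IntegrableOn k X →
      Integrable (fun z => φ z • k z) (volume.restrict X) := fun {φ k} h1 h2 h3 => by
    obtain ⟨C, hC⟩ := h2.exists_bound_of_continuous h1
    exact h3.bdd_smul C h1.aestronglyMeasurable (Filter.Eventually.of_forall hC)
  have i1 := hb (htest Complex.reCLM).1.continuous (htest Complex.reCLM).2.1 hh₁
  have i2 := hb (htest Complex.imCLM).1.continuous (htest Complex.imCLM).2.1 hh₂
  have i3 := hb (((htest Complex.reCLM).1.continuous_fderiv (by simp)).clm_apply continuous_const)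
    ((htest Complex.reCLM).2.1.fderiv_apply ℝ 1) hf
  have i4 := hb (((htest Complex.imCLM).1.continuous_fderiv (by simp)).clm_apply continuous_const)
    ((htest Complex.imCLM).2.1.fderiv_apply ℝ Complex.I) hf
  calc ∫ z in X, (mollifier c d z : ℂ) * (((c₁ + (d₁ / d) • (z - c)).re : ℂ) * h₁ z
          + ((c₁ + (d₁ / d) • (z - c)).im : ℂ) * h₂ z)
      = ∫ z in X, ((mollifier c d z * Complex.reCLM (c₁ + (d₁ / d) • (z - c))) • h₁ z
          + (mollifier c d z * Complex.imCLM (c₁ + (d₁ / d) • (z - c))) • h₂ z) := by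
        congr 1; ext z
        simp only [Complex.reCLM_apply, Complex.imCLM_apply, Complex.real_smul]
        push_cast; ring
    _ = -((∫ z in X, fderiv ℝ (fun z => mollifier c d z *
            Complex.reCLM (c₁ + (d₁ / d) • (z - c))) z 1 • f z)
          + ∫ z in X, fderiv ℝ (fun z => mollifier c d z *
            Complex.imCLM (c₁ + (d₁ / d) • (z - c))) z Complex.I • f z) := by
        rw [integral_add i1 i2, e1, e2]; ring
    _ = ∫ z in X, (D t z : ℂ) * f z := by
        rw [← integral_add i3 i4, ← integral_neg]
        congr 1; ext z
        rw [← add_smul, ← neg_smul, Complex.real_smul]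
        congr 2
        rw [fderiv_mollifier_mul, fderiv_mollifier_mul, hD]
        simp only [← hcc, ← hdd]
        set w := d⁻¹ • (z - c) with hw
        have hV : c₁ + (d₁ / d) • (z - c) = c₁ + d₁ • w := by
          rw [hw, smul_smul, div_eq_mul_inv]
        have hlin : fderiv ℝ rho w (c₁ + d₁ • w) = (c₁ + d₁ • w).re * fderiv ℝ rho w 1
            + (c₁ + d₁ • w).im * fderiv ℝ rho w Complex.I := by
          rw [← smul_eq_mul, ← smul_eq_mul, ← map_smul, ← map_smul, ← map_add]
          congr 1
          apply Complex.ext <;> simp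
        rw [hV, hlin, mollifier]
        simp only [Complex.reCLM_apply, Complex.imCLM_apply, Complex.one_re, Complex.I_im]
        rw [← hw]
        field_simp
        ring

/-! ### Morrey's estimate for disc averages -/

theorem inv_toReal_nonneg_lt_half {p : ℝ≥0∞} (hp : 2 < p) :
    0 ≤ 1 / p.toReal ∧ 1 / p.toReal < 1 / 2 := by
  refine ⟨by positivity, ?_⟩
  by_cases h : p = ∞
  · simp [h]
  · have : (2 : ℝ) < p.toReal := by
      rw [← ENNReal.toReal_ofNat]
      exact (ENNReal.toReal_lt_toReal (by simp) h).2 hp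
    exact one_div_lt_one_div_of_lt (by norm_num) this

/-- Hölder's inequality on a disc of radius `d`; the exponent `-2 / p` is the source of the Hölder
exponent `1 - 2 / p` of Morrey's embedding. -/
theorem integral_norm_closedBall_le {p : ℝ≥0∞} (hp : 2 < p) {X : Set ℂ} {h : ℂ → ℂ}
    (hm : MemLp h p (volume.restrict X)) {N : ℝ}
    (hN : eLpNorm h p (volume.restrict X) ≤ ENNReal.ofReal N) (hN0 : 0 ≤ N) {c : ℂ} {d : ℝ}
    (hd : 0 < d) (hX : Metric.closedBall c d ⊆ X) :
    ∫ z in Metric.closedBall c d, ‖h z‖ ≤ Real.pi * N * d ^ 2 * d ^ (-2 * (1 / p.toReal)) := by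
  obtain ⟨hb0, hb1⟩ := inv_toReal_nonneg_lt_half hp
  set b := 1 / p.toReal
  have hle : volume.restrict (Metric.closedBall c d) ≤ volume.restrict X :=
    Measure.restrict_mono_set _ hX
  have hm' : MemLp h p (volume.restrict (Metric.closedBall c d)) := hm.mono_measure hle
  have h1 := eLpNorm_le_eLpNorm_mul_rpow_measure_univ (p := 1) (q := p)
    ((by norm_num : (1 : ℝ≥0∞) ≤ 2).trans hp.le) hm'.1
  rw [Measure.restrict_apply_univ, Complex.volume_closedBall, ENNReal.toReal_one] at h1
  have h2 : eLpNorm h 1 (volume.restrict (Metric.closedBall c d)) ≤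
      ENNReal.ofReal (N * (d ^ 2 * Real.pi) ^ (1 - b)) := by
    refine h1.trans ?_
    rw [ENNReal.ofReal_mul hN0, ← ENNReal.ofReal_rpow_of_pos (by positivity),
      ENNReal.ofReal_mul (by positivity), ENNReal.ofReal_pow hd.le, one_div_one]
    have : ENNReal.ofReal Real.pi = (NNReal.pi : ℝ≥0∞) := by
      rw [← NNReal.coe_real_pi, ENNReal.ofReal_coe_nnreal]
    rw [this]
    gcongr
    exact (eLpNorm_mono_measure h hle).trans hN
  have h3 : ∫ z in Metric.closedBall c d, ‖h z‖ ≤ N * (d ^ 2 * Real.pi) ^ (1 - b) := by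
    rw [integral_norm_eq_lintegral_enorm hm'.1, ← eLpNorm_one_eq_lintegral_enorm]
    exact ENNReal.toReal_le_of_le_ofReal (by positivity) h2
  refine h3.trans ?_
  have h4 : Real.pi ^ (1 - b) ≤ Real.pi := by
    conv_rhs => rw [← Real.rpow_one Real.pi]
    exact Real.rpow_le_rpow_of_exponent_le (by linarith [Real.pi_gt_three]) (by linarith)
  have h5 : (d ^ 2 : ℝ) ^ (1 - b) = d ^ 2 * d ^ (-2 * b) := by
    rw [← Real.rpow_natCast, ← Real.rpow_mul hd.le, ← Real.rpow_add hd]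
    congr 1; push_cast; ring
  rw [Real.mul_rpow (by positivity) Real.pi_pos.le, h5]
  calc N * (d ^ 2 * d ^ (-2 * b) * Real.pi ^ (1 - b))
      ≤ N * (d ^ 2 * d ^ (-2 * b) * Real.pi) := by gcongr
    _ = _ := by ring

theorem IsOpen.integrableOn_of_memLp {p : ℝ≥0∞} (hp : 2 < p) {X : Set ℂ}
    (hb : Bornology.IsBounded X) {f : ℂ → ℂ} (hf : MemLp f p (volume.restrict X)) :
    IntegrableOn f X :=
  haveI : IsFiniteMeasure (volume.restrict X) := ⟨by
    rw [Measure.restrict_apply_univ]; exact hb.measure_lt_top⟩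
  hf.integrable ((by norm_num : (1 : ℝ≥0∞) ≤ 2).trans hp.le)

/-- Integrals against a kernel of size `d⁻²` on a disc of radius `d`. -/
theorem norm_integral_mollifier_mul_le {X : Set ℂ} (hX : MeasurableSet X) {k : ℂ → ℂ} {h : ℂ → ℝ}
    {c : ℂ} {d : ℝ}
    (hd : 0 < d) (hs : Metric.closedBall c d ⊆ X) (hk : IntegrableOn h (Metric.closedBall c d))
    (hkh : ∀ z ∈ Metric.closedBall c d, ‖k z‖ ≤ h z) :
    ‖∫ z in X, (mollifier c d z : ℂ) * k z‖ ≤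
      (d ^ 2)⁻¹ * rhoBound * ∫ z in Metric.closedBall c d, h z := by
  have : ∫ z in X, (mollifier c d z : ℂ) * k z
      = ∫ z in Metric.closedBall c d, (mollifier c d z : ℂ) * k z :=
    setIntegral_eq_of_subset_of_forall_sdiff_eq_zero hX hs
      fun z hz => by rw [mollifier_eq_zero hd hz.2]; simp
  rw [this, ← integral_const_mul]
  refine norm_integral_le_of_norm_le (hk.const_mul _) ?_
  refine (ae_restrict_iff' Metric.isClosed_closedBall.measurableSet).2
    (Filter.Eventually.of_forall fun z hz => ?_)
  rw [norm_mul, Complex.norm_real, Real.norm_of_nonneg (mollifier_nonneg _ _ _)]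
  exact mul_le_mul (mollifier_le _ _ _) (hkh z hz) (norm_nonneg _)
    (mul_nonneg (by positivity) rhoBound_pos.le)

/-- The constant in the estimates of disc averages. -/
noncomputable def morreyConst : ℝ := 2 * Real.pi * rhoBound

theorem morreyConst_pos : 0 < morreyConst := by
  have := rhoBound_pos
  unfold morreyConst; positivity

section

variable {p : ℝ≥0∞} {X : Set ℂ} {f : ℂ → ℂ}

theorem MemSobolev.eLpNorm_le (hp : 2 < p) (hX : IsOpen X) (hf : MemSobolev p X f) :
    eLpNorm f p (volume.restrict X) ≤ ENNReal.ofReal (sobolevNorm p X f).toReal ∧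
    eLpNorm (weakDeriv X 1 f) p (volume.restrict X)
      ≤ ENNReal.ofReal (sobolevNorm p X f).toReal ∧
    eLpNorm (weakDeriv X Complex.I f) p (volume.restrict X)
      ≤ ENNReal.ofReal (sobolevNorm p X f).toReal := by
  rw [ENNReal.ofReal_toReal (hf.sobolevNorm_ne_top hX)]
  exact lpNormOn_le_sobolevNorm (lt_trans (by norm_num) hp) X f

theorem norm_discAverage_le (hp : 2 < p) (hX : IsOpen X) (hf : MemSobolev p X f)
    {c : ℂ} {d : ℝ} (hd : 0 < d) (hs : Metric.closedBall c d ⊆ X) :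
    ‖discAverage X f c d‖ ≤
      morreyConst * (sobolevNorm p X f).toReal * d ^ (-2 * (1 / p.toReal)) := by
  have hN : 0 ≤ (sobolevNorm p X f).toReal := ENNReal.toReal_nonneg
  have hm : MemLp f p (volume.restrict X) := hf.1
  have hball : IntegrableOn f (Metric.closedBall c d) :=
    IsOpen.integrableOn_of_memLp hp Metric.isBounded_closedBall
      (hm.mono_measure (Measure.restrict_mono_set _ hs))
  refine (norm_integral_mollifier_mul_le hX.measurableSet hd hs hball.norm
    (fun z _ => le_rfl)).trans ?_
  have h1 := integral_norm_closedBall_le hp hm (hf.eLpNorm_le hp hX).1 hN hd hs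
  have := rhoBound_pos
  calc (d ^ 2)⁻¹ * rhoBound * ∫ z in Metric.closedBall c d, ‖f z‖
      ≤ (d ^ 2)⁻¹ * rhoBound * (Real.pi * (sobolevNorm p X f).toReal * d ^ 2
          * d ^ (-2 * (1 / p.toReal))) := by gcongr
    _ = 1 * (Real.pi * rhoBound * (sobolevNorm p X f).toReal * d ^ (-2 * (1 / p.toReal))) := by
        field_simp
    _ ≤ 2 * (Real.pi * rhoBound * (sobolevNorm p X f).toReal * d ^ (-2 * (1 / p.toReal))) := by
        gcongr; norm_num
    _ = _ := by unfold morreyConst; ring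

/-- The average over a moving disc changes at a rate controlled by the Sobolev norm. -/
theorem exists_hasDerivAt_discAverage (hp : 2 < p) (hX : IsOpen X) (hb : Bornology.IsBounded X)
    (hf : MemSobolev p X f) (c₀ c₁ : ℂ) (d₀ d₁ t : ℝ) (hd : 0 < d₀ + t * d₁)
    (hs : Metric.closedBall (c₀ + t • c₁) (d₀ + t * d₁) ⊆ X) :
    ∃ A : ℂ, HasDerivAt (fun t : ℝ => discAverage X f (c₀ + t • c₁) (d₀ + t * d₁)) A t ∧
      ‖A‖ ≤ morreyConst * (sobolevNorm p X f).toReal * (‖c₁‖ + |d₁|)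
        * (d₀ + t * d₁) ^ (-2 * (1 / p.toReal)) := by
  have hN : 0 ≤ (sobolevNorm p X f).toReal := ENNReal.toReal_nonneg
  have hm1 := hf.memLp_one hX
  have hm2 := hf.memLp_I hX
  refine ⟨_, hasDerivAt_discAverage (IsOpen.integrableOn_of_memLp hp hb hf.1)
    (IsOpen.integrableOn_of_memLp hp hb hm1) (IsOpen.integrableOn_of_memLp hp hb hm2)
    hf.hasWeakDeriv_one hf.hasWeakDeriv_I c₀ c₁ d₀ d₁ t hd hs, ?_⟩
  set d := d₀ + t * d₁
  set c := c₀ + t • c₁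
  have i1 := (IsOpen.integrableOn_of_memLp hp Metric.isBounded_closedBall
    (hm1.mono_measure (Measure.restrict_mono_set volume hs))).norm
  have i2 := (IsOpen.integrableOn_of_memLp hp Metric.isBounded_closedBall
    (hm2.mono_measure (Measure.restrict_mono_set volume hs))).norm
  refine (norm_integral_mollifier_mul_le (h := fun z => (‖c₁‖ + |d₁|) * (‖weakDeriv X 1 f z‖
    + ‖weakDeriv X Complex.I f z‖)) hX.measurableSet hd hs ((i1.add i2).const_mul _)
    fun z hz => ?_).trans ?_
  · have hV : ‖c₁ + (d₁ / d) • (z - c)‖ ≤ ‖c₁‖ + |d₁| := by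
      refine (norm_add_le _ _).trans (add_le_add le_rfl ?_)
      rw [norm_smul, Real.norm_eq_abs, abs_div, abs_of_pos hd]
      have : ‖z - c‖ ≤ d := by simpa [dist_eq_norm] using hz
      calc |d₁| / d * ‖z - c‖ ≤ |d₁| / d * d := by gcongr
        _ = |d₁| := by field_simp
    refine (norm_add_le _ _).trans ?_
    rw [norm_mul, norm_mul, Complex.norm_real, Complex.norm_real, mul_add]
    gcongr
    · exact (Complex.abs_re_le_norm _).trans hV
    · exact (Complex.abs_im_le_norm _).trans hV
  · have h1 := integral_norm_closedBall_le hp hm1 (hf.eLpNorm_le hp hX).2.1 hN hd hs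
    have h2 := integral_norm_closedBall_le hp hm2 (hf.eLpNorm_le hp hX).2.2 hN hd hs
    rw [integral_const_mul, integral_add i1 i2]
    have := rhoBound_pos
    set s := (sobolevNorm p X f).toReal
    calc (d ^ 2)⁻¹ * rhoBound * ((‖c₁‖ + |d₁|) *
          ((∫ z in Metric.closedBall c d, ‖weakDeriv X 1 f z‖)
            + ∫ z in Metric.closedBall c d, ‖weakDeriv X Complex.I f z‖))
        ≤ (d ^ 2)⁻¹ * rhoBound * ((‖c₁‖ + |d₁|) *
          (Real.pi * s * d ^ 2 * d ^ (-2 * (1 / p.toReal))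
            + Real.pi * s * d ^ 2 * d ^ (-2 * (1 / p.toReal)))) := by gcongr
      _ = _ := by unfold morreyConst; field_simp; ring

/-- Moving a disc of radius `d` along a segment. -/
theorem norm_discAverage_sub_le (hp : 2 < p) (hX : IsOpen X) (hb : Bornology.IsBounded X)
    (hf : MemSobolev p X f) (c c' : ℂ) {d : ℝ} (hd : 0 < d)
    (hs : ∀ t ∈ Icc (0 : ℝ) 1, Metric.closedBall (c + t • (c' - c)) d ⊆ X) :
    ‖discAverage X f c' d - discAverage X f c d‖ ≤
      morreyConst * (sobolevNorm p X f).toReal * ‖c' - c‖ * d ^ (-2 * (1 / p.toReal)) := by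
  have key : ∀ t ∈ Icc (0 : ℝ) 1, ∃ A : ℂ,
      HasDerivAt (fun t : ℝ => discAverage X f (c + t • (c' - c)) (d + t * 0)) A t ∧
      ‖A‖ ≤ morreyConst * (sobolevNorm p X f).toReal * ‖c' - c‖ * d ^ (-2 * (1 / p.toReal)) :=
    fun t ht => by
      simpa using exists_hasDerivAt_discAverage hp hX hb hf c (c' - c) d 0 t (by simpa using hd)
        (by simpa using hs t ht)
  choose! A hA hA' using key
  have := (convex_Icc (0 : ℝ) 1).norm_image_sub_le_of_norm_hasDerivWithin_le
    (fun t ht => (hA t ht).hasDerivWithinAt) (fun t ht => hA' t ht)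
    (left_mem_Icc.2 zero_le_one) (right_mem_Icc.2 zero_le_one)
  simpa using this

/-- Shrinking the disc with centre `y + d • e` and radius `d` to the point `y`. -/
theorem norm_discAverage_zoom_le (hp : 2 < p) (hX : IsOpen X) (hb : Bornology.IsBounded X)
    (hf : MemSobolev p X f) (y e : ℂ) {R : ℝ}
    (hs : ∀ d : ℝ, 0 < d → d ≤ R → Metric.closedBall (y + d • e) d ⊆ X) {d d' : ℝ} (hd' : 0 < d')
    (hdd : d' ≤ d) (hdR : d ≤ R) :
    ‖discAverage X f (y + d • e) d - discAverage X f (y + d' • e) d'‖ ≤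
      morreyConst * (sobolevNorm p X f).toReal * (‖e‖ + 1) * (1 - 2 * (1 / p.toReal))⁻¹
        * d ^ (1 - 2 * (1 / p.toReal)) := by
  obtain ⟨hb0, hb1⟩ := inv_toReal_nonneg_lt_half hp
  set b := 1 / p.toReal
  have ha : 0 < 1 - 2 * b := by linarith
  set M := morreyConst * (sobolevNorm p X f).toReal * (‖e‖ + 1) with hM
  have hM0 : 0 ≤ M := by
    have := morreyConst_pos
    positivity
  have key : ∀ t ∈ Icc d' d, ∃ A : ℂ,
      HasDerivAt (fun t : ℝ => discAverage X f (y + t • e) t) A t ∧ ‖A‖ ≤ M * t ^ (-2 * b) :=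
    fun t ht => by
      simpa [M, b] using exists_hasDerivAt_discAverage hp hX hb hf y e 0 1 t
        (by simpa using hd'.trans_le ht.1)
        (by simpa using hs t (hd'.trans_le ht.1) (ht.2.trans hdR))
  choose! A hA hA' using key
  set F : ℝ → ℂ := fun t => discAverage X f (y + t • e) t
  have hB : ∀ t, 0 < t → HasDerivAt (fun t : ℝ => M * (1 - 2 * b)⁻¹ * (t ^ (1 - 2 * b)
      - d' ^ (1 - 2 * b))) (M * t ^ (-2 * b)) t := fun t ht => by
    convert! ((Real.hasDerivAt_rpow_const (p := 1 - 2 * b) (Or.inl ht.ne')).sub_const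
      (d' ^ (1 - 2 * b))).const_mul (M * (1 - 2 * b)⁻¹) using 1
    rw [show 1 - 2 * b - 1 = -2 * b by ring]
    field_simp
  have := image_norm_le_of_norm_deriv_right_le_deriv_boundary' (f := fun t => F t - F d')
    (f' := A) (a := d') (b := d) (B := fun t : ℝ => M * (1 - 2 * b)⁻¹ * (t ^ (1 - 2 * b)
      - d' ^ (1 - 2 * b))) (B' := fun t => M * t ^ (-2 * b))
    (fun t ht => ((hA t ht).continuousAt.continuousWithinAt).sub continuousWithinAt_const)
    (fun t ht => ((hA t ⟨ht.1, ht.2.le⟩).sub_const _).hasDerivWithinAt) (by simp)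
    (fun t ht => (hB t (hd'.trans_le ht.1)).continuousAt.continuousWithinAt)
    (fun t ht => (hB t (hd'.trans_le ht.1)).hasDerivWithinAt)
    (fun t ht => hA' t ⟨ht.1, ht.2.le⟩) (x := d) ⟨hdd, le_rfl⟩
  refine this.trans ?_
  have : 0 ≤ d' ^ (1 - 2 * b) := by positivity
  gcongr
  linarith

/-- Weighted averages over discs shrinking to a point recover the function almost everywhere. -/
theorem ae_tendsto_discAverage (hX : IsOpen X) (hf : IntegrableOn f X) (e : ℂ) :
    ∀ᵐ z, z ∈ X → Filter.Tendsto (fun d : ℝ => discAverage X f (z + d • e) d)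
      (nhdsWithin 0 (Ioi 0)) (nhds (f z)) := by
  have hF : Integrable (X.indicator f) := (integrable_indicator_iff hX.measurableSet).2 hf
  filter_upwards [IsUnifLocDoublingMeasure.ae_tendsto_average_norm_sub volume
    hF.locallyIntegrable ‖e‖] with z hz hzX
  have h1 := hz (fun d : ℝ => z + d • e) id Filter.tendsto_id (by
    filter_upwards [self_mem_nhdsWithin] with d hd
    have hd : 0 < d := hd
    simp [dist_eq_norm, abs_of_pos hd, mul_comm])
  rw [tendsto_iff_norm_sub_tendsto_zero]
  have h2 := h1.const_mul (Real.pi * rhoBound)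
  rw [mul_zero] at h2
  refine squeeze_zero' (Filter.Eventually.of_forall fun _ => norm_nonneg _) ?_ h2
  filter_upwards [self_mem_nhdsWithin] with d hd
  have hd : 0 < d := hd
  have e1 : discAverage X f (z + d • e) d - f z
      = ∫ w in univ, (mollifier (z + d • e) d w : ℂ) * (X.indicator f w - X.indicator f z) := by
    have i1 := integrable_mollifier_mul (X := univ) hF.integrableOn (z + d • e) d
    have i2 : Integrable (fun w => (mollifier (z + d • e) d w : ℂ) * X.indicator f z) :=
      Integrable.mul_const (Integrable.ofReal
        ((mollifier_contDiff _ _).continuous.integrable_of_hasCompactSupport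
          (hasCompactSupport_mollifier hd))) _
    simp only [mul_sub]
    rw [setIntegral_univ] at *
    rw [Measure.restrict_univ] at i1
    rw [integral_sub i1 i2, integral_mul_const, integral_complex_ofReal, integral_mollifier hd,
      indicator_of_mem hzX, Complex.ofReal_one, one_mul, discAverage,
      ← integral_indicator hX.measurableSet]
    congr 2; ext w
    by_cases hw : w ∈ X <;> simp [hw]
  rw [e1]
  have i3 : IntegrableOn (fun w => ‖X.indicator f w - X.indicator f z‖)
      (Metric.closedBall (z + d • e) d) :=
    (hF.integrableOn.sub (integrableOn_const (by
      exact Metric.isBounded_closedBall.measure_lt_top.ne))).norm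
  refine (norm_integral_mollifier_mul_le MeasurableSet.univ hd (subset_univ _) i3
    fun _ _ => le_rfl).trans (le_of_eq ?_)
  rw [setAverage_eq, Measure.real, Complex.volume_closedBall]
  simp only [id, smul_eq_mul, ENNReal.toReal_mul, ENNReal.toReal_pow,
    ENNReal.toReal_ofReal hd.le, ENNReal.coe_toReal, NNReal.coe_real_pi]
  have := Real.pi_pos.ne'
  field_simp

end

/-! ### The Sobolev embedding on Lipschitz domains -/

/-- A uniform interior cone condition for `X` near `x`: from every point of the closure of `X` in
the disc of radius `R` about `x`, and in fact from every point of a segment of length at most `d`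
joining two such points, the disc of radius `d` displaced by `d • e` lies in `X`. -/
def HasUniformCone (X : Set ℂ) (e : ℂ) (R : ℝ) (x : ℂ) : Prop :=
  0 < R ∧ ∀ y ∈ closure X ∩ Metric.ball x R, ∀ y' ∈ closure X ∩ Metric.ball x R, ∀ d : ℝ, 0 < d →
    d ≤ R → ‖y' - y‖ ≤ d → ∀ t ∈ Icc (0 : ℝ) 1, Metric.closedBall (y + d • e + t • (y' - y)) d ⊆ X

/-- `(u, r, K, γ)` are local graph coordinates of `X` near `x`. -/
def IsGraphChart (X : Set ℂ) (x u : ℂ) (r : ℝ) (K : ℝ≥0) (γ : ℝ → ℝ) : Prop :=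
  ‖u‖ = 1 ∧ 0 < r ∧ LipschitzWith K γ ∧
    ∀ w : ℂ, |w.re| < r → |w.im| < r → (x + u * w ∈ X ↔ w.im < γ w.re)

theorem IsOpenLipschitz.exists_chart {X : Set ℂ} (hX : IsOpenLipschitz X) {x : ℂ}
    (hx : x ∈ frontier X) : ∃ u r K γ, IsGraphChart X x u r K γ := by
  obtain ⟨u, hu, r, hr, K, γ, hγ, h⟩ := hX.2 x hx
  refine ⟨u, r, K, γ, hu, hr, hγ, fun w h1 h2 => ?_⟩
  have := h w.re w.im h1 h2
  rwa [Complex.re_add_im] at this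

section

variable {X : Set ℂ} {x u : ℂ} {r : ℝ} {K : ℝ≥0} {γ : ℝ → ℝ}

theorem IsGraphChart.eq_coord (h : IsGraphChart X x u r K γ) (z : ℂ) :
    x + u * (u⁻¹ * (z - x)) = z := by
  have : u ≠ 0 := fun h0 => by simpa [h0] using h.1
  field_simp
  ring

theorem IsGraphChart.norm_coord (h : IsGraphChart X x u r K γ) (z : ℂ) :
    ‖u⁻¹ * (z - x)‖ = ‖z - x‖ := by
  rw [norm_mul, norm_inv, h.1, inv_one, one_mul]

theorem IsGraphChart.mem_iff (h : IsGraphChart X x u r K γ) {z : ℂ} (hz : ‖z - x‖ < r) :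
    z ∈ X ↔ (u⁻¹ * (z - x)).im < γ (u⁻¹ * (z - x)).re := by
  have h1 : ‖u⁻¹ * (z - x)‖ < r := by rwa [h.norm_coord]
  have := h.2.2.2 (u⁻¹ * (z - x)) ((Complex.abs_re_le_norm _).trans_lt h1)
    ((Complex.abs_im_le_norm _).trans_lt h1)
  rwa [h.eq_coord] at this

theorem IsGraphChart.le_of_mem_closure (h : IsGraphChart X x u r K γ) {z : ℂ} (hz : ‖z - x‖ < r)
    (hzX : z ∈ closure X) : (u⁻¹ * (z - x)).im ≤ γ (u⁻¹ * (z - x)).re := by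
  by_contra! hlt
  have hγ := h.2.2.1.continuous
  have ho : IsOpen ({z : ℂ | ‖z - x‖ < r} ∩
      {z : ℂ | γ (u⁻¹ * (z - x)).re < (u⁻¹ * (z - x)).im}) := by
    have hc : Continuous fun z : ℂ => u⁻¹ * (z - x) := by fun_prop
    have hn : Continuous fun z : ℂ => ‖z - x‖ := by fun_prop
    exact (isOpen_lt hn continuous_const).inter (isOpen_lt
      (hγ.comp (Complex.continuous_re.comp hc)) (Complex.continuous_im.comp hc))
  obtain ⟨w, hw, hwX⟩ := mem_closure_iff.1 hzX _ ho ⟨hz, hlt⟩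
  exact absurd ((h.mem_iff hw.1).1 hwX) hw.2.le.not_gt

/-- Going down from a segment joining two points below a `K`-Lipschitz graph, by `2K + 2` times
its length, leads to a point below the graph, with some room to spare. -/
theorem below_graph_of_cone {K : ℝ≥0} {γ : ℝ → ℝ} (hγ : LipschitzWith K γ) {w w' η : ℂ} {d t : ℝ}
    (h1 : w.im ≤ γ w.re) (h2 : w'.im ≤ γ w'.re) (hd : 0 < d) (hww : ‖w' - w‖ ≤ d) (hηn : ‖η‖ ≤ d)
    (ht : t ∈ Icc (0 : ℝ) 1) :
    (w + t • (w' - w) + d • (((-(2 * K + 2) : ℝ) : ℂ) * Complex.I) + η).im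
      < γ (w + t • (w' - w) + d • (((-(2 * K + 2) : ℝ) : ℂ) * Complex.I) + η).re := by
  have hK : (0 : ℝ) ≤ K := K.2
  have hlip : ∀ a b : ℝ, γ a ≤ γ b + K * |a - b| := fun a b => by
    have := hγ.dist_le_mul a b
    rw [Real.dist_eq, Real.dist_eq] at this
    linarith [le_abs_self (γ a - γ b)]
  obtain ⟨σ, hσ⟩ : ∃ σ, σ = w.re + t * (w'.re - w.re) + η.re := ⟨_, rfl⟩
  have hre : (w + t • (w' - w) + d • (((-(2 * K + 2) : ℝ) : ℂ) * Complex.I) + η).re = σ := by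
    rw [hσ]; simp
  have him : (w + t • (w' - w) + d • (((-(2 * K + 2) : ℝ) : ℂ) * Complex.I) + η).im
      = w.im + t * (w'.im - w.im) - d * (2 * K + 2) + η.im := by
    simp; ring
  have hηre : |η.re| ≤ d := (Complex.abs_re_le_norm _).trans hηn
  have hηim : η.im ≤ d := (le_abs_self _).trans ((Complex.abs_im_le_norm _).trans hηn)
  have hwre : |w'.re - w.re| ≤ d := by
    rw [← Complex.sub_re]; exact (Complex.abs_re_le_norm _).trans hww
  rw [hre, him]
  clear hre him
  rw [abs_le] at hηre hwre
  have d1 : |w.re - σ| ≤ 2 * d := by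
    rw [hσ, abs_le]
    constructor <;> nlinarith [ht.1, ht.2]
  have d2 : |w'.re - σ| ≤ 2 * d := by
    rw [hσ, abs_le]
    constructor <;> nlinarith [ht.1, ht.2]
  have g1 : w.im ≤ γ σ + K * (2 * d) := h1.trans ((hlip _ _).trans (by gcongr))
  have g2 : w'.im ≤ γ σ + K * (2 * d) := h2.trans ((hlip _ _).trans (by gcongr))
  have g3 : w.im + t * (w'.im - w.im) ≤ γ σ + K * (2 * d) := by
    nlinarith [ht.1, ht.2]
  nlinarith

/-- A set lying below a Lipschitz graph satisfies the uniform cone condition. -/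
theorem IsGraphChart.hasUniformCone (h : IsGraphChart X x u r K γ) :
    ∃ e R, HasUniformCone X e R x := by
  have hr := h.2.1
  have hK : (0 : ℝ) ≤ K := K.2
  set M : ℝ := 2 * K + 2 with hM
  have hu0 : u ≠ 0 := fun h0 => by simpa [h0] using h.1
  have hM0 : 0 < M := by positivity
  refine ⟨u * ((-M : ℝ) * Complex.I), r / (M + 3), by positivity, ?_⟩
  rintro y ⟨hyX, hy⟩ y' ⟨hyX', hy'⟩ d hd hdR hyy t ht z hz
  have hR : r / (M + 3) * (M + 3) = r := by field_simp
  set R := r / (M + 3)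
  have hR0 : 0 < R := hd.trans_le hdR
  have hyn : ‖y - x‖ < R := by simpa [dist_eq_norm] using hy
  have hyn' : ‖y' - x‖ < R := by simpa [dist_eq_norm] using hy'
  have hRr : R < r := by nlinarith
  have h1 := h.le_of_mem_closure (hyn.trans hRr) hyX
  have h2 := h.le_of_mem_closure (hyn'.trans hRr) hyX'
  set w := u⁻¹ * (y - x) with hw
  set w' := u⁻¹ * (y' - x) with hw'
  set η := u⁻¹ * (z - (y + d • (u * ((-M : ℝ) * Complex.I)) + t • (y' - y))) with hη
  have hηn : ‖η‖ ≤ d := by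
    rw [hη, norm_mul, norm_inv, h.1, inv_one, one_mul]
    simpa [dist_eq_norm] using hz
  have hww : ‖w' - w‖ ≤ d := by
    have : w' - w = u⁻¹ * (y' - y) := by rw [hw, hw']; ring
    rw [this, norm_mul, norm_inv, h.1, inv_one, one_mul]
    exact hyy
  have hwn : ‖w‖ < R := by rw [hw, h.norm_coord]; exact hyn
  have hzw : u⁻¹ * (z - x) = w + t • (w' - w) + d • ((-M : ℝ) * Complex.I) + η := by
    rw [hη, hw, hw']
    simp only [Complex.real_smul]
    field_simp
    ring
  have htw : ‖t • (w' - w)‖ ≤ d := by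
    rw [norm_smul, Real.norm_of_nonneg ht.1]
    nlinarith [ht.1, ht.2, norm_nonneg (w' - w)]
  have hdM : ‖d • (((-M : ℝ) : ℂ) * Complex.I)‖ = d * M := by
    rw [norm_smul, norm_mul, Complex.norm_real, Complex.norm_I, Real.norm_eq_abs, Real.norm_eq_abs,
      abs_neg, abs_of_pos hd, abs_of_pos hM0, mul_one]
  have hzn : ‖z - x‖ < r := by
    rw [← h.norm_coord, hzw]
    calc _ ≤ ‖w‖ + ‖t • (w' - w)‖ + ‖d • (((-M : ℝ) : ℂ) * Complex.I)‖ + ‖η‖ :=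
          (norm_add_le _ _).trans (add_le_add ((norm_add_le _ _).trans
            (add_le_add (norm_add_le _ _) le_rfl)) le_rfl)
      _ < R + R + R * M + R := by
          rw [hdM]
          have : d * M ≤ R * M := by gcongr
          linarith
      _ = r := by rw [← hR]; ring
  rw [h.mem_iff hzn, hzw]
  exact below_graph_of_cone h.2.2.1 h1 h2 hd hww hηn ht

end

theorem IsOpenLipschitz.hasUniformCone {X : Set ℂ} (hX : IsOpenLipschitz X) {x : ℂ}
    (hx : x ∈ closure X) : ∃ e R, HasUniformCone X e R x := by
  by_cases hxX : x ∈ X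
  · obtain ⟨r, hr, hball⟩ := Metric.isOpen_iff.1 hX.1 x hxX
    refine ⟨0, r / 3, by positivity, ?_⟩
    rintro y ⟨-, hy⟩ y' ⟨-, hy'⟩ d hd hdR hyy t ht z hz
    refine hball ?_
    rw [Metric.mem_ball, dist_eq_norm] at *
    rw [Metric.mem_closedBall, dist_eq_norm, smul_zero, add_zero] at hz
    have : ‖t • (y' - y)‖ ≤ d := by
      rw [norm_smul, Real.norm_of_nonneg ht.1]
      nlinarith [ht.1, ht.2, norm_nonneg (y' - y)]
    calc ‖z - x‖ = ‖(z - (y + t • (y' - y))) + t • (y' - y) + (y - x)‖ := by congr 1; ring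
      _ ≤ ‖z - (y + t • (y' - y))‖ + ‖t • (y' - y)‖ + ‖y - x‖ :=
          (norm_add_le _ _).trans (add_le_add (norm_add_le _ _) le_rfl)
      _ < r := by linarith
  · obtain ⟨u, r, K, γ, h⟩ := hX.exists_chart (x := x)
      (by rw [hX.1.frontier_eq]; exact ⟨hx, hxX⟩)
    exact h.hasUniformCone

/-- Near a point with a uniform cone, every Sobolev function has a Hölder continuous
representative. -/
theorem HasUniformCone.exists_patch {p : ℝ≥0∞} (hp : 2 < p) {X : Set ℂ} (hX : IsOpen X)
    (hb : Bornology.IsBounded X) {e x : ℂ} {R : ℝ} (hC : HasUniformCone X e R x) :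
    ∃ C : ℝ, 0 ≤ C ∧ ∀ f, MemSobolev p X f → ∃ u : ℂ → ℂ,
      (∀ᵐ z, z ∈ X ∩ Metric.ball x R → u z = f z) ∧
      (∀ y ∈ closure X ∩ Metric.ball x R, ‖u y‖ ≤ C * (sobolevNorm p X f).toReal) ∧
      ∀ y ∈ closure X ∩ Metric.ball x R, ∀ y' ∈ closure X ∩ Metric.ball x R,
        ‖u y' - u y‖ ≤ C * (sobolevNorm p X f).toReal * ‖y' - y‖ ^ (1 - 2 * (1 / p.toReal)) := by
  obtain ⟨hR, hcone⟩ := hC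
  obtain ⟨hb0, hb1⟩ := inv_toReal_nonneg_lt_half hp
  -- the discs of radius `d` with centre `y + d • e` stay in `X` and shrink to `y` as `d → 0`
  have hzoom := fun (f : ℂ → ℂ) (hf : MemSobolev p X f) (y : ℂ)
      (hy : y ∈ closure X ∩ Metric.ball x R) =>
    fun {d d' : ℝ} => norm_discAverage_zoom_le hp hX hb hf y e (R := R) (d := d) (d' := d')
      (fun d hd hdR => by
        simpa using hcone y hy y hy d hd hdR (by simpa using hd.le) 0 (by simp))
  have hsup := fun (f : ℂ → ℂ) (hf : MemSobolev p X f) => @norm_discAverage_le p X f hp hX hf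
  have hhop := fun (f : ℂ → ℂ) (hf : MemSobolev p X f) => @norm_discAverage_sub_le p X f hp hX hb hf
  set b := 1 / p.toReal
  set a := 1 - 2 * b with ha_def
  have ha : 0 < a := by rw [ha_def]; linarith
  set k := morreyConst * (‖e‖ + 1) * a⁻¹ with hk
  have hmc := morreyConst_pos
  have hk0 : 0 < k := by positivity
  set C₁ := k * R ^ a + morreyConst * R ^ (-2 * b) with hC₁
  set C₂ := 2 * k + morreyConst with hC₂
  have hC₁0 : 0 < C₁ := by positivity
  have hC₂0 : 0 < C₂ := by positivity
  refine ⟨C₁ + C₂ + 2 * C₁ * (R ^ a)⁻¹, by positivity, fun f hf => ?_⟩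
  set N := (sobolevNorm p X f).toReal
  have hN : 0 ≤ N := ENNReal.toReal_nonneg
  have hz : ∀ y ∈ closure X ∩ Metric.ball x R, ∀ d d' : ℝ, 0 < d' → d' ≤ d → d ≤ R →
      ‖discAverage X f (y + d • e) d - discAverage X f (y + d' • e) d'‖ ≤ k * N * d ^ a :=
    fun y hy d d' h1 h2 h3 => (hzoom f hf y hy h1 h2 h3).trans (le_of_eq (by rw [hk]; ring))
  have hlim : ∀ y ∈ closure X ∩ Metric.ball x R, ∃ l, Filter.Tendsto
      (fun d : ℝ => discAverage X f (y + d • e) d) (nhdsWithin 0 (Ioi 0)) (nhds l) := by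
    intro y hy
    refine cauchy_map_iff_exists_tendsto.1 (Metric.cauchy_iff.2 ⟨inferInstance, fun ε hε => ?_⟩)
    have ht : Filter.Tendsto (fun d : ℝ => k * N * d ^ a) (nhdsWithin 0 (Ioi 0)) (nhds 0) := by
      have : Filter.Tendsto (fun d : ℝ => k * N * d ^ a) (nhds 0) (nhds (k * N * 0 ^ a)) :=
        (Real.continuousAt_rpow_const 0 a (Or.inr ha.le)).tendsto.const_mul _
      rw [Real.zero_rpow ha.ne', mul_zero] at this
      exact this.mono_left nhdsWithin_le_nhds
    obtain ⟨d₀, hd₀, hd₀'⟩ := ((ht.eventually (gt_mem_nhds hε)).and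
      (Ioo_mem_nhdsGT hR)).exists
    refine ⟨(fun d : ℝ => discAverage X f (y + d • e) d) '' Ioc 0 d₀,
      Filter.image_mem_map (Ioc_mem_nhdsGT hd₀'.1), ?_⟩
    have aux : ∀ d ∈ Ioc 0 d₀, ∀ d' ∈ Ioc 0 d₀, d' ≤ d →
        ‖discAverage X f (y + d • e) d - discAverage X f (y + d' • e) d'‖ < ε :=
      fun d hd d' hd' hle => by
        refine (hz y hy d d' hd'.1 hle (hd.2.trans hd₀'.2.le)).trans_lt (lt_of_le_of_lt ?_ hd₀)
        gcongr
        exacts [hd.1.le, hd.2]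
    rintro _ ⟨d, hd, rfl⟩ _ ⟨d', hd', rfl⟩
    rw [dist_eq_norm]
    rcases le_total d' d with h | h
    · exact aux d hd d' hd' h
    · rw [norm_sub_rev]; exact aux d' hd' d hd h
  choose! u hu using hlim
  have hclose : ∀ y ∈ closure X ∩ Metric.ball x R, ∀ d, 0 < d → d ≤ R →
      ‖discAverage X f (y + d • e) d - u y‖ ≤ k * N * d ^ a := fun y hy d hd hdR => by
    refine le_of_tendsto (((hu y hy).const_sub _).norm) ?_
    filter_upwards [Ioc_mem_nhdsGT hd] with d' hd'
    exact hz y hy d d' hd'.1 hd'.2 hdR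
  have hbd : ∀ y ∈ closure X ∩ Metric.ball x R, ‖u y‖ ≤ C₁ * N := fun y hy => by
    have h1 := hclose y hy R hR le_rfl
    have h2 := hsup f hf hR (by
      simpa using hcone y hy y hy R hR le_rfl (by simpa using hR.le) 0 (by simp))
    calc ‖u y‖ ≤ ‖discAverage X f (y + R • e) R‖ + ‖discAverage X f (y + R • e) R - u y‖ := by
          rw [norm_sub_rev]; exact norm_le_norm_add_norm_sub' _ _
      _ ≤ morreyConst * N * R ^ (-2 * b) + k * N * R ^ a := add_le_add h2 h1
      _ = C₁ * N := by rw [hC₁]; ring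
  have hRa : 0 < R ^ a := by positivity
  refine ⟨u, ?_, fun y hy => (hbd y hy).trans ?_, fun y hy y' hy' => ?_⟩
  · filter_upwards [ae_tendsto_discAverage hX (IsOpen.integrableOn_of_memLp hp hb hf.1) e]
      with z hz hzm
    exact tendsto_nhds_unique (hu z ⟨subset_closure hzm.1, hzm.2⟩) (hz hzm.1)
  · gcongr
    have : 0 ≤ 2 * C₁ * (R ^ a)⁻¹ := by positivity
    linarith
  · rcases eq_or_ne y' y with rfl | hne
    · simp only [sub_self, norm_zero]; positivity
    have hδ : 0 < ‖y' - y‖ := norm_pos_iff.2 (sub_ne_zero.2 hne)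
    set δ := ‖y' - y‖
    -- compare the values at `y` and `y'` through the averages over discs of radius `‖y' - y‖`
    by_cases hδR : δ ≤ R
    · have h1 := hclose y hy δ hδ hδR
      have h2 := hclose y' hy' δ hδ hδR
      have h3 := hhop f hf (y + δ • e) (y' + δ • e) hδ (fun t ht => by
        simpa using hcone y hy y' hy' δ hδ hδR le_rfl t ht)
      have e1 : y' + δ • e - (y + δ • e) = y' - y := by ring
      have e2 : δ * δ ^ (-2 * b) = δ ^ a := by
        conv_lhs => rw [← Real.rpow_one δ]
        rw [← Real.rpow_mul hδ.le, one_mul, ← Real.rpow_add hδ, ha_def]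
        congr 1; ring
      rw [e1] at h3
      have h4 : ‖discAverage X f (y' + δ • e) δ - discAverage X f (y + δ • e) δ‖
          ≤ morreyConst * N * δ ^ a := h3.trans (le_of_eq (by rw [← e2]; ring))
      calc ‖u y' - u y‖ = ‖-(discAverage X f (y' + δ • e) δ - u y')
            + (discAverage X f (y' + δ • e) δ - discAverage X f (y + δ • e) δ)
            + (discAverage X f (y + δ • e) δ - u y)‖ := by congr 1; ring
        _ ≤ k * N * δ ^ a + morreyConst * N * δ ^ a + k * N * δ ^ a := by
            refine (norm_add_le _ _).trans (add_le_add ((norm_add_le _ _).trans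
              (add_le_add ?_ h4)) h1)
            rw [norm_neg]; exact h2
        _ = C₂ * N * δ ^ a := by rw [hC₂]; ring
        _ ≤ _ := by
            gcongr
            have : 0 ≤ 2 * C₁ * (R ^ a)⁻¹ := by positivity
            linarith
    · have h5 : R ^ a ≤ δ ^ a := Real.rpow_le_rpow hR.le (not_le.1 hδR).le ha.le
      calc ‖u y' - u y‖ ≤ C₁ * N + C₁ * N :=
            (norm_sub_le _ _).trans (add_le_add (hbd _ hy') (hbd _ hy))
        _ = (2 * C₁ * (R ^ a)⁻¹) * N * R ^ a := by field_simp; ring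
        _ ≤ (C₁ + C₂ + 2 * C₁ * (R ^ a)⁻¹) * N * δ ^ a := by
            gcongr
            linarith

theorem toNNReal_holder_exponent {p : ℝ≥0∞} (hp : 2 < p) :
    (((1 : ℝ≥0∞) - 2 / p).toNNReal : ℝ) = 1 - 2 * (1 / p.toReal) := by
  have h : 2 / p ≤ 1 := ENNReal.div_le_of_le_mul (by rw [one_mul]; exact hp.le)
  change ((1 : ℝ≥0∞) - 2 / p).toReal = _
  rw [ENNReal.toReal_sub_of_le h ENNReal.one_ne_top, ENNReal.toReal_div]
  simp [div_eq_mul_inv]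

/-- Morrey's embedding on a bounded open set with Lipschitz boundary. -/
theorem IsOpenLipschitz.exists_isEmbeddingConst {p : ℝ≥0∞} (hp : 2 < p) {X : Set ℂ}
    (hX : IsOpenLipschitz X) (hb : Bornology.IsBounded X) : ∃ C : ℝ≥0, IsEmbeddingConst p X C := by
  obtain ⟨hb0, hb1⟩ := inv_toReal_nonneg_lt_half hp
  have hcomp : IsCompact (closure X) := hb.isCompact_closure
  have hcone : ∀ x : closure X, ∃ e R, HasUniformCone X e R x := fun x => hX.hasUniformCone x.2
  choose e R hcone using hcone
  have hpatch := fun x => (hcone x).exists_patch hp hX.1 hb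
  set a := 1 - 2 * (1 / p.toReal) with ha_def
  have ha : 0 < a := by rw [ha_def]; linarith
  choose C hC0 hC using hpatch
  obtain ⟨T, hT⟩ := hcomp.elim_finite_subcover (fun x : closure X => Metric.ball (x : ℂ) (R x))
    (fun _ => Metric.isOpen_ball) (fun y hy => mem_iUnion.2
      ⟨⟨y, hy⟩, Metric.mem_ball_self (hcone ⟨y, hy⟩).1⟩)
  obtain ⟨δ, hδ, hleb⟩ := lebesgue_number_lemma_of_metric (c := fun x : T =>
      Metric.ball ((x : closure X) : ℂ) (R x)) hcomp (fun _ => Metric.isOpen_ball)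
    (hT.trans (by
      intro y hy
      obtain ⟨x, hx, hxy⟩ := mem_iUnion₂.1 hy
      exact mem_iUnion.2 ⟨⟨x, hx⟩, hxy⟩))
  set S := ∑ x ∈ T, C x with hS
  have hCS : ∀ x ∈ T, C x ≤ S := fun x hx =>
    Finset.single_le_sum (f := C) (fun i _ => hC0 i) hx
  have hS0 : 0 ≤ S := Finset.sum_nonneg fun i _ => hC0 i
  have hδa : 0 < δ ^ a := by positivity
  set H := S + 2 * S * (δ ^ a)⁻¹ with hH
  have hH0 : 0 ≤ H := by positivity
  refine ⟨S.toNNReal + H.toNNReal, fun f hf => ?_⟩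
  choose v hv1 hv2 hv3 using fun x => hC x f hf
  set N := (sobolevNorm p X f).toReal with hNdef
  have hN : 0 ≤ N := ENNReal.toReal_nonneg
  have hvc : ∀ x, ContinuousOn (v x) (closure X ∩ Metric.ball (x : ℂ) (R x)) := fun x => by
    refine HolderOnWith.continuousOn (C := (C x * N).toNNReal) (r := a.toNNReal)
      (fun y hy y' hy' => ?_) (by simpa using ha)
    rw [edist_dist, edist_dist, dist_eq_norm, dist_eq_norm, Real.coe_toNNReal _ ha.le,
      ENNReal.ofReal_rpow_of_nonneg (norm_nonneg _) ha.le]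
    rw [← ENNReal.ofReal_coe_nnreal, ← ENNReal.ofReal_mul (by positivity),
      Real.coe_toNNReal _ (mul_nonneg (hC0 x) hN)]
    exact ENNReal.ofReal_le_ofReal (hv3 x y' hy' y hy)
  -- local representatives agree where both are defined, being continuous and a.e. equal to `f`
  have hcons : ∀ x x' : closure X, ∀ y ∈ closure X, y ∈ Metric.ball (x : ℂ) (R x) →
      y ∈ Metric.ball (x' : ℂ) (R x') → v x y = v x' y := by
    intro x x' y hy hyx hyx'
    set B := Metric.ball (x : ℂ) (R x) ∩ Metric.ball (x' : ℂ) (R x') with hB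
    have hBo : IsOpen B := Metric.isOpen_ball.inter Metric.isOpen_ball
    have c1 : ContinuousOn (v x) (closure X ∩ B) :=
      (hvc x).mono (inter_subset_inter_right _ inter_subset_left)
    have c2 : ContinuousOn (v x') (closure X ∩ B) :=
      (hvc x').mono (inter_subset_inter_right _ inter_subset_right)
    have hsub : X ∩ B ⊆ closure X ∩ B := inter_subset_inter_left _ subset_closure
    have hEq : EqOn (v x) (v x') (X ∩ B) := by
      refine Measure.eqOn_open_of_ae_eq (μ := volume) ?_ (hX.1.inter hBo) (c1.mono hsub)
        (c2.mono hsub)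
      rw [Filter.EventuallyEq, ae_restrict_iff' (hX.1.inter hBo).measurableSet]
      filter_upwards [hv1 x, hv1 x'] with z h1 h2 hz
      rw [h1 ⟨hz.1, hz.2.1⟩, h2 ⟨hz.1, hz.2.2⟩]
    exact hEq.of_subset_closure c1 c2 hsub (by
      rw [inter_comm, inter_comm X]; exact hBo.inter_closure) ⟨hy, hyx, hyx'⟩
  have hidx : ∀ y ∈ closure X, ∃ x ∈ T, y ∈ Metric.ball (x : ℂ) (R x) := fun y hy => by
    obtain ⟨x, hx, hxy⟩ := mem_iUnion₂.1 (hT hy)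
    exact ⟨x, hx, hxy⟩
  rcases isEmpty_or_nonempty (closure X) with hemp | hne
  · have hX0 : X = ∅ := by
      rw [← closure_empty_iff]; exact isEmpty_coe_sort.1 hemp
    refine ⟨f, Filter.EventuallyEq.rfl, by simp [hX0], ?_⟩
    rw [holderNormOn, eHolderNorm_of_isEmpty]
    simp [hX0]
  choose! i hiT hi using hidx
  set u : ℂ → ℂ := fun y => v (i y) y with hu
  have huv : ∀ x : closure X, ∀ y ∈ closure X, y ∈ Metric.ball (x : ℂ) (R x) → u y = v x y :=
    fun x y hy hyx => hcons _ _ y hy (hi y hy) hyx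
  have hub : ∀ y ∈ closure X, ‖u y‖ ≤ S * N := fun y hy =>
    (hv2 (i y) y ⟨hy, hi y hy⟩).trans (by gcongr; exact hCS _ (hiT y hy))
  have huh : ∀ y ∈ closure X, ∀ y' ∈ closure X, ‖u y' - u y‖ ≤ H * N * ‖y' - y‖ ^ a := by
    intro y hy y' hy'
    -- two points closer than the Lebesgue number of the cover lie in a common patch
    by_cases hlt : ‖y' - y‖ < δ
    · obtain ⟨x, hx⟩ := hleb y hy
      have m1 : y ∈ Metric.ball ((x : closure X) : ℂ) (R x) := hx (Metric.mem_ball_self hδ)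
      have m2 : y' ∈ Metric.ball ((x : closure X) : ℂ) (R x) :=
        hx (by rwa [Metric.mem_ball, dist_eq_norm])
      rw [huv x y hy m1, huv x y' hy' m2]
      refine (hv3 x y ⟨hy, m1⟩ y' ⟨hy', m2⟩).trans ?_
      gcongr
      have := hCS x x.2
      have : 0 ≤ 2 * S * (δ ^ a)⁻¹ := by positivity
      linarith
    · have h5 : δ ^ a ≤ ‖y' - y‖ ^ a := Real.rpow_le_rpow hδ.le (not_lt.1 hlt) ha.le
      calc ‖u y' - u y‖ ≤ S * N + S * N :=
            (norm_sub_le _ _).trans (add_le_add (hub _ hy') (hub _ hy))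
        _ = (2 * S * (δ ^ a)⁻¹) * N * δ ^ a := by field_simp; ring
        _ ≤ H * N * ‖y' - y‖ ^ a := by
            gcongr
            linarith
  have hexp := toNNReal_holder_exponent hp
  have hholder : HolderWith (H * N).toNNReal ((1 : ℝ≥0∞) - 2 / p).toNNReal
      ((closure X).domRestrict u) := by
    intro y y'
    rw [edist_dist, edist_dist, dist_eq_norm, hexp, ← ha_def, Subtype.dist_eq, dist_eq_norm,
      ENNReal.ofReal_rpow_of_nonneg (norm_nonneg _) ha.le, ← ENNReal.ofReal_coe_nnreal,
      ← ENNReal.ofReal_mul (by positivity), Real.coe_toNNReal _ (mul_nonneg hH0 hN)]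
    exact ENNReal.ofReal_le_ofReal (huh y' y'.2 y y.2)
  refine ⟨u, ?_, ?_, ?_⟩
  · rw [Filter.EventuallyEq, ae_restrict_iff' hX.1.measurableSet]
    have hall : ∀ᵐ z, ∀ x ∈ T, z ∈ X ∩ Metric.ball ((x : closure X) : ℂ) (R x) → v x z = f z :=
      (Finset.eventually_all T).2 fun x _ => hv1 x
    filter_upwards [hall] with z hz hzX
    exact hz _ (hiT z (subset_closure hzX)) ⟨hzX, hi z (subset_closure hzX)⟩
  · rw [continuousOn_iff_continuous_domRestrict]
    refine hholder.continuous ?_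
    rw [← NNReal.coe_pos, hexp]
    exact ha
  · have hNe : ENNReal.ofReal N = sobolevNorm p X f :=
      ENNReal.ofReal_toReal (hf.sobolevNorm_ne_top hX.1)
    rw [holderNormOn, ENNReal.coe_add, add_mul, ← hNe]
    refine add_le_add (iSup₂_le fun z hz => ?_) (hholder.eHolderNorm_le.trans (le_of_eq ?_))
    · rw [← ofReal_norm]
      refine (ENNReal.ofReal_le_ofReal (hub z hz)).trans (le_of_eq ?_)
      rw [ENNReal.ofReal_mul hS0]; rfl
    · change ENNReal.ofReal (H * N) = ENNReal.ofReal H * _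
      rw [ENNReal.ofReal_mul hH0]

/-! ### The unit disc and the embedding constants -/

theorem unitDisc_isOpenLipschitz : IsOpenLipschitz unitDisc := by
  refine ⟨Metric.isOpen_ball, fun x hx => ?_⟩
  rw [frontier_ball _ one_ne_zero, mem_sphere_zero_iff_norm] at hx
  have hproj : LipschitzWith 1 (fun s : ℝ => max (-(1 / 2)) (min s (1 / 2))) :=
    (LipschitzWith.id.min_const _).const_max _
  have hlip : LipschitzWith 1
      (fun s : ℝ => √(1 - (max (-(1 / 2)) (min s (1 / 2))) ^ 2) - 1) := by
    refine LipschitzWith.of_dist_le_mul fun s s' => ?_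
    refine le_trans ?_ (hproj.dist_le_mul s s')
    simp only [Real.dist_eq]
    have hc : ∀ s : ℝ, -(1 / 2) ≤ max (-(1 / 2)) (min s (1 / 2)) ∧
        max (-(1 / 2)) (min s (1 / 2)) ≤ 1 / 2 := fun s =>
      ⟨le_max_left _ _, max_le (by norm_num) (min_le_right _ _)⟩
    obtain ⟨h1, h2⟩ := hc s
    obtain ⟨h3, h4⟩ := hc s'
    set c := max (-(1 / 2)) (min s (1 / 2))
    set c' := max (-(1 / 2)) (min s' (1 / 2))
    have ha : √(1 - c ^ 2) ^ 2 = 1 - c ^ 2 := Real.sq_sqrt (by nlinarith)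
    have ha' : √(1 - c' ^ 2) ^ 2 = 1 - c' ^ 2 := Real.sq_sqrt (by nlinarith)
    have hb : 1 / 2 ≤ √(1 - c ^ 2) := Real.le_sqrt_of_sq_le (by nlinarith)
    have hb' : 1 / 2 ≤ √(1 - c' ^ 2) := Real.le_sqrt_of_sq_le (by nlinarith)
    set a := √(1 - c ^ 2)
    set a' := √(1 - c' ^ 2)
    have e : |a - a'| * |a + a'| = |c - c'| * |c + c'| := by
      rw [← abs_mul, ← abs_mul, ← abs_neg]; congr 1; nlinarith
    have e1 : 1 ≤ |a + a'| := by rw [abs_of_pos (by linarith)]; linarith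
    have e2 : |c + c'| ≤ 1 := abs_le.2 ⟨by linarith, by linarith⟩
    calc |a - 1 - (a' - 1)| = |a - a'| := by congr 1; ring
      _ ≤ |a - a'| * |a + a'| := le_mul_of_one_le_right (abs_nonneg _) e1
      _ ≤ |c - c'| := by rw [e]; exact mul_le_of_le_one_right (abs_nonneg _) e2
  refine ⟨-(Complex.I * x), by simp [hx], 1 / 2, by norm_num, 1, _, hlip, fun s t hs ht => ?_⟩
  rw [abs_lt] at hs ht
  have hmm : max (-(1 / 2)) (min s (1 / 2)) = s := by
    rw [min_eq_left hs.2.le, max_eq_right hs.1.le]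
  have hz : x + -(Complex.I * x) * (s + t * Complex.I)
      = x * (((1 + t : ℝ) : ℂ) + ((-s : ℝ) : ℂ) * Complex.I) := by
    push_cast
    linear_combination (-(x * t)) * Complex.I_sq
  rw [hz, mem_ball_zero_iff, norm_mul, hx, one_mul, Complex.norm_add_mul_I, hmm,
    lt_sub_iff_add_lt', Real.lt_sqrt (by linarith), Real.sqrt_lt' one_pos]
  constructor <;> intro h <;> nlinarith

theorem IsLipschitzPartition.subset_unitDisc {m : ℕ} {U : Fin m → Set ℂ}
    (hU : IsLipschitzPartition U) (j : Fin m) : U j ⊆ unitDisc := by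
  have h : U j ⊆ closure unitDisc := by
    rw [hU.cover]
    exact subset_closure.trans (subset_iUnion (fun j => closure (U j)) j)
  rw [closure_ball _ one_ne_zero] at h
  have := (hU.lipschitz j).1.subset_interior_iff.2 h
  rwa [interior_closedBall _ one_ne_zero] at this

theorem IsLipschitzPartition.isBounded {m : ℕ} {U : Fin m → Set ℂ}
    (hU : IsLipschitzPartition U) (j : Fin m) : Bornology.IsBounded (U j) :=
  Metric.isBounded_ball.subset (hU.subset_unitDisc j)

theorem embeddingConst_ne_top {p : ℝ≥0∞} (hp : 2 < p) {X : Set ℂ} (hX : IsOpenLipschitz X)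
    (hb : Bornology.IsBounded X) : embeddingConst p X ≠ ∞ := by
  obtain ⟨C, hC⟩ := hX.exists_isEmbeddingConst hp hb
  exact ((iInf₂_le C hC).trans_lt ENNReal.coe_lt_top).ne

theorem ae_le_of_isEmbeddingConst {p : ℝ≥0∞} {X : Set ℂ} (hX : IsOpen X) {C : ℝ≥0}
    (hC : IsEmbeddingConst p X C) {f : ℂ → ℂ} (hf : MemSobolev p X f) :
    eLpNorm f ∞ (volume.restrict X) ≤ C * sobolevNorm p X f := by
  obtain ⟨u, hu, -, hn⟩ := hC f hf
  rw [← eLpNorm_congr_ae hu, eLpNorm_exponent_top]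
  refine essSup_le_of_ae_le _ ?_
  filter_upwards [ae_restrict_mem hX.measurableSet] with z hz
  refine le_trans ?_ ((le_self_add).trans hn)
  exact le_iSup₂ (f := fun z (_ : z ∈ closure X) => ‖u z‖ₑ) z (subset_closure hz)

/-- A Sobolev function is essentially bounded by its norm times the embedding constant. -/
theorem MemSobolev.eLpNorm_top_le {p : ℝ≥0∞} {X : Set ℂ} (hX : IsOpen X)
    {f : ℂ → ℂ} (hf : MemSobolev p X f) :
    eLpNorm f ∞ (volume.restrict X) ≤ embeddingConst p X * sobolevNorm p X f := by
  have hs := hf.sobolevNorm_ne_top hX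
  by_cases h0 : sobolevNorm p X f = 0
  · rw [h0, mul_zero]
    by_cases h : ∃ C, IsEmbeddingConst p X C
    · obtain ⟨C, hC⟩ := h
      simpa [h0] using ae_le_of_isEmbeddingConst hX hC hf
    · -- without an embedding the vanishing of the norm still forces `f = 0`
      by_cases hp : p = 0
      · exact absurd h0 (by simp [sobolevNorm, hp])
      · have h1 := (lpNormOn_le_sobolevNorm (pos_iff_ne_zero.2 hp) X f).1
        rw [h0, nonpos_iff_eq_zero, lpNormOn, eLpNorm_eq_zero_iff hf.1.1 hp] at h1
        rw [eLpNorm_congr_ae h1]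
        simp
  · rw [← ENNReal.div_le_iff h0 hs]
    exact le_iInf₂ fun C hC => (ENNReal.div_le_iff h0 hs).2 (ae_le_of_isEmbeddingConst hX hC hf)

/-! ### The length of the boundary and neighbourhoods of the boundary -/

section

variable {X : Set ℂ} {x u : ℂ} {r : ℝ} {K : ℝ≥0} {γ : ℝ → ℝ}

theorem IsGraphChart.eq_of_mem_frontier (h : IsGraphChart X x u r K γ) (hX : IsOpen X) {z : ℂ}
    (hz : ‖z - x‖ < r) (hzX : z ∈ frontier X) :
    (u⁻¹ * (z - x)).im = γ (u⁻¹ * (z - x)).re := by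
  rw [hX.frontier_eq] at hzX
  exact le_antisymm (h.le_of_mem_closure hz hzX.1)
    (not_lt.1 fun hlt => hzX.2 ((h.mem_iff hz).2 hlt))

theorem IsGraphChart.graph_mem_frontier (h : IsGraphChart X x u r K γ) (hX : IsOpen X) {s : ℝ}
    (hs : |s| < r) (hγs : |γ s| < r) :
    x + u * ((s : ℂ) + γ s * Complex.I) ∈ frontier X := by
  rw [hX.frontier_eq]
  have key : ∀ t : ℝ, |t| < r → (x + u * ((s : ℂ) + t * Complex.I) ∈ X ↔ t < γ s) := fun t ht => by
    simpa using h.2.2.2 ((s : ℂ) + t * Complex.I) (by simpa using hs) (by simpa using ht)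
  refine ⟨?_, fun hX' => lt_irrefl _ ((key _ hγs).1 hX')⟩
  have hc : Continuous fun t : ℝ => x + u * ((s : ℂ) + t * Complex.I) := by fun_prop
  have h1 : Filter.Tendsto (fun t : ℝ => x + u * ((s : ℂ) + t * Complex.I))
      (nhdsWithin (γ s) (Iio (γ s))) (nhds (x + u * ((s : ℂ) + γ s * Complex.I))) :=
    (hc.tendsto _).mono_left nhdsWithin_le_nhds
  refine mem_closure_of_tendsto h1 ?_
  have h2 : ∀ᶠ t in nhds (γ s), |t| < r := (isOpen_lt continuous_abs continuous_const).mem_nhds hγs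
  filter_upwards [self_mem_nhdsWithin, nhdsWithin_le_nhds h2] with t ht ht'
  exact (key t ht').2 ht

theorem IsGraphChart.lipschitzWith_graph (h : IsGraphChart X x u r K γ) :
    LipschitzWith (1 + K) (fun s : ℝ => x + u * ((s : ℂ) + γ s * Complex.I)) := by
  refine LipschitzWith.of_dist_le_mul fun s s' => ?_
  have e : x + u * ((s : ℂ) + γ s * Complex.I) - (x + u * ((s' : ℂ) + γ s' * Complex.I))
      = u * (((s - s' : ℝ) : ℂ) + ((γ s - γ s' : ℝ) : ℂ) * Complex.I) := by push_cast; ring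
  rw [dist_eq_norm, e, norm_mul, h.1, one_mul, Real.dist_eq]
  refine (norm_add_le _ _).trans ?_
  rw [norm_mul, Complex.norm_I, mul_one, Complex.norm_real, Complex.norm_real, Real.norm_eq_abs,
    Real.norm_eq_abs, NNReal.coe_add, NNReal.coe_one, add_mul, one_mul]
  gcongr
  simpa [Real.dist_eq] using h.2.2.1.dist_le_mul s s'

theorem IsGraphChart.hausdorffMeasure_lt_top (h : IsGraphChart X x u r K γ) (hX : IsOpen X) :
    Measure.hausdorffMeasure 1 (frontier X ∩ Metric.ball x r) < ∞ := by
  have hsub : frontier X ∩ Metric.ball x r ⊆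
      (fun s : ℝ => x + u * ((s : ℂ) + γ s * Complex.I)) '' Icc (-r) r := by
    rintro z ⟨hzX, hz⟩
    rw [Metric.mem_ball, dist_eq_norm] at hz
    have h1 := h.eq_of_mem_frontier hX hz hzX
    refine ⟨(u⁻¹ * (z - x)).re, abs_le.1 ((Complex.abs_re_le_norm _).trans ?_), ?_⟩
    · rw [h.norm_coord]; exact hz.le
    · simp only
      rw [← h1, Complex.re_add_im, h.eq_coord]
  refine (measure_mono hsub).trans_lt ?_
  refine (h.lipschitzWith_graph.hausdorffMeasure_image_le zero_le_one _).trans_lt ?_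
  rw [hausdorffMeasure_real, Real.volume_Icc]
  exact ENNReal.mul_lt_top (by simp) ENNReal.ofReal_lt_top

/-- The graph of a continuous function leaves a small disc about each of its points, so that its
length inside the disc is at least the radius. -/
theorem IsGraphChart.exists_le_hausdorffMeasure (h : IsGraphChart X x u r K γ) (hX : IsOpen X)
    (hx : x ∈ frontier X) :
    ∃ δ > 0, ∀ y ∈ frontier X ∩ Metric.ball x δ, ∀ ε, 0 < ε → ε ≤ δ →
      ENNReal.ofReal ε ≤ Measure.hausdorffMeasure 1 (frontier X ∩ Metric.closedBall y ε) := by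
  have hr := h.2.1
  have hK : (0 : ℝ) ≤ K := K.2
  have hγ0 : γ 0 = 0 := by simpa using (h.eq_of_mem_frontier hX (by simpa using hr) hx).symm
  refine ⟨r / (3 * (1 + K)), by positivity, ?_⟩
  rintro y ⟨hyX, hy⟩ ε hε hεδ
  have hδr : r / (3 * (1 + K)) * (3 * (1 + K)) = r := by field_simp
  set δ := r / (3 * (1 + K))
  rw [Metric.mem_ball, dist_eq_norm] at hy
  have hδr' : δ ≤ r := by nlinarith
  have hyγ := h.eq_of_mem_frontier hX (hy.trans_le hδr') hyX
  set c : ℝ → ℂ := fun s => x + u * ((s : ℂ) + γ s * Complex.I) with hc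
  set s₀ := (u⁻¹ * (y - x)).re with hs₀
  have hcs : c s₀ = y := by
    rw [hc]; simp only
    rw [← hyγ, hs₀, Complex.re_add_im, h.eq_coord]
  have hs₀δ : |s₀| < δ := by
    refine (Complex.abs_re_le_norm _).trans_lt ?_
    rwa [h.norm_coord]
  have hcc : Continuous c := h.lipschitzWith_graph.continuous
  have hsep : ε ≤ dist (c (s₀ + ε)) y := by
    rw [← hcs, dist_eq_norm]
    have e : c (s₀ + ε) - c s₀
        = u * ((ε : ℂ) + ((γ (s₀ + ε) - γ s₀ : ℝ) : ℂ) * Complex.I) := by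
      rw [hc]; push_cast; ring
    rw [e, norm_mul, h.1, one_mul]
    have := Complex.abs_re_le_norm ((ε : ℂ) + ((γ (s₀ + ε) - γ s₀ : ℝ) : ℂ) * Complex.I)
    rw [Complex.add_re, Complex.ofReal_re, Complex.re_ofReal_mul, Complex.I_re, mul_zero, add_zero]
      at this
    exact (le_abs_self ε).trans this
  have hmem : ∀ s ∈ Icc s₀ (s₀ + ε), c s ∈ frontier X := fun s hs => by
    have h1 : |s| ≤ 2 * δ := by
      rw [abs_lt] at hs₀δ
      exact abs_le.2 ⟨by linarith [hs.1], by linarith [hs.2]⟩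
    have h2 : |γ s| ≤ K * (2 * δ) := by
      have := h.2.2.1.dist_le_mul s 0
      rw [hγ0, Real.dist_eq, Real.dist_eq, sub_zero, sub_zero] at this
      exact this.trans (by gcongr)
    refine h.graph_mem_frontier hX (h1.trans_lt ?_) (h2.trans_lt ?_) <;> nlinarith
  have hsub : Icc 0 ε ⊆ (fun z => dist z y) '' (frontier X ∩ Metric.closedBall y ε) := by
    intro t ht
    have := intermediate_value_Icc (by linarith : s₀ ≤ s₀ + ε)
      ((hcc.dist continuous_const : Continuous fun s => dist (c s) y).continuousOn)
      (show t ∈ Icc (dist (c s₀) y) (dist (c (s₀ + ε)) y) by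
        rw [hcs, dist_self]; exact ⟨ht.1, ht.2.trans hsep⟩)
    obtain ⟨s, hs, hst⟩ := this
    change dist (c s) y = t at hst
    exact ⟨c s, ⟨hmem s hs, by rw [Metric.mem_closedBall, hst]; exact ht.2⟩, hst⟩
  calc ENNReal.ofReal ε = Measure.hausdorffMeasure 1 (Icc 0 ε) := by
        rw [hausdorffMeasure_real, Real.volume_Icc, sub_zero]
    _ ≤ Measure.hausdorffMeasure 1
          ((fun z => dist z y) '' (frontier X ∩ Metric.closedBall y ε)) := measure_mono hsub
    _ ≤ _ := by
        have := (LipschitzWith.dist_left y).hausdorffMeasure_image_le zero_le_one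
          (frontier X ∩ Metric.closedBall y ε)
        simpa using this

end

theorem isCompact_frontier {X : Set ℂ} (hb : Bornology.IsBounded X) : IsCompact (frontier X) :=
  hb.isCompact_closure.of_isClosed_subset isClosed_frontier frontier_subset_closure

theorem IsOpenLipschitz.boundaryLength_ne_top {X : Set ℂ} (hX : IsOpenLipschitz X)
    (hb : Bornology.IsBounded X) : boundaryLength X ≠ ∞ := by
  refine ((isCompact_frontier hb).measure_lt_top_of_nhdsWithin fun x hx => ?_).ne
  obtain ⟨u, r, K, γ, h⟩ := hX.exists_chart hx
  exact ⟨_, Filter.inter_mem self_mem_nhdsWithin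
    (mem_nhdsWithin_of_mem_nhds (Metric.ball_mem_nhds x h.2.1)), h.hausdorffMeasure_lt_top hX.1⟩

theorem IsOpenLipschitz.exists_le_hausdorffMeasure {X : Set ℂ} (hX : IsOpenLipschitz X)
    (hb : Bornology.IsBounded X) :
    ∃ δ > 0, ∀ y ∈ frontier X, ∀ ε, 0 < ε → ε ≤ δ →
      ENNReal.ofReal ε ≤ Measure.hausdorffMeasure 1 (frontier X ∩ Metric.closedBall y ε) := by
  refine (isCompact_frontier hb).induction_on (p := fun s => ∃ δ > 0, ∀ y ∈ s, ∀ ε, 0 < ε → ε ≤ δ →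
      ENNReal.ofReal ε ≤ Measure.hausdorffMeasure 1 (frontier X ∩ Metric.closedBall y ε))
    ⟨1, one_pos, by simp⟩ ?_ ?_ ?_
  · rintro s t hst ⟨δ, hδ, h⟩
    exact ⟨δ, hδ, fun y hy => h y (hst hy)⟩
  · rintro s t ⟨δ, hδ, h⟩ ⟨δ', hδ', h'⟩
    refine ⟨min δ δ', lt_min hδ hδ', ?_⟩
    rintro y (hy | hy) ε hε hle
    · exact h y hy ε hε (hle.trans (min_le_left _ _))
    · exact h' y hy ε hε (hle.trans (min_le_right _ _))
  · intro x hx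
    obtain ⟨u, r, K, γ, h⟩ := hX.exists_chart hx
    obtain ⟨δ, hδ, h'⟩ := h.exists_le_hausdorffMeasure hX.1 hx
    exact ⟨_, Filter.inter_mem self_mem_nhdsWithin
      (mem_nhdsWithin_of_mem_nhds (Metric.ball_mem_nhds x hδ)), δ, hδ, h'⟩

/-- The area of a thin neighbourhood of the boundary is at most a universal multiple of its
thickness times the length of the boundary. -/
theorem IsOpenLipschitz.exists_volume_thickening_le {X : Set ℂ} (hX : IsOpenLipschitz X)
    (hb : Bornology.IsBounded X) :
    ∃ δ > 0, ∀ ε, 0 < ε → ε ≤ δ → volume (Metric.thickening ε (frontier X)) ≤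
      ENNReal.ofReal (100 * ε) * boundaryLength X := by
  obtain ⟨δ, hδ, h⟩ := hX.exists_le_hausdorffMeasure hb
  refine ⟨δ, hδ, fun ε hε hεδ => ?_⟩
  obtain ⟨S, hSF, hdisj, hcov⟩ := Vitali.exists_disjoint_subfamily_covering_enlargement_closedBall
    (frontier X) (fun y : ℂ => y) (fun _ => ε) ε (fun _ _ => le_rfl) 5 (by norm_num)
  have hScount : S.Countable := hdisj.countable_of_nonempty_interior fun y _ => by
    rw [interior_closedBall _ hε.ne']
    exact ⟨y, Metric.mem_ball_self hε⟩
  -- each of the disjoint discs of the Vitali family uses up a boundary length of at least `ε`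
  have hthick : Metric.thickening ε (frontier X) ⊆ ⋃ y ∈ S, Metric.closedBall y (5 * ε) := by
    intro z hz
    obtain ⟨y, hy, hzy⟩ := Metric.mem_thickening_iff.1 hz
    obtain ⟨b, hb, hyb⟩ := hcov y hy
    exact mem_biUnion hb (hyb (Metric.mem_closedBall.2 hzy.le))
  have hcount := hScount.to_subtype
  have hsum : ∑' _ : S, ENNReal.ofReal ε ≤ boundaryLength X := by
    calc ∑' _ : S, ENNReal.ofReal ε
        ≤ ∑' y : S, Measure.hausdorffMeasure 1 (frontier X ∩ Metric.closedBall (y : ℂ) ε) :=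
          ENNReal.tsum_le_tsum fun y => h y (hSF y.2) ε hε hεδ
      _ = Measure.hausdorffMeasure 1 (⋃ y ∈ S, frontier X ∩ Metric.closedBall (y : ℂ) ε) :=
          (measure_biUnion hScount (fun y hy y' hy' hne =>
            (hdisj hy hy' hne).mono inter_subset_right inter_subset_right)
            fun y _ => isClosed_frontier.measurableSet.inter
              Metric.isClosed_closedBall.measurableSet).symm
      _ ≤ boundaryLength X := measure_mono (iUnion₂_subset fun _ _ => inter_subset_left)
  have hball : ∀ y : ℂ, volume (Metric.closedBall y (5 * ε)) ≤
      ENNReal.ofReal (100 * ε) * ENNReal.ofReal ε := fun y => by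
    rw [Complex.volume_closedBall, ← ENNReal.ofReal_mul (by positivity),
      ← ENNReal.ofReal_pow (by positivity), ← ENNReal.ofReal_coe_nnreal, NNReal.coe_real_pi,
      ← ENNReal.ofReal_mul (by positivity)]
    refine ENNReal.ofReal_le_ofReal ?_
    nlinarith [Real.pi_le_four, sq_nonneg ε]
  calc volume (Metric.thickening ε (frontier X))
      ≤ volume (⋃ y ∈ S, Metric.closedBall y (5 * ε)) := measure_mono hthick
    _ ≤ ∑' y : S, volume (Metric.closedBall (y : ℂ) (5 * ε)) :=
        measure_biUnion_le _ hScount _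
    _ ≤ ∑' _ : S, ENNReal.ofReal (100 * ε) * ENNReal.ofReal ε :=
        ENNReal.tsum_le_tsum fun y => hball y
    _ = ENNReal.ofReal (100 * ε) * ∑' _ : S, ENNReal.ofReal ε := ENNReal.tsum_mul_left
    _ ≤ _ := by gcongr

/-! ### Smooth cut-off functions -/

theorem ball_subset_of_disjoint_frontier {X : Set ℂ} (hX : IsOpen X) {c : ℂ} (hc : c ∈ X) {r : ℝ}
    (hr : 0 < r) (h : ∀ z ∈ Metric.ball c r, z ∉ frontier X) : Metric.ball c r ⊆ X := by
  refine (convex_ball c r).isPreconnected.subset_left_of_subset_union hX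
    (isClosed_closure (s := X)).isOpen_compl ?_ ?_ ⟨c, Metric.mem_ball_self hr, hc⟩
  · exact disjoint_compl_right.mono_left subset_closure
  · intro z hz
    by_contra hcon
    simp only [mem_union, mem_compl_iff, not_or, not_not] at hcon
    exact h z hz (by rw [hX.frontier_eq]; exact ⟨hcon.2, hcon.1⟩)

/-- There are cut-off functions that are `1` at distance `2 ε` from the boundary, with gradient of
order `ε⁻¹`: regularisations of the indicator function of the points at distance `ε / 2` from the
boundary. -/
theorem exists_cutoff {X : Set ℂ} (hX : IsOpen X) (hb : Bornology.IsBounded X) {ε : ℝ}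
    (hε : 0 < ε) : ∃ χ : ℂ → ℝ, ContDiff ℝ (⊤ : ℕ∞) χ ∧ HasCompactSupport χ ∧ tsupport χ ⊆ X ∧
      (∀ z, 0 ≤ χ z ∧ χ z ≤ 1) ∧
      (∀ z ∈ X, z ∉ Metric.thickening (2 * ε) (frontier X) → χ z = 1 ∧ fderiv ℝ χ z = 0) ∧
      ∀ z, ‖fderiv ℝ χ z‖ ≤ 4 * Real.pi * rhoBound * ε⁻¹ := by
  set F := frontier X
  set d := ε / 4 with hd
  have hd0 : 0 < d := by positivity
  set k : ℂ → ℝ := mollifier 0 d with hk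
  have hksm : ContDiff ℝ (⊤ : ℕ∞) k := mollifier_contDiff 0 d
  have hkc : HasCompactSupport k := hasCompactSupport_mollifier hd0
  have hk0 : ∀ w, d < ‖w‖ → k w = 0 := fun w hw =>
    mollifier_eq_zero hd0 (by simpa using hw)
  set A := X \ Metric.thickening (ε / 2) F with hA
  have hAm : MeasurableSet A := hX.measurableSet.diff Metric.isOpen_thickening.measurableSet
  set f : ℂ → ℝ := A.indicator 1 with hf
  have hfi : Integrable f := (integrable_indicator_iff hAm).2
    (integrableOn_const ((hb.subset sdiff_subset).measure_lt_top.ne))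
  have hf01 : ∀ z, 0 ≤ f z ∧ f z ≤ 1 := fun z => by
    by_cases hz : z ∈ A <;> simp [hf, hz]
  set L := ContinuousLinearMap.lsmul ℝ ℝ (E := ℝ)
  set χ : ℂ → ℝ := convolution f k L volume with hχ
  have hχv : ∀ z, χ z = ∫ w, f w * k (z - w) := fun z => rfl
  have hint : ∀ z, Integrable fun w => k (z - w) := fun z =>
    (hksm.continuous.integrable_of_hasCompactSupport hkc).comp_sub_left z
  have hint1 : ∀ z, ∫ w, k (z - w) = 1 := fun z => by
    rw [integral_sub_left_eq_self k volume z]; exact integral_mollifier hd0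
  have hkn : ∀ w, 0 ≤ k w := mollifier_nonneg 0 d
  have hint2 : ∀ z, Integrable fun w => f w * k (z - w) := fun z =>
    (hint z).bdd_mul (c := 1) hfi.1 (Filter.Eventually.of_forall fun w => by
      rw [Real.norm_of_nonneg (hf01 w).1]; exact (hf01 w).2)
  have hchi1 : ∀ z ∈ X, z ∉ Metric.thickening ε F → χ z = 1 := by
    intro z hz hzF
    rw [hχv, ← hint1 z]
    congr 1; ext w
    by_cases hw : d < ‖z - w‖
    · rw [hk0 _ hw, mul_zero]
    rw [not_lt] at hw
    have hbX : Metric.ball z ε ⊆ X := ball_subset_of_disjoint_frontier hX hz hε fun y hy hyF =>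
      hzF (Metric.mem_thickening_iff.2 ⟨y, hyF, by rw [dist_comm]; exact hy⟩)
    have hwA : w ∈ A := by
      refine ⟨hbX ?_, fun hwF => hzF ?_⟩
      · rw [Metric.mem_ball, dist_comm, dist_eq_norm]; linarith
      · obtain ⟨y, hy, hwy⟩ := Metric.mem_thickening_iff.1 hwF
        refine Metric.mem_thickening_iff.2 ⟨y, hy, ?_⟩
        have := dist_triangle z w y
        rw [dist_eq_norm z w] at this
        linarith
    simp [hf, hwA]
  have hsupp : tsupport χ ⊆ Metric.cthickening d A := by
    refine closure_minimal (fun z hz => ?_) Metric.isClosed_cthickening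
    by_contra hzA
    refine hz ?_
    rw [hχv, ← integral_zero ℂ ℝ (μ := volume)]
    congr 1; ext w
    by_cases hwA : w ∈ A
    · have : d < ‖z - w‖ := by
        by_contra hle
        exact hzA (Metric.mem_cthickening_of_dist_le z w d A hwA (by
          rw [dist_eq_norm]; exact not_lt.1 hle))
      rw [hk0 _ this, mul_zero]
    · simp [hf, hwA]
  have hcthick : Metric.cthickening d A ⊆ X := by
    intro z hz
    have hz' := Metric.cthickening_subset_thickening' (by positivity : 0 < ε / 2)
      (by rw [hd]; linarith) A hz
    obtain ⟨a, ha, hza⟩ := Metric.mem_thickening_iff.1 hz'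
    refine ball_subset_of_disjoint_frontier hX ha.1 (by positivity : 0 < ε / 2)
      (fun y hy hyF => ha.2 (Metric.mem_thickening_iff.2 ⟨y, hyF, ?_⟩)) (Metric.mem_ball.2 hza)
    rw [dist_comm]; exact hy
  have hchism : ContDiff ℝ (⊤ : ℕ∞) χ := hkc.contDiff_convolution_right L hfi.locallyIntegrable hksm
  refine ⟨χ, hchism, ?_, hsupp.trans hcthick, fun z => ⟨?_, ?_⟩, fun z hz hzF => ⟨?_, ?_⟩,
    fun z => ?_⟩
  · exact Metric.isCompact_of_isClosed_isBounded (isClosed_tsupport χ)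
      (hb.subset (hsupp.trans hcthick))
  · exact integral_nonneg fun w => mul_nonneg (hf01 w).1 (hkn _)
  · rw [← hint1 z]
    exact integral_mono (hint2 z) (hint z) fun w => mul_le_of_le_one_left (hkn _) (hf01 w).2
  · exact hchi1 z hz fun h => hzF (Metric.thickening_mono (by linarith) F h)
  · have hzc : z ∉ Metric.cthickening ε F := fun h =>
      hzF (Metric.cthickening_subset_thickening' (by positivity) (by linarith) F h)
    have hnear : χ =ᶠ[nhds z] fun _ => 1 := by
      filter_upwards [hX.mem_nhds hz, Metric.isClosed_cthickening.isOpen_compl.mem_nhds hzc]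
        with w hw hwc
      exact hchi1 w hw fun h => hwc (Metric.thickening_subset_cthickening ε F h)
    rw [hnear.fderiv_eq]; simp
  · have h1 := (hkc.hasFDerivAt_convolution_right L hfi.locallyIntegrable
      (hksm.of_le (by simp)) z).fderiv
    refine ContinuousLinearMap.opNorm_le_bound _ (by have := rhoBound_pos; positivity) fun v => ?_
    rw [hχ, h1, convolution_precompR_apply L hfi.locallyIntegrable (hkc.fderiv ℝ)
      (hksm.continuous_fderiv (by simp))]
    change ‖∫ w, f w * fderiv ℝ k (z - w) v‖ ≤ _
    have hk' : ∀ w, fderiv ℝ k w = ((d ^ 2)⁻¹ * d⁻¹) • fderiv ℝ rho (d⁻¹ • (w - 0)) := fun w =>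
      (hasFDerivAt_mollifier 0 d w).fderiv
    have hzero : ∀ w ∉ Metric.closedBall z d, f w * fderiv ℝ k (z - w) v = 0 := fun w hw => by
      have : fderiv ℝ k (z - w) = 0 := by
        rw [hk', fderiv_rho_eq_zero (norm_scaled_gt hd0 ?_), smul_zero]
        rw [Metric.mem_closedBall, dist_eq_norm, sub_zero]
        rwa [Metric.mem_closedBall, dist_comm, dist_eq_norm] at hw
      rw [this]; simp
    rw [← setIntegral_eq_integral_of_forall_compl_eq_zero hzero]
    refine (norm_setIntegral_le_of_norm_le_const
      (C := ((d ^ 2)⁻¹ * d⁻¹) * rhoBound * ‖v‖)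
      (Metric.isBounded_closedBall.measure_lt_top) fun w _ => ?_).trans (le_of_eq ?_)
    · rw [norm_mul, Real.norm_of_nonneg (hf01 w).1]
      refine (mul_le_of_le_one_left (norm_nonneg _) (hf01 w).2).trans ?_
      refine (ContinuousLinearMap.le_opNorm _ _).trans ?_
      gcongr
      rw [hk', norm_smul, Real.norm_of_nonneg (by positivity)]
      gcongr
      exact norm_fderiv_rho_le _
    · rw [Measure.real, Complex.volume_closedBall]
      simp only [ENNReal.toReal_mul, ENNReal.toReal_pow, ENNReal.toReal_ofReal hd0.le,
        ENNReal.coe_toReal, NNReal.coe_real_pi]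
      rw [hd]; field_simp

/-! ### The product rule for Sobolev functions -/

theorem rho_neg (w : ℂ) : rho (-w) = rho w := ContDiffBump.normed_neg _ w

theorem mollifier_zero_neg (d : ℝ) (w : ℂ) : mollifier 0 d (-w) = mollifier 0 d w := by
  rw [mollifier, mollifier, sub_zero, sub_zero, smul_neg, rho_neg]

theorem mollifier_zero_sub (c : ℂ) (d : ℝ) (z : ℂ) : mollifier 0 d (z - c) = mollifier c d z := by
  rw [mollifier, mollifier, sub_zero]

theorem integral_mul_integral_swap {a b κ : ℂ → ℂ} (ha : Integrable a) (hb : Integrable b)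
    (hκ : Continuous κ) {C : ℝ} (hC : ∀ w, ‖κ w‖ ≤ C) :
    ∫ z, a z * ∫ c, b c * κ (z - c) = ∫ c, b c * ∫ z, a z * κ (z - c) := by
  simp only [← integral_const_mul]
  rw [integral_integral_swap]
  · congr 1; ext c; congr 1; ext z; ring
  · have h1 : Integrable (fun p : ℂ × ℂ => a p.1 * b p.2) (volume.prod volume) := ha.mul_prod hb
    have h2 := h1.mul_bdd (c := C) (g := fun p : ℂ × ℂ => κ (p.1 - p.2))
      (hκ.comp (continuous_fst.sub continuous_snd)).aestronglyMeasurable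
      (Filter.Eventually.of_forall fun p => hC _)
    refine h2.congr (Filter.Eventually.of_forall fun p => ?_)
    simp only [Function.uncurry]; ring

/-- Mollifying `a` does not change its integral against `b` in the limit, when `a` is uniformly
continuous near the points where `b` does not vanish. -/
theorem tendsto_integral_mul_mollified {a b : ℂ → ℂ} (ha : Integrable a) (hb : Integrable b)
    (hab : Integrable fun c => b c * a c)
    (h : ∀ ε > 0, ∃ δ > 0, ∀ c, b c ≠ 0 → ∀ z, ‖z - c‖ ≤ δ → ‖a z - a c‖ ≤ ε) :
    Filter.Tendsto (fun d : ℝ => ∫ c, b c * ∫ z, a z * (mollifier 0 d (z - c) : ℂ))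
      (nhdsWithin 0 (Ioi 0)) (nhds (∫ c, b c * a c)) := by
  rw [Metric.tendsto_nhds]
  intro ε hε
  set I := ∫ c, ‖b c‖ with hI
  have hI0 : 0 ≤ I := integral_nonneg fun _ => norm_nonneg _
  obtain ⟨δ, hδ, hδ'⟩ := h (ε / (2 * (I + 1))) (by positivity)
  filter_upwards [Ioc_mem_nhdsGT hδ] with d hd
  have hi : ∀ c, Integrable fun z => (mollifier c d z : ℂ) * a z := fun c => by
    have := integrable_mollifier_mul (X := univ) ha.integrableOn c d
    rwa [Measure.restrict_univ] at this
  have hm : ∀ c, Integrable fun z => mollifier c d z := fun c =>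
    (mollifier_contDiff _ _).continuous.integrable_of_hasCompactSupport
      (hasCompactSupport_mollifier hd.1)
  have hpt : ∀ c, b c ≠ 0 → ‖(∫ z, a z * (mollifier 0 d (z - c) : ℂ)) - a c‖
      ≤ ε / (2 * (I + 1)) := fun c hc => by
    have e : (∫ z, a z * (mollifier 0 d (z - c) : ℂ)) - a c
        = ∫ z, (mollifier c d z : ℂ) * (a z - a c) := by
      simp only [mul_sub, mollifier_zero_sub]
      have i2 : Integrable fun z => (mollifier c d z : ℂ) * a c := (hm c).ofReal.mul_const _
      rw [integral_sub (hi c) i2, integral_mul_const,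
        integral_complex_ofReal, integral_mollifier hd.1, Complex.ofReal_one, one_mul]
      congr 2; ext z; ring
    rw [e]
    refine (norm_integral_le_of_norm_le ((hm c).mul_const (ε / (2 * (I + 1))))
      (Filter.Eventually.of_forall fun z => ?_)).trans (le_of_eq ?_)
    · rw [norm_mul, Complex.norm_real, Real.norm_of_nonneg (mollifier_nonneg _ _ _)]
      by_cases hz : z ∈ Metric.closedBall c d
      · rw [Metric.mem_closedBall, dist_eq_norm] at hz
        exact mul_le_mul_of_nonneg_left (hδ' c hc z (hz.trans hd.2)) (mollifier_nonneg _ _ _)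
      · rw [mollifier_eq_zero hd.1 hz]; simp
    · rw [integral_mul_const, integral_mollifier hd.1, one_mul]
  have hmeas : Integrable fun c => b c * ∫ z, a z * (mollifier 0 d (z - c) : ℂ) := by
    have h1 : Integrable (fun p : ℂ × ℂ => b p.1 * a p.2) (volume.prod volume) := hb.mul_prod ha
    have h2 := h1.mul_bdd (c := (d ^ 2)⁻¹ * rhoBound)
      (g := fun p : ℂ × ℂ => (mollifier 0 d (p.2 - p.1) : ℂ))
      (Complex.continuous_ofReal.comp ((mollifier_contDiff 0 d).continuous.comp
        (continuous_snd.sub continuous_fst))).aestronglyMeasurable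
      (Filter.Eventually.of_forall fun p => by
        rw [Complex.norm_real, Real.norm_of_nonneg (mollifier_nonneg _ _ _)]
        exact mollifier_le _ _ _)
    refine h2.integral_prod_left.congr (Filter.Eventually.of_forall fun c => ?_)
    simp only [mul_assoc, integral_const_mul]
  rw [dist_eq_norm, ← integral_sub hmeas hab]
  refine (norm_integral_le_of_norm_le (hb.norm.mul_const (ε / (2 * (I + 1))))
    (Filter.Eventually.of_forall fun c => ?_)).trans_lt ?_
  · rw [← mul_sub, norm_mul]
    by_cases hc : b c = 0
    · simp [hc]
    · exact mul_le_mul_of_nonneg_left (hpt c hc) (norm_nonneg _)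
  · rw [integral_mul_const, ← hI]
    have : I * (ε / (2 * (I + 1))) = ε / 2 * (I / (I + 1)) := by field_simp
    rw [this]
    have : I / (I + 1) ≤ 1 := by rw [div_le_one (by positivity)]; linarith
    nlinarith

/-- Integration by parts for the product of two Sobolev functions with continuous representatives.
The product rule is obtained by doubling the variables: the weak derivative of `g` is tested with
`η(c) k(z - c)` as a function of `c`, that of `q` with `k(z - c)` as a function of `z`, where `k` is
a mollifier. -/
theorem integral_fderiv_mul_mul {X : Set ℂ} (hX : IsOpen X) {v : ℂ} {q g q' g' : ℂ → ℂ}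
    (Hq : HasWeakDeriv X v q q') (Hg : HasWeakDeriv X v g g') (hq : IntegrableOn q X)
    (hg : IntegrableOn g X) (hq' : IntegrableOn q' X) (hg' : IntegrableOn g' X)
    (cq : ContinuousOn q X) (cg : ContinuousOn g X) {η : ℂ → ℂ} (hη : ContDiff ℝ (⊤ : ℕ∞) η)
    (hc : HasCompactSupport η) (hs : tsupport η ⊆ X) :
    ∫ z in X, fderiv ℝ η z v * (q z * g z) = -∫ z in X, η z * (q' z * g z + q z * g' z) := by
  obtain ⟨Cη, hCη⟩ := hc.exists_bound_of_continuous hη.continuous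
  have hDη : Continuous fun z => fderiv ℝ η z v :=
    (hη.continuous_fderiv (by simp)).clm_apply continuous_const
  obtain ⟨CD, hCD⟩ := (hc.fderiv_apply ℝ v).exists_bound_of_continuous hDη
  have hη0 : ∀ z, z ∉ tsupport η → η z = 0 := fun z hz => image_eq_zero_of_notMem_tsupport hz
  have hDη0 : ∀ z, z ∉ tsupport η → fderiv ℝ η z v = 0 := fun z hz => by
    rw [fderiv_of_notMem_tsupport ℝ hz]; simp
  -- extension by zero
  have hi : ∀ {f : ℂ → ℂ}, IntegrableOn f X → Integrable (X.indicator f) := fun hf =>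
    (integrable_indicator_iff hX.measurableSet).2 hf
  have hind : ∀ φ f : ℂ → ℂ, ∫ z in X, φ z * f z = ∫ z, φ z * X.indicator f z := fun φ f => by
    rw [← integral_indicator hX.measurableSet]
    congr 1; ext z
    by_cases hz : z ∈ X <;> simp [hz]
  set Q := X.indicator q with hQ
  set Q' := X.indicator q' with hQ'
  set G := X.indicator g with hG
  set G' := X.indicator g' with hG'
  have iQ : Integrable Q := hi hq
  have iQ' : Integrable Q' := hi hq'
  have iG : Integrable G := hi hg
  have iG' : Integrable G' := hi hg'
  have WQ : ∀ φ : ℂ → ℂ, ContDiff ℝ (⊤ : ℕ∞) φ → HasCompactSupport φ → tsupport φ ⊆ X →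
      ∫ z, fderiv ℝ φ z v * Q z = -∫ z, φ z * Q' z := fun φ h1 h2 h3 => by
    rw [← hind, ← hind]; exact Hq.integral_complex hq hq' h1 h2 h3
  have WG : ∀ φ : ℂ → ℂ, ContDiff ℝ (⊤ : ℕ∞) φ → HasCompactSupport φ → tsupport φ ⊆ X →
      ∫ z, fderiv ℝ φ z v * G z = -∫ z, φ z * G' z := fun φ h1 h2 h3 => by
    rw [← hind, ← hind]; exact Hg.integral_complex hg hg' h1 h2 h3
  have iGη : Integrable fun c => G c * η c :=
    iG.mul_bdd (c := Cη) hη.continuous.aestronglyMeasurable (Filter.Eventually.of_forall hCη)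
  have iG'η : Integrable fun c => G' c * η c :=
    iG'.mul_bdd (c := Cη) hη.continuous.aestronglyMeasurable (Filter.Eventually.of_forall hCη)
  have iGD : Integrable fun c => G c * fderiv ℝ η c v :=
    iG.mul_bdd (c := CD) hDη.aestronglyMeasurable (Filter.Eventually.of_forall hCD)
  -- room around the support of `η`
  obtain ⟨δ₀, hδ₀, hthick⟩ := IsCompact.exists_cthickening_subset_open hc hX hs
  have hKc : IsCompact (Metric.cthickening δ₀ (tsupport η)) := IsCompact.cthickening hc
  -- uniform continuity of `Q` near the support and of `G η` everywhere
  have ucQ : ∀ ε > 0, ∃ δ > 0, ∀ c ∈ tsupport η, ∀ z, ‖z - c‖ ≤ δ → ‖Q z - Q c‖ ≤ ε := by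
    intro ε hε
    have hu := hKc.uniformContinuousOn_of_continuous (cq.mono hthick)
    obtain ⟨δ, hδ, h⟩ := Metric.uniformContinuousOn_iff_le.1 hu ε hε
    refine ⟨min δ δ₀, lt_min hδ hδ₀, fun c hcs z hz => ?_⟩
    have hz' : z ∈ Metric.cthickening δ₀ (tsupport η) :=
      Metric.mem_cthickening_of_dist_le z c δ₀ _ hcs (by
        rw [dist_eq_norm]; exact hz.trans (min_le_right _ _))
    have hc' : c ∈ Metric.cthickening δ₀ (tsupport η) := Metric.self_subset_cthickening _ hcs
    have := h z hz' c hc' (by rw [dist_eq_norm]; exact hz.trans (min_le_left _ _))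
    rwa [dist_eq_norm, ← indicator_of_mem (hthick hz') q, ← indicator_of_mem (hthick hc') q] at this
  have cGη : Continuous fun c => G c * η c := by
    rw [continuous_iff_continuousAt]
    intro z
    by_cases hz : z ∈ X
    · have h1 : (fun c => G c * η c) =ᶠ[nhds z] fun c => g c * η c := by
        filter_upwards [hX.mem_nhds hz] with c hc
        rw [hG, indicator_of_mem hc]
      exact (((cg.continuousAt (hX.mem_nhds hz)).mul hη.continuous.continuousAt).congr h1.symm)
    · have h1 : (fun c => G c * η c) =ᶠ[nhds z] fun c => 0 := by
        filter_upwards [(isClosed_tsupport η).isOpen_compl.mem_nhds fun h => hz (hs h)] with c hc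
        rw [hη0 c hc, mul_zero]
      exact continuousAt_const.congr h1.symm
  have ucG : ∀ ε > 0, ∃ δ > 0, ∀ c, Q' c ≠ 0 → ∀ z, ‖z - c‖ ≤ δ →
      ‖G z * η z - G c * η c‖ ≤ ε := by
    intro ε hε
    have hu := hc.mul_left.uniformContinuous_of_continuous cGη
    obtain ⟨δ, hδ, h⟩ := Metric.uniformContinuous_iff.1 hu ε hε
    refine ⟨δ / 2, by positivity, fun c _ z hz => ?_⟩
    have := h (a := z) (b := c) (by rw [dist_eq_norm]; linarith)
    rw [dist_eq_norm] at this
    exact this.le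
  have hbQ : ∃ C, ∀ c ∈ tsupport η, ‖Q c‖ ≤ C := by
    obtain ⟨C, hC⟩ := IsCompact.exists_bound_of_continuousOn hc (cq.mono hs)
    exact ⟨C, fun c hcs => by rw [hQ, indicator_of_mem (hs hcs)]; exact hC c hcs⟩
  obtain ⟨CQ, hCQ⟩ := hbQ
  have hbdd : ∀ b : ℂ → ℂ, Integrable b → (∀ c, c ∉ tsupport η → b c = 0) →
      Integrable fun c => b c * Q c := fun b hb hb0 => by
    refine (hb.norm.mul_const CQ).mono' (hb.1.mul iQ.1) (Filter.Eventually.of_forall fun c => ?_)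
    rw [norm_mul]
    by_cases hcs : c ∈ tsupport η
    · exact mul_le_mul_of_nonneg_left (hCQ c hcs) (norm_nonneg _)
    · simp [hb0 c hcs]
  have z1 : ∀ c, c ∉ tsupport η → G c * fderiv ℝ η c v = 0 := fun c h => by
    rw [hDη0 c h, mul_zero]
  have z2 : ∀ c, c ∉ tsupport η → G' c * η c = 0 := fun c h => by rw [hη0 c h, mul_zero]
  have ucQ' : ∀ b : ℂ → ℂ, (∀ c, c ∉ tsupport η → b c = 0) → ∀ ε > 0, ∃ δ > 0, ∀ c, b c ≠ 0 →
      ∀ z, ‖z - c‖ ≤ δ → ‖Q z - Q c‖ ≤ ε := fun b hb ε hε => by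
    obtain ⟨δ, hδ, h⟩ := ucQ ε hε
    exact ⟨δ, hδ, fun c hbc => h c (by by_contra hcon; exact hbc (hb c hcon))⟩
  have iQ'Gη : Integrable fun c => Q' c * (G c * η c) := by
    obtain ⟨C, hC⟩ := (hc.mul_left (f := G)).exists_bound_of_continuous cGη
    exact iQ'.mul_bdd (c := C) cGη.aestronglyMeasurable (Filter.Eventually.of_forall hC)
  have t1 := tendsto_integral_mul_mollified iQ iGD (hbdd _ iGD z1) (ucQ' _ z1)
  have t3 := tendsto_integral_mul_mollified iQ iG'η (hbdd _ iG'η z2) (ucQ' _ z2)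
  have t2 := tendsto_integral_mul_mollified iGη iQ' iQ'Gη ucG
  -- the identity before passing to the limit
  have hid : ∀ d, 0 < d → d ≤ δ₀ →
      ((∫ c, (G c * fderiv ℝ η c v) * ∫ z, Q z * (mollifier 0 d (z - c) : ℂ))
        + ∫ z, Q' z * ∫ c, (G c * η c) * (mollifier 0 d (c - z) : ℂ))
        + ∫ c, (G' c * η c) * ∫ z, Q z * (mollifier 0 d (z - c) : ℂ) = 0 := by
    intro d hd hdδ
    set k : ℂ → ℂ := fun w => (mollifier 0 d w : ℂ) with hk
    have ksm : ContDiff ℝ (⊤ : ℕ∞) k := Complex.ofRealCLM.contDiff.comp (mollifier_contDiff 0 d)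
    have kc : HasCompactSupport k := (hasCompactSupport_mollifier hd).comp_left Complex.ofReal_zero
    obtain ⟨Ck, hCk⟩ := kc.exists_bound_of_continuous ksm.continuous
    have hDk : Continuous fun z => fderiv ℝ k z v :=
      (ksm.continuous_fderiv (by simp)).clm_apply continuous_const
    obtain ⟨CDk, hCDk⟩ := (kc.fderiv_apply ℝ v).exists_bound_of_continuous hDk
    have kd : ∀ w, HasFDerivAt k (fderiv ℝ k w) w := fun w =>
      (ksm.differentiable (by simp) w).hasFDerivAt
    have hbk : ∀ {b κ : ℂ → ℂ} {C : ℝ} (z : ℂ), Integrable b → Continuous κ → (∀ w, ‖κ w‖ ≤ C) →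
        Integrable fun c => b c * κ (z - c) := fun {b κ C} z hb hκ hC =>
      hb.mul_bdd (c := C) (hκ.comp (continuous_const.sub continuous_id)).aestronglyMeasurable
        (Filter.Eventually.of_forall fun c => hC _)
    have eq1 : ∀ z, (∫ c, (G c * fderiv ℝ η c v) * k (z - c))
        - (∫ c, (G c * η c) * fderiv ℝ k (z - c) v) = -∫ c, (G' c * η c) * k (z - c) := by
      intro z
      have h1 := WG (fun c => η c * k (z - c))
        (hη.mul (ksm.comp (contDiff_const.sub contDiff_id))) hc.mul_right
        ((tsupport_mul_subset_left (f := η)).trans hs)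
      rw [← integral_sub (hbk z iGD ksm.continuous hCk) (hbk z iGη hDk hCDk)]
      have e1 : ∀ c, fderiv ℝ (fun c => η c * k (z - c)) c v
          = fderiv ℝ η c v * k (z - c) - η c * fderiv ℝ k (z - c) v := fun c => by
        have h2 : HasFDerivAt (fun c => k (z - c))
            ((fderiv ℝ k (z - c)).comp (-ContinuousLinearMap.id ℝ ℂ)) c :=
          (kd (z - c)).comp c ((hasFDerivAt_id c).const_sub z)
        have h3 : HasFDerivAt (fun c => η c * k (z - c)) _ c :=
          ((hη.differentiable (by simp) c).hasFDerivAt).mul h2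
        rw [h3.fderiv]
        simp
        ring
      simp only [e1] at h1
      calc _ = ∫ c, (fderiv ℝ η c v * k (z - c) - η c * fderiv ℝ k (z - c) v) * G c := by
            congr 1; ext c; ring
        _ = -∫ c, η c * k (z - c) * G' c := h1
        _ = _ := by congr 2; ext c; ring
    have eq2 : ∀ c, (G c * η c) * (∫ z, Q z * fderiv ℝ k (z - c) v)
        = -((G c * η c) * ∫ z, Q' z * k (z - c)) := by
      intro c
      by_cases hcs : c ∈ tsupport η
      · have hball : tsupport (fun z => k (z - c)) ⊆ X := by
          have : (fun z => k (z - c)) = fun z => ((mollifier c d z : ℝ) : ℂ) := by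
            ext z; rw [hk]; simp only [mollifier_zero_sub]
          rw [this]
          refine (tsupport_comp_subset (g := fun x : ℝ => (x : ℂ)) Complex.ofReal_zero _).trans
            ((tsupport_mollifier_subset hd).trans fun z hz => hthick ?_)
          exact Metric.mem_cthickening_of_dist_le z c δ₀ _ hcs
            ((Metric.mem_closedBall.1 hz).trans hdδ)
        have hcomp : HasCompactSupport fun z => k (z - c) :=
          kc.comp_homeomorph (Homeomorph.subRight c)
        have h1 := WQ (fun z => k (z - c)) (ksm.comp (contDiff_id.sub contDiff_const)) hcomp hball
        have e1 : ∀ z, fderiv ℝ (fun z => k (z - c)) z v = fderiv ℝ k (z - c) v := fun z => by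
          have h2 : HasFDerivAt (fun z => k (z - c))
              ((fderiv ℝ k (z - c)).comp (ContinuousLinearMap.id ℝ ℂ)) z :=
            (kd (z - c)).comp z ((hasFDerivAt_id z).sub_const c)
          rw [h2.fderiv, ContinuousLinearMap.comp_id]
        simp only [e1] at h1
        have h2 : ∫ z, Q z * fderiv ℝ k (z - c) v = -∫ z, Q' z * k (z - c) := by
          simp only [mul_comm (Q _), mul_comm (Q' _)]
          exact h1
        rw [h2]; ring
      · rw [hη0 c hcs]; simp
    have s1 := integral_mul_integral_swap iQ iGD ksm.continuous hCk
    have s2 := integral_mul_integral_swap iQ iGη hDk hCDk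
    have s3 := integral_mul_integral_swap iQ iG'η ksm.continuous hCk
    have s4 := integral_mul_integral_swap iQ' iGη ksm.continuous hCk
    have hii : ∀ {a b κ : ℂ → ℂ} {C : ℝ}, Integrable a → Integrable b → Continuous κ →
        (∀ w, ‖κ w‖ ≤ C) → Integrable fun z => a z * ∫ c, b c * κ (z - c) :=
      fun {a b κ C} ha hb hκ hC => by
        have h1 : Integrable (fun p : ℂ × ℂ => a p.1 * b p.2) (volume.prod volume) := ha.mul_prod hb
        have h2 := h1.mul_bdd (c := C) (g := fun p : ℂ × ℂ => κ (p.1 - p.2))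
          (hκ.comp (continuous_fst.sub continuous_snd)).aestronglyMeasurable
          (Filter.Eventually.of_forall fun p => hC _)
        refine h2.integral_prod_left.congr (Filter.Eventually.of_forall fun c => ?_)
        simp only [mul_assoc, integral_const_mul]
    have hsum : (∫ z, Q z * ∫ c, (G c * fderiv ℝ η c v) * k (z - c))
        - (∫ z, Q z * ∫ c, (G c * η c) * fderiv ℝ k (z - c) v)
        = -∫ z, Q z * ∫ c, (G' c * η c) * k (z - c) := by
      rw [← integral_sub (hii iQ iGD ksm.continuous hCk) (hii iQ iGη hDk hCDk), ← integral_neg]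
      congr 1; ext z
      rw [← mul_sub, eq1 z, mul_neg]
    have hsym : ∀ z c, (mollifier 0 d (c - z) : ℂ) = k (z - c) := fun z c => by
      rw [hk]; simp only [← mollifier_zero_neg d (z - c), neg_sub]
    have hsym' : (∫ z, Q' z * ∫ c, (G c * η c) * (mollifier 0 d (c - z) : ℂ))
        = ∫ z, Q' z * ∫ c, (G c * η c) * k (z - c) := by simp only [hsym]
    rw [s1, s2, s3] at hsum
    simp only [eq2, integral_neg] at hsum
    rw [hsym', s4]
    simp only [hk] at hsum ⊢
    linear_combination hsum
  have hlim := (t1.add t2).add t3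
  have hzero : ((∫ c, (G c * fderiv ℝ η c v) * Q c) + ∫ c, Q' c * (G c * η c))
      + ∫ c, (G' c * η c) * Q c = 0 := by
    refine tendsto_nhds_unique hlim ((tendsto_const_nhds (x := (0 : ℂ))).congr' ?_)
    filter_upwards [Ioc_mem_nhdsGT hδ₀] with d hd
    exact (hid d hd.1 hd.2).symm
  rw [hind, hind, ← sub_eq_zero, sub_neg_eq_add, ← hzero]
  have j1 : ∫ z, fderiv ℝ η z v * X.indicator (fun z => q z * g z) z
      = ∫ c, (G c * fderiv ℝ η c v) * Q c := by
    congr 1; ext z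
    by_cases hz : z ∈ X
    · simp only [hG, hQ, indicator_of_mem hz]; ring
    · simp [hG, hz]
  have j2 : ∫ z, η z * X.indicator (fun z => q' z * g z + q z * g' z) z
      = (∫ c, Q' c * (G c * η c)) + ∫ c, (G' c * η c) * Q c := by
    rw [← integral_add iQ'Gη (hbdd _ iG'η z2)]
    congr 1; ext z
    by_cases hz : z ∈ X
    · simp only [hG, hQ, hQ', hG', indicator_of_mem hz]; ring
    · simp [hG, hG', hz]
  rw [j1, j2, add_assoc]

/-! ### The `L²` bound for the oscillatory integral -/

section

open FourierTransform

/-- For `f ∈ L¹ ∩ L²` the Fourier integral agrees with the `L²` Fourier transform, so that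
Plancherel's theorem applies to it. -/
theorem eLpNorm_fourier_eq {f : ℂ → ℂ} (h1 : Integrable f) (h2 : MemLp f 2 volume) :
    eLpNorm (𝓕 f) 2 volume = eLpNorm f 2 volume := by
  set F : Lp ℂ 2 (volume : Measure ℂ) := 𝓕 (h2.toLp f) with hF
  have hcont : Continuous (𝓕 f) :=
    VectorFourier.fourierIntegral_continuous Real.continuous_fourierChar
      (by exact continuous_inner) h1
  have hae : ∀ᵐ w, (F : ℂ → ℂ) w = 𝓕 f w := by
    refine ae_eq_of_integral_contDiff_smul_eq
      ((Lp.memLp F).locallyIntegrable (by norm_num)) hcont.locallyIntegrable fun g hg hgc => ?_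
    have hg₁ : HasCompactSupport (Complex.ofRealCLM ∘ g) := hgc.comp_left rfl
    have hg₂ : ContDiff ℝ (⊤ : ℕ∞) (Complex.ofRealCLM ∘ g) := by fun_prop
    set φ := hg₁.toSchwartzMap hg₂ with hφ
    have hφg : ∀ w, φ w = (g w : ℂ) := fun w => rfl
    have e1 := congrArg (fun T => T φ)
      (Lp.fourier_toTemperedDistribution_eq (E := ℂ) (F := ℂ) (h2.toLp f))
    simp only [TemperedDistribution.fourier_apply, Lp.toTemperedDistribution_apply] at e1
    have e2 : ∫ x, (𝓕 φ) x • (h2.toLp f : ℂ → ℂ) x = ∫ x, (𝓕 φ) x • f x :=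
      integral_congr_ae (by filter_upwards [h2.coeFn_toLp] with x hx; rw [hx])
    have e3 : ∫ x, (𝓕 φ) x • f x = ∫ x, φ x • 𝓕 f x := by
      rw [SchwartzMap.fourier_coe]
      have := VectorFourier.integral_fourierIntegral_smul_eq_flip (L := innerₗ ℂ)
        (μ := volume) (ν := volume) Real.continuous_fourierChar (by exact continuous_inner)
        (f := φ) φ.integrable h1
      rw [flip_innerₗ] at this
      exact this
    calc ∫ x, g x • (F : ℂ → ℂ) x = ∫ x, φ x • (F : ℂ → ℂ) x := by
          congr 1
      _ = ∫ x, φ x • 𝓕 f x := by rw [← e3, ← e2, e1]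
      _ = ∫ x, g x • 𝓕 f x := by
          congr 1
  rw [← eLpNorm_congr_ae hae, ← eLpNorm_congr_ae h2.coeFn_toLp]
  have := Lp.norm_fourier_eq (h2.toLp f)
  rw [Lp.norm_def, Lp.norm_def] at this
  exact (ENNReal.toReal_eq_toReal_iff' (Lp.eLpNorm_ne_top _) (Lp.eLpNorm_ne_top _)).1 this

/-- Expanding the squares separates the phase into functions of `z₀` and of `z` alone and a
Fourier character. -/
theorem phaseKernel_eq (n : ℝ) (z₀ z : ℂ) :
    phaseKernel n z₀ z = (2 * n / Real.pi : ℝ) *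
      Complex.exp (Complex.I * n * (z₀ ^ 2 + (starRingEnd ℂ) z₀ ^ 2)) *
      (Complex.exp (Complex.I * n * (z ^ 2 + (starRingEnd ℂ) z ^ 2)) *
        (Real.fourierChar (-(inner ℝ z ((2 * n / Real.pi) • (starRingEnd ℂ) z₀))) : ℂ)) := by
  rw [phaseKernel, Real.fourierChar_apply, ← Complex.exp_add,
    mul_assoc _ (Complex.exp _) (Complex.exp _), ← Complex.exp_add]
  congr 2
  have hpi : (Real.pi : ℂ) ≠ 0 := by exact_mod_cast Real.pi_ne_zero
  have e : ((inner ℝ z ((2 * n / Real.pi) • (starRingEnd ℂ) z₀) : ℝ) : ℂ)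
      = (2 * n / Real.pi : ℂ) * ((z * z₀ + (starRingEnd ℂ) z * (starRingEnd ℂ) z₀) / 2) := by
    rw [inner_smul_right, Complex.inner, Complex.ofReal_mul, ← map_mul, Complex.re_eq_add_conj]
    push_cast
    simp only [map_mul, Complex.conj_conj]
    ring
  push_cast
  rw [e]
  field_simp
  ring

theorem continuous_phaseKernel (n : ℝ) : Continuous fun w : ℂ × ℂ => phaseKernel n w.1 w.2 := by
  unfold phaseKernel
  have := Complex.continuous_conj
  fun_prop

theorem norm_exp_phase (n : ℝ) (z : ℂ) :
    ‖Complex.exp (Complex.I * n * (z ^ 2 + (starRingEnd ℂ) z ^ 2))‖ = 1 := by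
  have : Complex.I * n * (z ^ 2 + (starRingEnd ℂ) z ^ 2)
      = ((2 * n * (z ^ 2).re : ℝ) : ℂ) * Complex.I := by
    rw [← map_pow, Complex.add_conj]; push_cast; ring
  rw [this, Complex.norm_exp_ofReal_mul_I]

theorem norm_phaseKernel {n : ℝ} (hn : 0 < n) (z₀ z : ℂ) :
    ‖phaseKernel n z₀ z‖ = 2 * n / Real.pi := by
  have := norm_exp_phase n (z - z₀)
  rw [map_sub] at this
  rw [phaseKernel, norm_mul, this, mul_one, Complex.norm_real, Real.norm_of_nonneg (by positivity)]

/-- Up to unimodular factors, a dilation and a reflection, integration against the phase kernel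
is the Fourier transform; it is therefore isometric on `L²`. -/
theorem eLpNorm_phaseKernel_integral_eq {n : ℝ} (hn : 0 < n) {Q : ℂ → ℂ} (h1 : Integrable Q)
    (h2 : MemLp Q 2 volume) :
    eLpNorm (fun z₀ => ∫ z, phaseKernel n z₀ z * Q z) 2 volume = eLpNorm Q 2 volume := by
  set s : ℝ := 2 * n / Real.pi with hs
  have hs0 : 0 < s := by positivity
  set E : ℂ → ℂ := fun z => Complex.exp (Complex.I * n * (z ^ 2 + (starRingEnd ℂ) z ^ 2)) with hE
  have hEc : Continuous E := by
    have := Complex.continuous_conj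
    rw [hE]; fun_prop
  have hEn : ∀ z, ‖E z‖ = 1 := norm_exp_phase n
  set Q₁ : ℂ → ℂ := fun z => E z * Q z with hQ₁
  have hQn : ∀ z, ‖Q₁ z‖ = ‖Q z‖ := fun z => by rw [hQ₁]; simp only [norm_mul, hEn, one_mul]
  have i1 : Integrable Q₁ := h1.bdd_mul (c := 1) hEc.aestronglyMeasurable
    (Filter.Eventually.of_forall fun z => (hEn z).le)
  have i2 : MemLp Q₁ 2 volume := (memLp_congr_norm i1.1 h2.1
    (Filter.Eventually.of_forall hQn)).2 h2
  have hT : ∀ z₀, ∫ z, phaseKernel n z₀ z * Q z = (s : ℂ) * E z₀ * 𝓕 Q₁ (s • (starRingEnd ℂ) z₀) :=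
    fun z₀ => by
      rw [Real.fourier_eq, ← integral_const_mul]
      congr 1; ext z
      rw [phaseKernel_eq, Circle.smul_def, smul_eq_mul, hQ₁]
      ring
  have hconj : MeasurePreserving (starRingEnd ℂ) volume volume :=
    Complex.conjLIE.measurePreserving
  have hcont : Continuous (𝓕 Q₁) :=
    VectorFourier.fourierIntegral_continuous Real.continuous_fourierChar
      (by exact continuous_inner) i1
  have e1 : eLpNorm (fun z₀ => ∫ z, phaseKernel n z₀ z * Q z) 2 volume
      = ENNReal.ofReal s * eLpNorm (fun z₀ => 𝓕 Q₁ (s • (starRingEnd ℂ) z₀)) 2 volume := by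
    have : eLpNorm (fun z₀ => ∫ z, phaseKernel n z₀ z * Q z) 2 volume
        = eLpNorm (fun z₀ => (s : ℂ) • 𝓕 Q₁ (s • (starRingEnd ℂ) z₀)) 2 volume := by
      refine eLpNorm_congr_norm_ae (Filter.Eventually.of_forall fun z₀ => ?_)
      rw [hT, norm_mul, norm_mul, hEn, mul_one, norm_smul]
    rw [this]
    have h3 := eLpNorm_const_smul (s : ℂ) (fun z₀ => 𝓕 Q₁ (s • (starRingEnd ℂ) z₀)) 2 volume
    rw [← ofReal_norm, Complex.norm_real, Real.norm_of_nonneg hs0.le] at h3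
    exact h3
  have e2 : eLpNorm (fun z₀ => 𝓕 Q₁ (s • (starRingEnd ℂ) z₀)) 2 volume
      = eLpNorm (fun z₀ => 𝓕 Q₁ (s • z₀)) 2 volume :=
    eLpNorm_comp_measurePreserving (g := fun z₀ => 𝓕 Q₁ (s • z₀))
      (hcont.comp (continuous_const_smul s)).aestronglyMeasurable hconj
  have e3 : eLpNorm (fun z₀ => 𝓕 Q₁ (s • z₀)) 2 volume
      = ENNReal.ofReal s⁻¹ * eLpNorm (𝓕 Q₁) 2 volume := by
    have hm : Measurable fun z : ℂ => s • z := measurable_const_smul s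
    have h4 := eLpNorm_map_measure (p := 2) (μ := volume) (g := 𝓕 Q₁) (f := fun z : ℂ => s • z)
      hcont.aestronglyMeasurable hm.aemeasurable
    change _ = eLpNorm (fun z₀ => 𝓕 Q₁ (s • z₀)) 2 volume at h4
    rw [← h4, Measure.map_addHaar_smul _ hs0.ne', Complex.finrank_real_complex,
      eLpNorm_smul_measure_of_ne_top (by norm_num), smul_eq_mul]
    congr 1
    rw [abs_of_pos (by positivity), ← inv_pow, ENNReal.ofReal_pow (by positivity),
      ← ENNReal.rpow_natCast, ← ENNReal.rpow_mul]
    norm_num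
  rw [e1, e2, e3, eLpNorm_fourier_eq i1 i2, ← mul_assoc, ← ENNReal.ofReal_mul hs0.le,
    mul_inv_cancel₀ hs0.ne', ENNReal.ofReal_one, one_mul]
  exact eLpNorm_congr_norm_ae (Filter.Eventually.of_forall hQn)

end

/-! ### Integration by parts against the phase -/

theorem HasWeakDeriv.sub_const {X : Set ℂ} {v : ℂ} {f h : ℂ → ℂ}
    (H : HasWeakDeriv X v f h) (hf : IntegrableOn f X) (c : ℂ) :
    HasWeakDeriv X v (fun z => f z - c) h := by
  refine ⟨H.1, fun φ hφ hc hs => ?_⟩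
  rw [← H.2 φ hφ hc hs]
  have hcont : Continuous fun z => fderiv ℝ φ z v :=
    (hφ.continuous_fderiv (by simp)).clm_apply continuous_const
  obtain ⟨C, hC⟩ := (hc.fderiv_apply ℝ v).exists_bound_of_continuous hcont
  have i1 : Integrable (fun z => fderiv ℝ φ z v • f z) (volume.restrict X) :=
    hf.bdd_smul C hcont.aestronglyMeasurable (Filter.Eventually.of_forall hC)
  have i2 : Integrable (fun z => fderiv ℝ φ z v) :=
    hcont.integrable_of_hasCompactSupport (hc.fderiv_apply ℝ v)
  have h0 : ∫ z in X, fderiv ℝ φ z v = 0 := by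
    rw [setIntegral_eq_integral_of_forall_compl_eq_zero fun z hz => by
      rw [fderiv_of_notMem_tsupport ℝ fun h => hz (hs h)]; simp]
    have := integral_mul_fderiv_eq_neg_fderiv_mul_of_integrable (μ := (volume : Measure ℂ))
      (f := fun _ : ℂ => (1 : ℝ)) (g := φ) (v := v) (by simp) (by simpa using i2)
      (by simpa using hφ.continuous.integrable_of_hasCompactSupport hc)
      (by fun_prop) (fun x _ => hφ.differentiable (by simp) x)
    simpa using this
  simp only [smul_sub]
  rw [integral_sub i1 (i2.integrableOn.smul_const c), integral_smul_const, h0, zero_smul, sub_zero]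

/-- The oscillating factor of the phase kernel. -/
noncomputable def phase (n : ℝ) (z₀ z : ℂ) : ℂ :=
  Complex.exp (Complex.I * n * ((z - z₀) ^ 2 + ((starRingEnd ℂ) z - (starRingEnd ℂ) z₀) ^ 2))

theorem norm_phase (n : ℝ) (z₀ z : ℂ) : ‖phase n z₀ z‖ = 1 := by
  have := norm_exp_phase n (z - z₀)
  rwa [map_sub] at this

/-- The regularisation `phase * ζ / (|ζ|² + κ)`, where `ζ = z - z₀`, of the function
`phase / conj ζ`, whose `∂̄`-derivative would be `2 i n * phase` up to a term without the
factor `n`. -/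
noncomputable def regPhase (n κ : ℝ) (z₀ z : ℂ) : ℂ :=
  phase n z₀ z * (z - z₀) * ((z - z₀) * ((starRingEnd ℂ) z - (starRingEnd ℂ) z₀) + κ)⁻¹

theorem regPhase_denom (κ : ℝ) (z₀ z : ℂ) :
    (z - z₀) * ((starRingEnd ℂ) z - (starRingEnd ℂ) z₀) + κ = ((‖z - z₀‖ ^ 2 + κ : ℝ) : ℂ) := by
  rw [← map_sub, Complex.mul_conj, Complex.normSq_eq_norm_sq]; push_cast; ring

theorem regPhase_denom_ne_zero {κ : ℝ} (hκ : 0 < κ) (z₀ z : ℂ) :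
    (z - z₀) * ((starRingEnd ℂ) z - (starRingEnd ℂ) z₀) + κ ≠ 0 := by
  rw [regPhase_denom]
  exact_mod_cast (by positivity : (0 : ℝ) < ‖z - z₀‖ ^ 2 + κ).ne'

theorem contDiff_phase (n : ℝ) (z₀ : ℂ) : ContDiff ℝ (⊤ : ℕ∞) (phase n z₀) := by
  have hc : ContDiff ℝ (⊤ : ℕ∞) fun z : ℂ => (starRingEnd ℂ) z := Complex.conjCLE.contDiff
  unfold phase
  exact (contDiff_const.mul (((contDiff_id.sub contDiff_const).pow 2).add
    ((hc.sub contDiff_const).pow 2))).cexp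

theorem contDiff_regPhase (n : ℝ) {κ : ℝ} (hκ : 0 < κ) (z₀ : ℂ) :
    ContDiff ℝ (⊤ : ℕ∞) (regPhase n κ z₀) := by
  have hc : ContDiff ℝ (⊤ : ℕ∞) fun z : ℂ => (starRingEnd ℂ) z := Complex.conjCLE.contDiff
  exact ((contDiff_phase n z₀).mul (contDiff_id.sub contDiff_const)).mul
    ((((contDiff_id.sub contDiff_const).mul (hc.sub contDiff_const)).add contDiff_const).inv
      fun z => regPhase_denom_ne_zero hκ z₀ z)

theorem fderiv_regPhase (n : ℝ) {κ : ℝ} (hκ : 0 < κ) (z₀ z v : ℂ) :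
    fderiv ℝ (regPhase n κ z₀) z v = phase n z₀ z *
      (Complex.I * n * (2 * (z - z₀) * v + 2 * ((starRingEnd ℂ) z - (starRingEnd ℂ) z₀) *
          (starRingEnd ℂ) v) * (z - z₀) *
          ((z - z₀) * ((starRingEnd ℂ) z - (starRingEnd ℂ) z₀) + κ)⁻¹
        + v * ((z - z₀) * ((starRingEnd ℂ) z - (starRingEnd ℂ) z₀) + κ)⁻¹
        - (z - z₀) * (v * ((starRingEnd ℂ) z - (starRingEnd ℂ) z₀) + (z - z₀) * (starRingEnd ℂ) v)
          * (((z - z₀) * ((starRingEnd ℂ) z - (starRingEnd ℂ) z₀) + κ)⁻¹) ^ 2) := by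
  have hD := regPhase_denom_ne_zero hκ z₀ z
  have hd := (contDiff_regPhase n hκ z₀).differentiable (by simp) z
  rw [← hd.lineDeriv_eq_fderiv]
  refine HasLineDerivAt.lineDeriv ?_
  have hA : HasDerivAt (fun t : ℝ => z + t • v - z₀) v 0 := by
    simpa using (((hasDerivAt_id (0 : ℝ)).smul_const v).const_add z).sub_const z₀
  have hB : HasDerivAt (fun t : ℝ => (starRingEnd ℂ) (z + t • v) - (starRingEnd ℂ) z₀)
      ((starRingEnd ℂ) v) 0 := by
    have : HasDerivAt (fun t : ℝ => (starRingEnd ℂ) z + t • (starRingEnd ℂ) v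
        - (starRingEnd ℂ) z₀) ((starRingEnd ℂ) v) 0 := by
      simpa using (((hasDerivAt_id (0 : ℝ)).smul_const ((starRingEnd ℂ) v)).const_add
        ((starRingEnd ℂ) z)).sub_const ((starRingEnd ℂ) z₀)
    convert! this using 1
    ext t
    simp
  have h1 := ((((hA.fun_pow 2).fun_add (hB.fun_pow 2)).const_mul (Complex.I * n)).cexp.fun_mul
    hA).fun_mul (((hA.fun_mul hB).add_const (κ : ℂ)).fun_inv (by simpa using hD))
  unfold HasLineDerivAt
  convert! h1 using 1
  simp only [zero_smul, add_zero, phase]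
  field_simp
  ring

/-- Twice the Cauchy-Riemann derivative of the regularised phase. -/
theorem dbar_regPhase (n : ℝ) {κ : ℝ} (hκ : 0 < κ) (z₀ z : ℂ) :
    fderiv ℝ (regPhase n κ z₀) z 1 + Complex.I * fderiv ℝ (regPhase n κ z₀) z Complex.I
      = 4 * Complex.I * n * (phase n z₀ z * ((‖z - z₀‖ ^ 2 / (‖z - z₀‖ ^ 2 + κ) : ℝ) : ℂ))
        - 2 * phase n z₀ z * (z - z₀) ^ 2 * (((‖z - z₀‖ ^ 2 + κ : ℝ) : ℂ)⁻¹) ^ 2 := by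
  have hD := regPhase_denom_ne_zero hκ z₀ z
  have hN : ((‖z - z₀‖ ^ 2 : ℝ) : ℂ) = (z - z₀) * ((starRingEnd ℂ) z - (starRingEnd ℂ) z₀) := by
    have := regPhase_denom 0 z₀ z
    simpa using this.symm
  rw [fderiv_regPhase n hκ, fderiv_regPhase n hκ, Complex.ofReal_div, ← regPhase_denom, hN]
  simp only [map_one, Complex.conj_I]
  set A := z - z₀
  set B := (starRingEnd ℂ) z - (starRingEnd ℂ) z₀
  rw [div_eq_mul_inv]
  set D := (A * B + κ)⁻¹
  linear_combination (phase n z₀ z * (2 * Complex.I * n * A * A * D + D - A * B * D ^ 2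
    - 2 * Complex.I * n * A * B * D + A ^ 2 * D ^ 2)) * Complex.I_sq

theorem enorm_regPhase_le (n : ℝ) {κ : ℝ} (hκ : 0 < κ) (z₀ z : ℂ) :
    ‖regPhase n κ z₀ z‖ₑ ≤ ‖z - z₀‖ₑ⁻¹ := by
  rcases eq_or_ne z z₀ with rfl | hne
  · simp [regPhase]
  have h0 : 0 < ‖z - z₀‖ := norm_pos_iff.2 (sub_ne_zero.2 hne)
  rw [← ofReal_norm (z - z₀), ← ENNReal.ofReal_inv_of_pos h0, ← ofReal_norm]
  refine ENNReal.ofReal_le_ofReal ?_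
  rw [regPhase, regPhase_denom, norm_mul, norm_mul, norm_phase, one_mul, norm_inv,
    Complex.norm_real, Real.norm_of_nonneg (by positivity), ← div_eq_mul_inv,
    div_le_iff₀ (by positivity), inv_mul_eq_div, le_div_iff₀ h0]
  nlinarith

theorem enorm_dbar_error_le (n : ℝ) {κ : ℝ} (hκ : 0 < κ) (z₀ z : ℂ) :
    ‖2 * phase n z₀ z * (z - z₀) ^ 2 * (((‖z - z₀‖ ^ 2 + κ : ℝ) : ℂ)⁻¹) ^ 2‖ₑ
      ≤ 2 * (‖z - z₀‖ₑ⁻¹) ^ 2 := by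
  rcases eq_or_ne z z₀ with rfl | hne
  · simp
  have h0 : 0 < ‖z - z₀‖ := norm_pos_iff.2 (sub_ne_zero.2 hne)
  rw [← ofReal_norm (z - z₀), ← ENNReal.ofReal_inv_of_pos h0, ← ofReal_norm,
    ← ENNReal.ofReal_pow (by positivity), ← ENNReal.ofReal_ofNat,
    ← ENNReal.ofReal_mul (by norm_num)]
  refine ENNReal.ofReal_le_ofReal ?_
  rw [norm_mul, norm_mul, norm_mul, norm_phase, norm_pow, norm_pow, norm_inv, Complex.norm_real,
    Real.norm_of_nonneg (by positivity), Complex.norm_ofNat, mul_one, mul_assoc, ← mul_pow]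
  gcongr
  rw [← div_eq_mul_inv, div_le_iff₀ (by positivity), inv_mul_eq_div, le_div_iff₀ h0]
  nlinarith

/-- Integrating by parts once gains a factor `n⁻¹` at the price of the singular factors
`|z - z₀|⁻¹` and `|z - z₀|⁻²`. -/
theorem enorm_integral_cutoff_phase_le {X : Set ℂ} (hX : IsOpen X) {q q₁ q₂ H h₁ h₂ : ℂ → ℂ}
    (Hq₁ : HasWeakDeriv X 1 q q₁) (Hq₂ : HasWeakDeriv X Complex.I q q₂)
    (Hh₁ : HasWeakDeriv X 1 H h₁) (Hh₂ : HasWeakDeriv X Complex.I H h₂)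
    (iq : IntegrableOn q X) (iq₁ : IntegrableOn q₁ X) (iq₂ : IntegrableOn q₂ X)
    (iH : IntegrableOn H X) (ih₁ : IntegrableOn h₁ X) (ih₂ : IntegrableOn h₂ X)
    (cq : ContinuousOn q X) (cH : ContinuousOn H X) (iqH : IntegrableOn (fun z => q z * H z) X)
    {χ : ℂ → ℝ} (hχ : ContDiff ℝ (⊤ : ℕ∞) χ) (hχc : HasCompactSupport χ) (hχX : tsupport χ ⊆ X)
    (hχ1 : ∀ z, 0 ≤ χ z ∧ χ z ≤ 1) {n : ℝ} (hn : 0 < n) (z₀ : ℂ) :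
    ENNReal.ofReal (4 * n) * ‖∫ z in X, (χ z : ℂ) * phase n z₀ z * (q z * H z)‖ₑ ≤
      (∫⁻ z in X, 2 * (‖z - z₀‖ₑ⁻¹) ^ 2 * (‖q z‖ₑ * ‖H z‖ₑ))
      + (∫⁻ z in X, 2 * ‖fderiv ℝ χ z‖ₑ * ‖z - z₀‖ₑ⁻¹ * (‖q z‖ₑ * ‖H z‖ₑ))
      + (∫⁻ z in X, ‖z - z₀‖ₑ⁻¹ * (‖q₁ z‖ₑ * ‖H z‖ₑ + ‖q z‖ₑ * ‖h₁ z‖ₑ))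
      + ∫⁻ z in X, ‖z - z₀‖ₑ⁻¹ * (‖q₂ z‖ₑ * ‖H z‖ₑ + ‖q z‖ₑ * ‖h₂ z‖ₑ) := by
  set B := (∫⁻ z in X, 2 * (‖z - z₀‖ₑ⁻¹) ^ 2 * (‖q z‖ₑ * ‖H z‖ₑ))
      + (∫⁻ z in X, 2 * ‖fderiv ℝ χ z‖ₑ * ‖z - z₀‖ₑ⁻¹ * (‖q z‖ₑ * ‖H z‖ₑ))
      + (∫⁻ z in X, ‖z - z₀‖ₑ⁻¹ * (‖q₁ z‖ₑ * ‖H z‖ₑ + ‖q z‖ₑ * ‖h₁ z‖ₑ))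
      + ∫⁻ z in X, ‖z - z₀‖ₑ⁻¹ * (‖q₂ z‖ₑ * ‖H z‖ₑ + ‖q z‖ₑ * ‖h₂ z‖ₑ) with hB
  have hχC : ContDiff ℝ (⊤ : ℕ∞) fun z => (χ z : ℂ) := Complex.ofRealCLM.contDiff.comp hχ
  have hχCc : HasCompactSupport fun z => (χ z : ℂ) := hχc.comp_left Complex.ofReal_zero
  have hχ1' : ∀ z, ‖(χ z : ℂ)‖ₑ ≤ 1 := fun z => by
    rw [← ofReal_norm, Complex.norm_real, Real.norm_of_nonneg (hχ1 z).1, ← ENNReal.ofReal_one]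
    exact ENNReal.ofReal_le_ofReal (hχ1 z).2
  have hphc : Continuous (phase n z₀) := (contDiff_phase n z₀).continuous
  -- the estimate for the regularised phase
  have key : ∀ κ : ℝ, 0 < κ → ‖∫ z in X, 4 * Complex.I * n * ((χ z : ℂ) * phase n z₀ z *
      ((‖z - z₀‖ ^ 2 / (‖z - z₀‖ ^ 2 + κ) : ℝ) : ℂ) * (q z * H z))‖ₑ ≤ B := by
    intro κ hκ
    have hE := contDiff_regPhase n hκ z₀
    set η : ℂ → ℂ := fun z => (χ z : ℂ) * regPhase n κ z₀ z with hη
    have hηs : ContDiff ℝ (⊤ : ℕ∞) η := hχC.mul hE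
    have hηc : HasCompactSupport η := hχCc.mul_right
    have hηX : tsupport η ⊆ X := (tsupport_mul_subset_left (f := fun z => (χ z : ℂ))).trans
      ((tsupport_comp_subset (g := fun x : ℝ => (x : ℂ)) Complex.ofReal_zero χ).trans hχX)
    have e1 := integral_fderiv_mul_mul hX Hq₁ Hh₁ iq iH iq₁ ih₁ cq cH hηs hηc hηX
    have e2 := integral_fderiv_mul_mul hX Hq₂ Hh₂ iq iH iq₂ ih₂ cq cH hηs hηc hηX
    have hbd : ∀ {c : ℂ → ℂ}, Continuous c → HasCompactSupport c →
        Integrable (fun z => c z * (q z * H z)) (volume.restrict X) := fun {c} hc hcc => by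
      obtain ⟨C, hC⟩ := hcc.exists_bound_of_continuous hc
      exact iqH.bdd_mul (c := C) hc.aestronglyMeasurable (Filter.Eventually.of_forall hC)
    have cD : ∀ v, Continuous fun z => fderiv ℝ η z v := fun v =>
      (hηs.continuous_fderiv (by simp)).clm_apply continuous_const
    have j1 := hbd (cD 1) (hηc.fderiv_apply ℝ 1)
    have j2 := hbd (cD Complex.I) (hηc.fderiv_apply ℝ Complex.I)
    have hsum : ∫ z in X, (fderiv ℝ η z 1 + Complex.I * fderiv ℝ η z Complex.I) * (q z * H z)
        = -(∫ z in X, η z * (q₁ z * H z + q z * h₁ z))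
          - Complex.I * ∫ z in X, η z * (q₂ z * H z + q z * h₂ z) := by
      have : ∀ z, (fderiv ℝ η z 1 + Complex.I * fderiv ℝ η z Complex.I) * (q z * H z)
          = fderiv ℝ η z 1 * (q z * H z)
            + Complex.I * (fderiv ℝ η z Complex.I * (q z * H z)) := fun z => by ring
      simp only [this]
      rw [integral_add j1 (j2.const_mul _), integral_const_mul, e1, e2]
      ring
    set dχ : ℂ → ℂ := fun z => fderiv ℝ (fun z => (χ z : ℂ)) z 1
      + Complex.I * fderiv ℝ (fun z => (χ z : ℂ)) z Complex.I with hdχ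
    have hdχc : Continuous dχ := by
      have h := hχC.continuous_fderiv (n := (⊤ : ℕ∞)) (by simp)
      exact (h.clm_apply continuous_const).add
        (continuous_const.mul (h.clm_apply continuous_const))
    have hdχcc : HasCompactSupport dχ :=
      (hχCc.fderiv_apply ℝ 1).add ((hχCc.fderiv_apply ℝ Complex.I).mul_left)
    set er : ℂ → ℂ := fun z => 2 * phase n z₀ z * (z - z₀) ^ 2 *
      (((‖z - z₀‖ ^ 2 + κ : ℝ) : ℂ)⁻¹) ^ 2 with her
    have hnz : ∀ z : ℂ, ((‖z - z₀‖ ^ 2 + κ : ℝ) : ℂ) ≠ 0 := fun z => by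
      exact_mod_cast (by positivity : (0 : ℝ) < ‖z - z₀‖ ^ 2 + κ).ne'
    have hnc : Continuous fun z : ℂ => ((‖z - z₀‖ ^ 2 + κ : ℝ) : ℂ) := by fun_prop
    have herc : Continuous er :=
      ((continuous_const.mul hphc).mul ((continuous_id.sub continuous_const).pow 2)).mul
        ((hnc.inv₀ hnz).pow 2)
    have hηD : ∀ z, fderiv ℝ η z 1 + Complex.I * fderiv ℝ η z Complex.I
        = 4 * Complex.I * n * ((χ z : ℂ) * phase n z₀ z *
            ((‖z - z₀‖ ^ 2 / (‖z - z₀‖ ^ 2 + κ) : ℝ) : ℂ))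
          - (χ z : ℂ) * er z + dχ z * regPhase n κ z₀ z := fun z => by
      have hd : HasFDerivAt η _ z := ((hχC.differentiable (by simp) z).hasFDerivAt).mul
        ((hE.differentiable (by simp) z).hasFDerivAt)
      rw [hd.fderiv]
      simp only [add_apply, smul_apply, smul_eq_mul]
      have := dbar_regPhase n hκ z₀ z
      rw [her, hdχ]
      linear_combination (χ z : ℂ) * this
    have i2 : Integrable (fun z => ((χ z : ℂ) * er z) * (q z * H z)) (volume.restrict X) :=
      hbd (hχC.continuous.mul herc) hχCc.mul_right
    have i3 : Integrable (fun z => (dχ z * regPhase n κ z₀ z) * (q z * H z))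
        (volume.restrict X) := hbd (hdχc.mul hE.continuous) hdχcc.mul_right
    have i0 : Integrable (fun z => (fderiv ℝ η z 1 + Complex.I * fderiv ℝ η z Complex.I) *
        (q z * H z)) (volume.restrict X) :=
      hbd ((cD 1).add (continuous_const.mul (cD Complex.I)))
        ((hηc.fderiv_apply ℝ 1).add
          ((hηc.fderiv_apply ℝ Complex.I).mul_left (f := fun _ => Complex.I)))
    have i02 : Integrable (fun z => (fderiv ℝ η z 1 + Complex.I * fderiv ℝ η z Complex.I) *
        (q z * H z) + ((χ z : ℂ) * er z) * (q z * H z)) (volume.restrict X) := i0.add i2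
    have hmain : ∫ z in X, 4 * Complex.I * n * ((χ z : ℂ) * phase n z₀ z *
        ((‖z - z₀‖ ^ 2 / (‖z - z₀‖ ^ 2 + κ) : ℝ) : ℂ) * (q z * H z))
        = (∫ z in X, ((χ z : ℂ) * er z) * (q z * H z))
          + (-∫ z in X, (dχ z * regPhase n κ z₀ z) * (q z * H z))
          + (-(∫ z in X, η z * (q₁ z * H z + q z * h₁ z)))
          + (-(Complex.I * ∫ z in X, η z * (q₂ z * H z + q z * h₂ z))) := by
      have e3 : ∀ z, 4 * Complex.I * n * ((χ z : ℂ) * phase n z₀ z *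
          ((‖z - z₀‖ ^ 2 / (‖z - z₀‖ ^ 2 + κ) : ℝ) : ℂ) * (q z * H z))
          = (fderiv ℝ η z 1 + Complex.I * fderiv ℝ η z Complex.I) * (q z * H z)
            + ((χ z : ℂ) * er z) * (q z * H z)
            - (dχ z * regPhase n κ z₀ z) * (q z * H z) := fun z => by rw [hηD]; ring
      simp only [e3]
      rw [integral_sub i02 i3, integral_add i0 i2, hsum]
      ring
    rw [hmain, hB]
    have hηn : ∀ z, ‖η z‖ₑ ≤ ‖z - z₀‖ₑ⁻¹ := fun z => by
      rw [hη, enorm_mul]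
      exact (mul_le_mul' (hχ1' z) (enorm_regPhase_le n hκ z₀ z)).trans (one_mul _).le
    have hdχn : ∀ z, ‖dχ z‖ₑ ≤ 2 * ‖fderiv ℝ χ z‖ₑ := fun z => by
      have hf : ∀ v : ℂ, ‖v‖ = 1 → ‖fderiv ℝ (fun z => (χ z : ℂ)) z v‖ₑ ≤ ‖fderiv ℝ χ z‖ₑ :=
        fun v hv => by
          have hd : HasFDerivAt (fun z => (χ z : ℂ)) (Complex.ofRealCLM.comp (fderiv ℝ χ z)) z :=
            Complex.ofRealCLM.hasFDerivAt.comp z ((hχ.differentiable (by simp) z).hasFDerivAt)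
          rw [hd.fderiv, ← ofReal_norm, ← ofReal_norm]
          refine ENNReal.ofReal_le_ofReal ?_
          have := (fderiv ℝ χ z).le_opNorm v
          rw [hv, mul_one] at this
          simpa using this
      rw [hdχ, two_mul]
      refine (enorm_add_le _ _).trans (add_le_add (hf 1 (by simp)) ?_)
      rw [enorm_mul, ← ofReal_norm Complex.I, Complex.norm_I, ENNReal.ofReal_one, one_mul]
      exact hf Complex.I (by simp)
    have hpart : ∀ a b c d : ℂ → ℂ, ‖∫ z in X, η z * (a z * b z + c z * d z)‖ₑ
        ≤ ∫⁻ z in X, ‖z - z₀‖ₑ⁻¹ * (‖a z‖ₑ * ‖b z‖ₑ + ‖c z‖ₑ * ‖d z‖ₑ) := fun a b c d => by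
      refine (enorm_integral_le_lintegral_enorm _).trans (lintegral_mono fun z => ?_)
      rw [enorm_mul]
      refine mul_le_mul' (hηn z) ((enorm_add_le _ _).trans ?_)
      rw [enorm_mul, enorm_mul]
    refine (enorm_add_le _ _).trans (add_le_add ((enorm_add_le _ _).trans (add_le_add
      ((enorm_add_le _ _).trans (add_le_add ?_ ?_)) ?_)) ?_)
    · refine (enorm_integral_le_lintegral_enorm _).trans (lintegral_mono fun z => ?_)
      rw [enorm_mul, enorm_mul, enorm_mul (q z)]
      refine mul_le_mul' ((mul_le_mul' (hχ1' z) (enorm_dbar_error_le n hκ z₀ z)).trans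
        (one_mul _).le) le_rfl
    · rw [enorm_neg]
      refine (enorm_integral_le_lintegral_enorm _).trans (lintegral_mono fun z => ?_)
      rw [enorm_mul, enorm_mul, enorm_mul (q z)]
      exact mul_le_mul' (mul_le_mul' (hdχn z) (enorm_regPhase_le n hκ z₀ z)) le_rfl
    · rw [enorm_neg]; exact hpart _ _ _ _
    · rw [enorm_neg, enorm_mul, ← ofReal_norm Complex.I, Complex.norm_I, ENNReal.ofReal_one,
        one_mul]
      exact hpart _ _ _ _
  -- remove the regularisation
  have hlim : Filter.Tendsto (fun κ : ℝ => ∫ z in X, 4 * Complex.I * n * ((χ z : ℂ) *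
      phase n z₀ z * ((‖z - z₀‖ ^ 2 / (‖z - z₀‖ ^ 2 + κ) : ℝ) : ℂ) * (q z * H z)))
      (nhdsWithin 0 (Ioi 0)) (nhds (∫ z in X, 4 * Complex.I * n * ((χ z : ℂ) *
      phase n z₀ z * (q z * H z)))) := by
    refine tendsto_integral_filter_of_dominated_convergence (fun z => 4 * n * ‖q z * H z‖)
      (Filter.Eventually.of_forall fun κ => ?_) ?_ (iqH.norm.const_mul _) ?_
    · have hm : Measurable fun z : ℂ => ((‖z - z₀‖ ^ 2 / (‖z - z₀‖ ^ 2 + κ) : ℝ) : ℂ) := by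
        fun_prop
      exact ((((hχC.continuous.mul hphc).aestronglyMeasurable.mul hm.aestronglyMeasurable).mul
        iqH.1).const_mul _)
    · filter_upwards [self_mem_nhdsWithin] with κ hκ
      have hκ : 0 < κ := hκ
      refine Filter.Eventually.of_forall fun z => ?_
      rw [norm_mul, norm_mul, norm_mul, norm_mul, norm_mul, norm_mul, norm_phase, Complex.norm_I,
        Complex.norm_ofNat, Complex.norm_real, Complex.norm_real, Complex.norm_real,
        Real.norm_of_nonneg hn.le, Real.norm_of_nonneg (hχ1 z).1,
        Real.norm_of_nonneg (by positivity), mul_one, mul_one]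
      have h1 : ‖z - z₀‖ ^ 2 / (‖z - z₀‖ ^ 2 + κ) ≤ 1 := by
        rw [div_le_one (by positivity)]; linarith
      have h2 : χ z * (‖z - z₀‖ ^ 2 / (‖z - z₀‖ ^ 2 + κ)) ≤ 1 :=
        mul_le_one₀ (hχ1 z).2 (by positivity) h1
      gcongr
      exact mul_le_of_le_one_left (norm_nonneg _) h2
    · have hne : ∀ᵐ z ∂(volume.restrict X), z ≠ z₀ :=
        ae_restrict_of_ae (by simp [ae_iff])
      filter_upwards [hne] with z hz
      have h0 : 0 < ‖z - z₀‖ := norm_pos_iff.2 (sub_ne_zero.2 hz)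
      have h1 : Filter.Tendsto (fun κ : ℝ => ‖z - z₀‖ ^ 2 / (‖z - z₀‖ ^ 2 + κ))
          (nhdsWithin 0 (Ioi 0)) (nhds 1) := by
        have : Filter.Tendsto (fun κ : ℝ => ‖z - z₀‖ ^ 2 / (‖z - z₀‖ ^ 2 + κ))
            (nhds 0) (nhds (‖z - z₀‖ ^ 2 / (‖z - z₀‖ ^ 2 + 0))) :=
          (tendsto_const_nhds).div (tendsto_const_nhds.add Filter.tendsto_id) (by positivity)
        rw [add_zero, div_self (by positivity)] at this
        exact this.mono_left nhdsWithin_le_nhds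
      have h2 : Filter.Tendsto (fun κ : ℝ => ((‖z - z₀‖ ^ 2 / (‖z - z₀‖ ^ 2 + κ) : ℝ) : ℂ))
          (nhdsWithin 0 (Ioi 0)) (nhds ((1 : ℝ) : ℂ)) :=
        (Complex.continuous_ofReal.tendsto 1).comp h1
      have h3 := ((h2.const_mul ((χ z : ℂ) * phase n z₀ z)).mul_const (q z * H z)).const_mul
        (4 * Complex.I * n)
      simpa using h3
  have hle := le_of_tendsto hlim.enorm (by
    filter_upwards [self_mem_nhdsWithin] with κ hκ using key κ hκ)
  rw [integral_const_mul, enorm_mul] at hle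
  have e4 : ‖4 * Complex.I * (n : ℂ)‖ₑ = ENNReal.ofReal (4 * n) := by
    rw [← ofReal_norm, norm_mul, norm_mul, Complex.norm_I, Complex.norm_ofNat, Complex.norm_real,
      Real.norm_of_nonneg hn.le, mul_one]
  rwa [e4] at hle

/-! ### Singular integrals on the disc -/

/-- The integral of `|z| ^ (-s)` over the disc of radius `2`. -/
noncomputable def singularIntegral (s : ℝ) : ℝ≥0∞ :=
  ∫⁻ z in Metric.ball (0 : ℂ) 2, ‖z‖ₑ ^ (-s)

theorem singularIntegral_ne_top {s : ℝ} (hs : s < 2) : singularIntegral s ≠ ∞ := by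
  set f : ℝ → ℝ := (Iio 2).indicator fun r => r ^ (-s) with hf
  have h1 : IntegrableOn (fun y : ℝ => y ^ (Module.finrank ℝ ℂ - 1) • f y) (Ioi 0) := by
    have h2 : IntegrableOn (fun y : ℝ => y ^ (1 - s)) (Ioo 0 2) := by
      have := (intervalIntegral.intervalIntegrable_rpow' (a := 0) (b := 2) (r := 1 - s)
        (by linarith))
      rw [intervalIntegrable_iff_integrableOn_Ioo_of_le (by norm_num)] at this
      exact this
    have h3 : IntegrableOn ((Iio 2).indicator fun y : ℝ => y ^ (1 - s)) (Ioi 0) := by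
      rw [IntegrableOn, integrable_indicator_iff measurableSet_Iio, IntegrableOn,
        Measure.restrict_restrict measurableSet_Iio, inter_comm, Ioi_inter_Iio]
      exact h2
    refine h3.congr_fun (fun y hy => ?_) measurableSet_Ioi
    have hy : 0 < y := hy
    rw [Complex.finrank_real_complex, hf]
    by_cases hy2 : y ∈ Iio (2 : ℝ)
    · simp only [indicator_of_mem hy2, smul_eq_mul]
      rw [sub_eq_add_neg, Real.rpow_add hy]
      simp
    · simp [indicator_of_notMem hy2]
  have h4 : Integrable (fun z : ℂ => f ‖z‖) := (integrable_fun_norm_addHaar volume).2 h1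
  refine ne_of_lt (lt_of_le_of_lt ?_ h4.2)
  rw [singularIntegral, ← lintegral_indicator Metric.isOpen_ball.measurableSet]
  refine lintegral_mono_ae ?_
  have hne : ∀ᵐ z : ℂ, z ≠ 0 := by simp [ae_iff]
  filter_upwards [hne] with z hz
  by_cases hzb : z ∈ Metric.ball (0 : ℂ) 2
  · have hz2 : ‖z‖ ∈ Iio (2 : ℝ) := by simpa using hzb
    have hz0 : 0 < ‖z‖ := norm_pos_iff.2 hz
    rw [indicator_of_mem hzb, hf, indicator_of_mem hz2, ← ofReal_norm z,
      ENNReal.ofReal_rpow_of_pos hz0, Real.enorm_eq_ofReal (by positivity)]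
  · rw [indicator_of_notMem hzb]; exact zero_le

theorem measurable_enorm_sub_rpow (s : ℝ) :
    Measurable fun w : ℂ × ℂ => ‖w.1 - w.2‖ₑ ^ s := by
  fun_prop

theorem lintegral_unitDisc_le (s : ℝ) {z₀ : ℂ} (hz₀ : z₀ ∈ unitDisc) :
    ∫⁻ z in unitDisc, ‖z - z₀‖ₑ ^ (-s) ≤ singularIntegral s := by
  rw [singularIntegral, ← lintegral_indicator Metric.isOpen_ball.measurableSet,
    ← lintegral_indicator Metric.isOpen_ball.measurableSet]
  rw [← lintegral_sub_right_eq_self ((Metric.ball (0 : ℂ) 2).indicator fun z => ‖z‖ₑ ^ (-s)) z₀]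
  refine lintegral_mono fun z => ?_
  by_cases hz : z ∈ unitDisc
  · have : z - z₀ ∈ Metric.ball (0 : ℂ) 2 := by
      rw [mem_ball_zero_iff] at *
      linarith [norm_sub_le z z₀]
    rw [indicator_of_mem hz, indicator_of_mem this]
  · rw [indicator_of_notMem hz]; exact zero_le

/-- The constant in Hölder's inequality against the kernel `|z - z₀|⁻¹`. -/
noncomputable def holderConst (p : ℝ≥0∞) : ℝ≥0∞ :=
  singularIntegral (1 / (1 - 1 / p.toReal)) ^ (1 - 1 / p.toReal)

theorem holderConst_ne_top {p : ℝ≥0∞} (hp : 2 < p) : holderConst p ≠ ∞ := by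
  obtain ⟨h0, h1⟩ := inv_toReal_nonneg_lt_half hp
  refine ENNReal.rpow_ne_top_of_nonneg (by linarith) (singularIntegral_ne_top ?_)
  rw [div_lt_iff₀ (by linarith)]
  linarith

/-- Hölder's inequality against the kernel `|z - z₀|⁻¹`, which belongs to the dual Lebesgue space
because `p > 2`. -/
theorem lintegral_inv_mul_le {p : ℝ≥0∞} (hp : 2 < p) {X : Set ℂ} (hX : X ⊆ unitDisc) {f : ℂ → ℂ}
    (hf : AEStronglyMeasurable f (volume.restrict X)) {z₀ : ℂ} (hz₀ : z₀ ∈ unitDisc) :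
    ∫⁻ z in X, ‖z - z₀‖ₑ⁻¹ * ‖f z‖ₑ ≤ holderConst p * eLpNorm f p (volume.restrict X) := by
  obtain ⟨h0, h1⟩ := inv_toReal_nonneg_lt_half hp
  have hle : ∀ s, ∫⁻ z in X, ‖z - z₀‖ₑ ^ (-s) ≤ singularIntegral s := fun s =>
    (lintegral_mono_set hX).trans (lintegral_unitDisc_le s hz₀)
  have hm : Measurable fun z : ℂ => ‖z - z₀‖ₑ⁻¹ := by fun_prop
  by_cases hpt : p = ∞
  · subst hpt
    have hle1 := hle 1
    simp only [ENNReal.rpow_neg_one] at hle1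
    simp only [holderConst, ENNReal.toReal_top, div_zero, sub_zero, div_one, ENNReal.rpow_one]
    calc ∫⁻ z in X, ‖z - z₀‖ₑ⁻¹ * ‖f z‖ₑ
        ≤ ∫⁻ z in X, ‖z - z₀‖ₑ⁻¹ * eLpNorm f ∞ (volume.restrict X) := by
          refine lintegral_mono_ae ?_
          filter_upwards [ae_le_eLpNormEssSup (f := f) (μ := volume.restrict X)] with z hz
          rw [eLpNorm_exponent_top]
          gcongr
      _ = (∫⁻ z in X, ‖z - z₀‖ₑ⁻¹) * eLpNorm f ∞ (volume.restrict X) :=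
          lintegral_mul_const _ hm
      _ ≤ _ := by gcongr
  · have hp0 : p ≠ 0 := (lt_trans (by norm_num) hp).ne'
    have hpr : 0 < p.toReal := ENNReal.toReal_pos hp0 hpt
    set b := 1 / p.toReal with hb
    have hconj : (1 / (1 - b)).HolderConjugate p.toReal := by
      rw [Real.holderConjugate_iff]
      refine ⟨?_, ?_⟩
      · have : 0 < b := by positivity
        rw [lt_div_iff₀ (by linarith)]; linarith
      · rw [one_div, inv_inv, ← one_div, ← hb]; ring
    refine (ENNReal.lintegral_mul_le_Lp_mul_Lq _ hconj hm.aemeasurable hf.enorm).trans ?_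
    rw [eLpNorm_eq_lintegral_rpow_enorm_toReal hp0 hpt, holderConst, ← hb, one_div_one_div]
    refine mul_le_mul' (ENNReal.rpow_le_rpow ?_ (by linarith)) le_rfl
    refine le_trans (le_of_eq ?_) (hle (1 / (1 - b)))
    congr 1; ext z
    rw [ENNReal.inv_rpow, ENNReal.rpow_neg]

/-- The `L²(Ω)` norm of a potential of a set is bounded by a multiple of the area of the set. -/
theorem eLpNorm_potential_le {s : ℝ} {A : Set ℂ} (hAΩ : A ⊆ unitDisc) :
    eLpNorm (fun z₀ => ∫⁻ z in A, ‖z - z₀‖ₑ ^ (-s)) 2 (volume.restrict unitDisc)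
      ≤ singularIntegral (2 * s) ^ (1 / 2 : ℝ) * volume A := by
  rw [eLpNorm_eq_lintegral_rpow_enorm_toReal (by norm_num) (by norm_num)]
  simp only [enorm_eq_self, ENNReal.toReal_ofNat]
  have hm := measurable_enorm_sub_rpow (-s)
  have hCS : ∀ z₀, (∫⁻ z in A, ‖z - z₀‖ₑ ^ (-s)) ^ (2 : ℝ)
      ≤ volume A * ∫⁻ z in A, ‖z - z₀‖ₑ ^ (-(2 * s)) := fun z₀ => by
    have hmz : Measurable fun z : ℂ => ‖z - z₀‖ₑ ^ (-s) := hm.comp (measurable_id.prodMk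
      measurable_const)
    have := ENNReal.lintegral_mul_le_Lp_mul_Lq (volume.restrict A)
      (Real.HolderConjugate.two_two) (f := fun _ => 1) (g := fun z : ℂ => ‖z - z₀‖ₑ ^ (-s))
      aemeasurable_const hmz.aemeasurable
    simp only [Pi.mul_apply, one_mul, ENNReal.one_rpow, lintegral_const,
      Measure.restrict_apply_univ, ← ENNReal.rpow_mul] at this
    calc (∫⁻ z in A, ‖z - z₀‖ₑ ^ (-s)) ^ (2 : ℝ)
        ≤ (volume A ^ (1 / 2 : ℝ) * (∫⁻ z in A, ‖z - z₀‖ₑ ^ (-s * 2)) ^ (1 / 2 : ℝ)) ^ (2 : ℝ) :=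
          ENNReal.rpow_le_rpow this (by norm_num)
      _ = _ := by
          rw [ENNReal.mul_rpow_of_nonneg _ _ (by norm_num), ← ENNReal.rpow_mul, ← ENNReal.rpow_mul]
          norm_num [mul_comm]
  have hle : ∫⁻ z₀ in unitDisc, (∫⁻ z in A, ‖z - z₀‖ₑ ^ (-s)) ^ (2 : ℝ)
      ≤ singularIntegral (2 * s) * volume A ^ (2 : ℝ) := by
    have hm2 := measurable_enorm_sub_rpow (-(2 * s))
    calc ∫⁻ z₀ in unitDisc, (∫⁻ z in A, ‖z - z₀‖ₑ ^ (-s)) ^ (2 : ℝ)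
        ≤ ∫⁻ z₀ in unitDisc, volume A * ∫⁻ z in A, ‖z - z₀‖ₑ ^ (-(2 * s)) :=
          lintegral_mono fun z₀ => hCS z₀
      _ = volume A * ∫⁻ z₀ in unitDisc, ∫⁻ z in A, ‖z - z₀‖ₑ ^ (-(2 * s)) :=
          lintegral_const_mul _ (Measurable.lintegral_prod_left' (f := fun w : ℂ × ℂ =>
            ‖w.1 - w.2‖ₑ ^ (-(2 * s))) hm2)
      _ = volume A * ∫⁻ z in A, ∫⁻ z₀ in unitDisc, ‖z - z₀‖ₑ ^ (-(2 * s)) := by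
          rw [lintegral_lintegral_swap (f := fun z₀ z : ℂ => ‖z - z₀‖ₑ ^ (-(2 * s)))
            (hm2.comp measurable_swap).aemeasurable]
      _ ≤ volume A * ∫⁻ _ in A, singularIntegral (2 * s) := by
          gcongr 1
          refine setLIntegral_mono measurable_const fun z hz => ?_
          simp only [enorm_sub_rev z]
          exact lintegral_unitDisc_le (2 * s) (hAΩ hz)
      _ = _ := by
          rw [lintegral_const, Measure.restrict_apply_univ, ENNReal.rpow_two]; ring
  refine (ENNReal.rpow_le_rpow hle (by norm_num)).trans (le_of_eq ?_)
  rw [ENNReal.mul_rpow_of_nonneg _ _ (by norm_num), ← ENNReal.rpow_mul]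
  norm_num

/-! ### The estimate on one piece -/

/-- The continuous representative furnished by the Sobolev embedding, with pointwise bounds. -/
theorem IsEmbeddingConst.exists_holder {p : ℝ≥0∞} (hp : 2 < p) {X : Set ℂ} {C : ℝ≥0}
    (hC : IsEmbeddingConst p X C) (hX : IsOpen X) {f : ℂ → ℂ} (hf : MemSobolev p X f) :
    ∃ u : ℂ → ℂ, u =ᵐ[volume.restrict X] f ∧ ContinuousOn u (closure X) ∧
      (∀ z ∈ closure X, ‖u z‖ₑ ≤ C * sobolevNorm p X f) ∧
      ∀ z ∈ closure X, ∀ w ∈ closure X,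
        ‖u z - u w‖ₑ ≤ C * sobolevNorm p X f * ‖z - w‖ₑ ^ (1 - 2 * (1 / p.toReal)) := by
  obtain ⟨u, hu, hc, hn⟩ := hC f hf
  have htop : (C : ℝ≥0∞) * sobolevNorm p X f ≠ ∞ :=
    ENNReal.mul_ne_top ENNReal.coe_ne_top (hf.sobolevNorm_ne_top hX)
  refine ⟨u, hu, hc, fun z hz => ?_, fun z hz w hw => ?_⟩
  · exact (le_iSup₂ (f := fun z (_ : z ∈ closure X) => ‖u z‖ₑ) z hz).trans (le_self_add.trans hn)
  · have h1 : eHolderNorm (1 - 2 / p).toNNReal ((closure X).domRestrict u)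
        ≤ C * sobolevNorm p X f := le_add_self.trans hn
    have hm : MemHolder (1 - 2 / p).toNNReal ((closure X).domRestrict u) :=
      eHolderNorm_lt_top.1 (h1.trans_lt htop.lt_top)
    have h2 := hm.holderWith ⟨z, hz⟩ ⟨w, hw⟩
    rw [hm.coe_nnHolderNorm_eq_eHolderNorm, toNNReal_holder_exponent hp] at h2
    rw [← edist_eq_enorm_sub, ← edist_eq_enorm_sub]
    exact h2.trans (mul_le_mul' h1 le_rfl)

/-- The integral over one piece, with the amplitude `G` normalised to vanish at the singularity
`z₀` of the phase. The first three terms come from integrating by parts against a cutoff equal to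
`1` outside the `2ε`-neighbourhood `A` of the boundary, the last one from the part near the
boundary. -/
theorem enorm_integral_piece_le {p : ℝ≥0∞} (hp : 2 < p) {X : Set ℂ} (hX : IsOpenLipschitz X)
    (hXΩ : X ⊆ unitDisc) {q : ℂ → ℂ} (hq : MemSobolev p X q) {Q : ℝ≥0∞}
    (hQ : ∀ᵐ z ∂(volume.restrict X), ‖q z‖ₑ ≤ Q) {g G : ℂ → ℂ} (hg : MemSobolev p unitDisc g)
    {L : ℝ≥0∞} (hL : L ≠ ∞) (hGg : G =ᵐ[volume.restrict unitDisc] g)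
    (hGc : ContinuousOn G unitDisc) (hG1 : ∀ z ∈ unitDisc, ‖G z‖ₑ ≤ L)
    (hG2 : ∀ z ∈ unitDisc, ∀ w ∈ unitDisc,
      ‖G z - G w‖ₑ ≤ L * ‖z - w‖ₑ ^ (1 - 2 * (1 / p.toReal)))
    {n : ℝ} (hn : 0 < n) {ε : ℝ} (hε : 0 < ε) {z₀ : ℂ} (hz₀ : z₀ ∈ unitDisc) :
    ‖∫ z in X, phaseKernel n z₀ z * q z * (G z - G z₀)‖ₑ ≤
      2 * (Q * L) * singularIntegral (1 + 2 * (1 / p.toReal))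
      + ENNReal.ofReal (8 * Real.pi * rhoBound * ε⁻¹) * (Q * L) *
        (∫⁻ z in X ∩ Metric.thickening (2 * ε) (frontier X), ‖z - z₀‖ₑ ^ (-(2 * (1 / p.toReal))))
      + 2 * (2 * L * (holderConst p * sobolevNorm p X q)
        + Q * (holderConst p * sobolevNorm p unitDisc g))
      + ENNReal.ofReal (2 * n / Real.pi) *
        (2 * (Q * L) * volume (X ∩ Metric.thickening (2 * ε) (frontier X))) := by
  have hp0 : 0 < p := lt_trans (by norm_num) hp
  have hb : Bornology.IsBounded X := Metric.isBounded_ball.subset hXΩ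
  have hXm := hX.1.measurableSet
  set b := 1 / p.toReal with hbdef
  obtain ⟨hb0, hb1⟩ := inv_toReal_nonneg_lt_half hp
  rw [← hbdef] at hb0 hb1
  set A := X ∩ Metric.thickening (2 * ε) (frontier X) with hA
  have hAm : MeasurableSet A := hXm.inter Metric.isOpen_thickening.measurableSet
  obtain ⟨CX, hCX⟩ := hX.exists_isEmbeddingConst hp hb
  obtain ⟨u, hu, huc, -⟩ := hCX q hq
  have hμ : volume.restrict X ≤ volume.restrict unitDisc := Measure.restrict_mono hXΩ le_rfl
  obtain ⟨χ, hχ, hχc, hχX, hχ1, hχN, hχd⟩ := exists_cutoff hX.1 hb hε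
  have iq : IntegrableOn q X := IsOpen.integrableOn_of_memLp hp hb hq.1
  have iu : IntegrableOn u X := iq.congr hu.symm
  have ig : IntegrableOn g unitDisc := IsOpen.integrableOn_of_memLp hp Metric.isBounded_ball hg.1
  have iG : IntegrableOn G unitDisc := ig.congr hGg.symm
  have iGX : IntegrableOn G X := iG.mono_set hXΩ
  have hQu : ∀ᵐ z ∂(volume.restrict X), ‖u z‖ₑ ≤ Q := by
    filter_upwards [hu, hQ] with z h1 h2
    rwa [h1]
  set H : ℂ → ℂ := fun z => G z - G z₀ with hH
  have hH2 : ∀ z ∈ X, ‖H z‖ₑ ≤ 2 * L := fun z hz => by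
    rw [two_mul]
    exact (enorm_sub_le).trans (add_le_add (hG1 z (hXΩ hz)) (hG1 z₀ hz₀))
  have hHa : ∀ z ∈ X, ‖H z‖ₑ ≤ L * ‖z - z₀‖ₑ ^ (1 - 2 * b) := fun z hz =>
    hG2 z (hXΩ hz) z₀ hz₀
  have hfin : volume X ≠ ∞ := hb.measure_lt_top.ne
  have iH : IntegrableOn H X := iGX.sub (integrableOn_const hfin)
  have hHs : AEStronglyMeasurable H (volume.restrict X) := iH.1
  have iuH : IntegrableOn (fun z => u z * H z) X := by
    refine Integrable.mul_bdd (c := (2 * L).toReal) iu hHs ?_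
    filter_upwards [ae_restrict_mem hXm] with z hz
    rw [← toReal_enorm]
    exact ENNReal.toReal_mono (ENNReal.mul_ne_top (by simp) hL) (hH2 z hz)
  have memq1 := hq.memLp_one hX.1
  have memq2 := hq.memLp_I hX.1
  have memg1 := hg.memLp_one Metric.isOpen_ball
  have memg2 := hg.memLp_I Metric.isOpen_ball
  have mg1 : MemLp (weakDeriv unitDisc 1 g) p (volume.restrict X) := memg1.mono_measure hμ
  have mg2 : MemLp (weakDeriv unitDisc Complex.I g) p (volume.restrict X) :=
    memg2.mono_measure hμ
  have main := enorm_integral_cutoff_phase_le hX.1 (hq.hasWeakDeriv_one.congr_left hu)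
    (hq.hasWeakDeriv_I.congr_left hu)
    (((hg.hasWeakDeriv_one.congr_left hGg).mono hXΩ).sub_const iGX (G z₀))
    (((hg.hasWeakDeriv_I.congr_left hGg).mono hXΩ).sub_const iGX (G z₀))
    iu (IsOpen.integrableOn_of_memLp hp hb memq1) (IsOpen.integrableOn_of_memLp hp hb memq2)
    iH (IsOpen.integrableOn_of_memLp hp hb mg1) (IsOpen.integrableOn_of_memLp hp hb mg2)
    (huc.mono subset_closure) ((hGc.mono hXΩ).sub continuousOn_const) iuH hχ hχc hχX hχ1 hn z₀
  have hne : ∀ᵐ z ∂(volume.restrict X), z ≠ z₀ := ae_restrict_of_ae (by simp [ae_iff])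
  have hpow : ∀ z, z ≠ z₀ → ∀ s t : ℝ, ‖z - z₀‖ₑ ^ s * ‖z - z₀‖ₑ ^ t = ‖z - z₀‖ₑ ^ (s + t) :=
    fun z hz s t => (ENNReal.rpow_add _ _ (by simpa [sub_eq_zero] using hz) (by simp)).symm
  have hmeas : ∀ s : ℝ, Measurable fun z : ℂ => ‖z - z₀‖ₑ ^ s := fun s => by fun_prop
  -- the term from the derivative of the singular factor
  have t1 : ∫⁻ z in X, 2 * (‖z - z₀‖ₑ⁻¹) ^ 2 * (‖u z‖ₑ * ‖H z‖ₑ)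
      ≤ 2 * (Q * L) * singularIntegral (1 + 2 * b) := by
    calc ∫⁻ z in X, 2 * (‖z - z₀‖ₑ⁻¹) ^ 2 * (‖u z‖ₑ * ‖H z‖ₑ)
        ≤ ∫⁻ z in X, 2 * (Q * L) * ‖z - z₀‖ₑ ^ (-(1 + 2 * b)) := by
          refine lintegral_mono_ae ?_
          filter_upwards [hQu, hne, ae_restrict_mem hXm] with z h1 h2 h3
          calc 2 * (‖z - z₀‖ₑ⁻¹) ^ 2 * (‖u z‖ₑ * ‖H z‖ₑ)
              ≤ 2 * (‖z - z₀‖ₑ⁻¹) ^ 2 * (Q * (L * ‖z - z₀‖ₑ ^ (1 - 2 * b))) := by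
                gcongr; exact hHa z h3
            _ = 2 * (Q * L) * (‖z - z₀‖ₑ ^ (-2 : ℝ) * ‖z - z₀‖ₑ ^ (1 - 2 * b)) := by
                rw [ENNReal.rpow_neg, ENNReal.rpow_two, ENNReal.inv_pow]; ring
            _ = _ := by rw [hpow z h2]; congr 2; ring
      _ = 2 * (Q * L) * ∫⁻ z in X, ‖z - z₀‖ₑ ^ (-(1 + 2 * b)) :=
          lintegral_const_mul _ (hmeas _)
      _ ≤ _ := by
          gcongr
          exact (lintegral_mono_set hXΩ).trans (lintegral_unitDisc_le _ hz₀)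
  -- the term from the derivative of the cutoff, supported near the boundary
  have t2 : ∫⁻ z in X, 2 * ‖fderiv ℝ χ z‖ₑ * ‖z - z₀‖ₑ⁻¹ * (‖u z‖ₑ * ‖H z‖ₑ)
      ≤ ENNReal.ofReal (8 * Real.pi * rhoBound * ε⁻¹) * (Q * L) *
        ∫⁻ z in A, ‖z - z₀‖ₑ ^ (-(2 * b)) := by
    set D := ENNReal.ofReal (8 * Real.pi * rhoBound * ε⁻¹) * (Q * L) with hD
    rw [← lintegral_const_mul D (hmeas _), hA, inter_comm,
      ← Measure.restrict_restrict Metric.isOpen_thickening.measurableSet,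
      ← lintegral_indicator Metric.isOpen_thickening.measurableSet]
    refine lintegral_mono_ae ?_
    filter_upwards [hQu, hne, ae_restrict_mem hXm] with z h1 h2 h3
    by_cases hz : z ∈ Metric.thickening (2 * ε) (frontier X)
    · rw [indicator_of_mem hz]
      have hd : 2 * ‖fderiv ℝ χ z‖ₑ ≤ ENNReal.ofReal (8 * Real.pi * rhoBound * ε⁻¹) := by
        rw [← ofReal_norm, show (2 : ℝ≥0∞) = ENNReal.ofReal 2 by simp,
          ← ENNReal.ofReal_mul (by norm_num)]
        refine ENNReal.ofReal_le_ofReal ?_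
        linarith [hχd z]
      calc 2 * ‖fderiv ℝ χ z‖ₑ * ‖z - z₀‖ₑ⁻¹ * (‖u z‖ₑ * ‖H z‖ₑ)
          ≤ ENNReal.ofReal (8 * Real.pi * rhoBound * ε⁻¹) * ‖z - z₀‖ₑ⁻¹ *
            (Q * (L * ‖z - z₀‖ₑ ^ (1 - 2 * b))) := by
            gcongr; exact hHa z h3
        _ = D * (‖z - z₀‖ₑ ^ (-1 : ℝ) * ‖z - z₀‖ₑ ^ (1 - 2 * b)) := by
            rw [ENNReal.rpow_neg_one, hD]; ring
        _ = _ := by rw [hpow z h2]; congr 2; ring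
    · have h0 : ‖fderiv ℝ χ z‖ₑ = 0 := by
        rw [← ofReal_norm, (hχN z h3 hz).2, norm_zero, ENNReal.ofReal_zero]
      rw [h0, mul_zero, zero_mul, zero_mul]
      exact zero_le
  -- the terms from the derivatives of the amplitude
  have t3 : ∀ q₁ h₁ : ℂ → ℂ, AEStronglyMeasurable q₁ (volume.restrict X) →
      AEStronglyMeasurable h₁ (volume.restrict X) →
      eLpNorm q₁ p (volume.restrict X) ≤ sobolevNorm p X q →
      eLpNorm h₁ p (volume.restrict X) ≤ sobolevNorm p unitDisc g →
      ∫⁻ z in X, ‖z - z₀‖ₑ⁻¹ * (‖q₁ z‖ₑ * ‖H z‖ₑ + ‖u z‖ₑ * ‖h₁ z‖ₑ)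
        ≤ 2 * L * (holderConst p * sobolevNorm p X q)
          + Q * (holderConst p * sobolevNorm p unitDisc g) := by
    intro q₁ h₁ mq mh hq1 hh1
    have hm1 : Measurable fun z : ℂ => ‖z - z₀‖ₑ⁻¹ := by fun_prop
    calc ∫⁻ z in X, ‖z - z₀‖ₑ⁻¹ * (‖q₁ z‖ₑ * ‖H z‖ₑ + ‖u z‖ₑ * ‖h₁ z‖ₑ)
        ≤ ∫⁻ z in X, (2 * L * (‖z - z₀‖ₑ⁻¹ * ‖q₁ z‖ₑ) + Q * (‖z - z₀‖ₑ⁻¹ * ‖h₁ z‖ₑ)) := by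
          refine lintegral_mono_ae ?_
          filter_upwards [hQu, ae_restrict_mem hXm] with z h1 h3
          calc ‖z - z₀‖ₑ⁻¹ * (‖q₁ z‖ₑ * ‖H z‖ₑ + ‖u z‖ₑ * ‖h₁ z‖ₑ)
              ≤ ‖z - z₀‖ₑ⁻¹ * (‖q₁ z‖ₑ * (2 * L) + Q * ‖h₁ z‖ₑ) := by
                gcongr; exact hH2 z h3
            _ = _ := by ring
      _ = 2 * L * (∫⁻ z in X, ‖z - z₀‖ₑ⁻¹ * ‖q₁ z‖ₑ) + Q * ∫⁻ z in X, ‖z - z₀‖ₑ⁻¹ * ‖h₁ z‖ₑ := by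
          have e1 : AEMeasurable (fun z : ℂ => ‖z - z₀‖ₑ⁻¹ * ‖q₁ z‖ₑ) (volume.restrict X) :=
            hm1.aemeasurable.mul mq.enorm
          have e2 : AEMeasurable (fun z : ℂ => ‖z - z₀‖ₑ⁻¹ * ‖h₁ z‖ₑ) (volume.restrict X) :=
            hm1.aemeasurable.mul mh.enorm
          rw [lintegral_add_left' (e1.const_mul _), lintegral_const_mul'' _ e1,
            lintegral_const_mul'' _ e2]
      _ ≤ _ := by
          gcongr
          · exact (lintegral_inv_mul_le hp hXΩ mq hz₀).trans (by gcongr)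
          · exact (lintegral_inv_mul_le hp hXΩ mh hz₀).trans (by gcongr)
  have hSq := lpNormOn_le_sobolevNorm hp0 X q
  have hSg := lpNormOn_le_sobolevNorm hp0 unitDisc g
  have hmain : ENNReal.ofReal (4 * n) * ‖∫ z in X, (χ z : ℂ) * phase n z₀ z * (u z * H z)‖ₑ ≤
      2 * (Q * L) * singularIntegral (1 + 2 * b)
      + ENNReal.ofReal (8 * Real.pi * rhoBound * ε⁻¹) * (Q * L) *
        (∫⁻ z in A, ‖z - z₀‖ₑ ^ (-(2 * b)))
      + 2 * (2 * L * (holderConst p * sobolevNorm p X q)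
        + Q * (holderConst p * sobolevNorm p unitDisc g)) := by
    rw [two_mul (2 * L * _ + _), ← add_assoc]
    refine main.trans (add_le_add (add_le_add (add_le_add t1 t2) ?_) ?_)
    · exact t3 _ _ memq1.1 mg1.1 hSq.2.1 ((eLpNorm_mono_measure _ hμ).trans hSg.2.1)
    · exact t3 _ _ memq2.1 mg2.1 hSq.2.2 ((eLpNorm_mono_measure _ hμ).trans hSg.2.2)
  -- splitting off the part near the boundary
  have hχcont : Continuous fun z => (χ z : ℂ) := Complex.continuous_ofReal.comp hχ.continuous
  have hph : Continuous (phase n z₀) := (contDiff_phase n z₀).continuous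
  have hbd1 : ∀ z, ‖(χ z : ℂ) * phase n z₀ z‖ ≤ 1 := fun z => by
    rw [norm_mul, norm_phase, Complex.norm_real, Real.norm_of_nonneg (hχ1 z).1, mul_one]
    exact (hχ1 z).2
  have hbd2 : ∀ z, ‖(1 - χ z : ℂ) * phase n z₀ z‖ ≤ 1 := fun z => by
    rw [norm_mul, norm_phase, ← Complex.ofReal_one, ← Complex.ofReal_sub, Complex.norm_real,
      Real.norm_of_nonneg (by linarith [(hχ1 z).2]), mul_one]
    linarith [(hχ1 z).1]
  have i1 : IntegrableOn (fun z => (χ z : ℂ) * phase n z₀ z * (u z * H z)) X :=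
    Integrable.bdd_mul iuH (hχcont.mul hph).aestronglyMeasurable (ae_of_all _ hbd1)
  have i2 : IntegrableOn (fun z => (1 - χ z : ℂ) * phase n z₀ z * (u z * H z)) X :=
    Integrable.bdd_mul iuH ((continuous_const.sub hχcont).mul hph).aestronglyMeasurable
      (ae_of_all _ hbd2)
  have hsplit : ∫ z in X, phaseKernel n z₀ z * q z * H z =
      ((2 * n / Real.pi : ℝ) : ℂ) * ((∫ z in X, (χ z : ℂ) * phase n z₀ z * (u z * H z))
        + ∫ z in X, (1 - χ z : ℂ) * phase n z₀ z * (u z * H z)) := by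
    rw [← integral_add i1 i2, ← integral_const_mul]
    refine integral_congr_ae ?_
    filter_upwards [hu] with z hz
    rw [hz, phaseKernel, phase]
    ring
  have hnear : ‖∫ z in X, (1 - χ z : ℂ) * phase n z₀ z * (u z * H z)‖ₑ
      ≤ 2 * (Q * L) * volume A := by
    refine (enorm_integral_le_lintegral_enorm _).trans ?_
    rw [← setLIntegral_const, hA, inter_comm,
      ← Measure.restrict_restrict Metric.isOpen_thickening.measurableSet,
      ← lintegral_indicator Metric.isOpen_thickening.measurableSet]
    refine lintegral_mono_ae ?_
    filter_upwards [hQu, ae_restrict_mem hXm] with z h1 h3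
    by_cases hz : z ∈ Metric.thickening (2 * ε) (frontier X)
    · rw [indicator_of_mem hz, enorm_mul, enorm_mul (u z)]
      have h4 : ‖(1 - χ z : ℂ) * phase n z₀ z‖ₑ ≤ 1 := by
        rw [← ofReal_norm, ← ENNReal.ofReal_one]
        exact ENNReal.ofReal_le_ofReal (hbd2 z)
      calc _ ≤ 1 * (Q * (2 * L)) := by gcongr; exact hH2 z h3
        _ = _ := by ring
    · rw [(hχN z h3 hz).1]; simp
  have hc : ‖((2 * n / Real.pi : ℝ) : ℂ)‖ₑ = ENNReal.ofReal (2 * n / Real.pi) := by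
    rw [← ofReal_norm, Complex.norm_real, Real.norm_of_nonneg (by positivity)]
  rw [hsplit, enorm_mul, hc]
  refine (mul_le_mul' le_rfl (enorm_add_le _ _)).trans ?_
  rw [mul_add]
  refine add_le_add (le_trans (mul_le_mul' (ENNReal.ofReal_le_ofReal ?_) le_rfl) hmain)
    (mul_le_mul' le_rfl hnear)
  rw [div_le_iff₀ Real.pi_pos]
  nlinarith [Real.pi_gt_three]

/-! ### Summation over the pieces -/

theorem IsOpenLipschitz.volume_frontier {X : Set ℂ} (hX : IsOpenLipschitz X)
    (hb : Bornology.IsBounded X) : volume (frontier X) = 0 := by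
  obtain ⟨δ, hδ, h⟩ := hX.exists_volume_thickening_le hb
  have hlim : Filter.Tendsto (fun ε : ℝ => ENNReal.ofReal (100 * ε) * boundaryLength X)
      (nhdsWithin 0 (Ioi 0)) (nhds 0) := by
    have h1 : Filter.Tendsto (fun ε : ℝ => ENNReal.ofReal (100 * ε)) (nhdsWithin 0 (Ioi 0))
        (nhds 0) := by
      have : Continuous fun ε : ℝ => ENNReal.ofReal (100 * ε) :=
        ENNReal.continuous_ofReal.comp (continuous_const.mul continuous_id)
      have h2 := this.tendsto 0
      simp only [mul_zero, ENNReal.ofReal_zero] at h2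
      exact h2.mono_left nhdsWithin_le_nhds
    simpa using ENNReal.Tendsto.mul_const h1 (Or.inr (hX.boundaryLength_ne_top hb))
  refine nonpos_iff_eq_zero.1 (ge_of_tendsto hlim ?_)
  filter_upwards [Ioc_mem_nhdsGT hδ] with ε hε
  exact (measure_mono (Metric.self_subset_thickening hε.1 _)).trans (h ε hε.1 hε.2)

theorem IsLipschitzPartition.ae_eq_iUnion {m : ℕ} {U : Fin m → Set ℂ}
    (hU : IsLipschitzPartition U) : unitDisc =ᵐ[volume] ⋃ j, U j := by
  refine (Filter.EventuallyLE.antisymm ?_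
    (LE.le.eventuallyLE (iUnion_subset hU.subset_unitDisc)))
  rw [ae_le_set]
  refine measure_mono_null (t := ⋃ j, frontier (U j)) (fun z hz => ?_)
    (measure_iUnion_null fun j => (hU.lipschitz j).volume_frontier (hU.isBounded j))
  have h1 : z ∈ ⋃ j, closure (U j) := hU.cover ▸ subset_closure hz.1
  obtain ⟨j, hj⟩ := mem_iUnion.1 h1
  refine mem_iUnion.2 ⟨j, ?_⟩
  rw [(hU.lipschitz j).1.frontier_eq]
  exact ⟨hj, fun h => hz.2 (mem_iUnion.2 ⟨j, h⟩)⟩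

theorem IsLipschitzPartition.integral_eq_sum {m : ℕ} {U : Fin m → Set ℂ}
    (hU : IsLipschitzPartition U) {f : ℂ → ℂ} (hf : IntegrableOn f unitDisc) :
    ∫ z in unitDisc, f z = ∑ j, ∫ z in U j, f z := by
  rw [setIntegral_congr_set hU.ae_eq_iUnion]
  exact integral_iUnion_fintype (fun j => (hU.lipschitz j).1.measurableSet)
    (fun j k hjk => hU.disjoint j k hjk) fun j => hf.mono_set (hU.subset_unitDisc j)

section

variable {p : ℝ≥0∞} {m : ℕ} {U : Fin m → Set ℂ} {q : ℂ → ℂ}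

theorem MemPiecewiseSobolev.ae_enorm_le (hq : MemPiecewiseSobolev p U q) (j : Fin m) :
    ∀ᵐ z ∂(volume.restrict (U j)), ‖q z‖ₑ ≤ embeddingConst p (U j) * sobolevNorm p (U j) q := by
  have h := (hq.memSobolev j).eLpNorm_top_le (hq.partition.lipschitz j).1
  filter_upwards [ae_le_eLpNormEssSup (f := q) (μ := volume.restrict (U j))] with z hz
  rw [eLpNorm_exponent_top] at h
  exact hz.trans h

theorem MemPiecewiseSobolev.eLpNorm_two_le (hq : MemPiecewiseSobolev p U q) :
    eLpNorm q 2 (volume.restrict unitDisc) ≤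
      (∑ j, embeddingConst p (U j) * sobolevNorm p (U j) q) * volume unitDisc ^ (1 / 2 : ℝ) := by
  have h : ∀ᵐ z ∂(volume.restrict unitDisc),
      ‖q z‖ₑ ≤ ‖∑ j, embeddingConst p (U j) * sobolevNorm p (U j) q‖ₑ := by
    rw [Measure.restrict_congr_set hq.partition.ae_eq_iUnion, ae_restrict_iUnion_iff]
    intro j
    filter_upwards [hq.ae_enorm_le j] with z hz
    rw [enorm_eq_self]
    exact hz.trans (Finset.single_le_sum
      (f := fun j => embeddingConst p (U j) * sobolevNorm p (U j) q)
      (fun _ _ => zero_le) (Finset.mem_univ j))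
  refine (eLpNorm_mono_enorm_ae h).trans (le_of_eq ?_)
  rw [eLpNorm_const' _ (by norm_num) (by norm_num), enorm_eq_self, Measure.restrict_apply_univ,
    ENNReal.toReal_ofNat]

theorem sobolevNorm_le_piecewiseSobolevNorm (hp : 0 < p) (U : Fin m → Set ℂ) (q : ℂ → ℂ)
    (j : Fin m) : sobolevNorm p (U j) q ≤ piecewiseSobolevNorm p U q := by
  unfold piecewiseSobolevNorm
  split_ifs with h
  · subst h
    exact le_iSup (fun j => sobolevNorm ∞ (U j) q) j
  · have hr : 0 < p.toReal := ENNReal.toReal_pos hp.ne' h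
    have h1 : sobolevNorm p (U j) q ^ p.toReal ≤ ∑ j, sobolevNorm p (U j) q ^ p.toReal :=
      Finset.single_le_sum (f := fun j => sobolevNorm p (U j) q ^ p.toReal)
        (fun _ _ => zero_le) (Finset.mem_univ j)
    have h2 := ENNReal.rpow_le_rpow h1 (z := 1 / p.toReal) (by positivity)
    rwa [← ENNReal.rpow_mul, mul_one_div_cancel hr.ne', ENNReal.rpow_one] at h2

theorem integrableOn_phaseKernel_mul (hp : 2 < p) (hq : MemLpOn p unitDisc q) {n : ℝ} (hn : 0 < n)
    (z₀ : ℂ) : IntegrableOn (fun z => phaseKernel n z₀ z * q z) unitDisc := by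
  have hc : Continuous fun z => phaseKernel n z₀ z := by
    have h := (continuous_phaseKernel n).comp (Continuous.prodMk_right z₀)
    simpa only [Function.comp_def] using h
  have iq : Integrable q (volume.restrict unitDisc) :=
    IsOpen.integrableOn_of_memLp hp Metric.isBounded_ball hq
  exact iq.bdd_mul (f := phaseKernel n z₀) (c := 2 * n / Real.pi)
    hc.aestronglyMeasurable (ae_of_all _ fun z => (norm_phaseKernel hn z₀ z).le)

/-- The product of the integrable function `f` with the essentially bounded function `g`. -/
theorem IntegrableOn.mul_memSobolev (hp : 2 < p) {f g : ℂ → ℂ} (hf : IntegrableOn f unitDisc)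
    (hg : MemSobolev p unitDisc g) : IntegrableOn (fun z => f z * g z) unitDisc := by
  obtain ⟨C, hC⟩ := unitDisc_isOpenLipschitz.exists_isEmbeddingConst hp Metric.isBounded_ball
  have h := ae_le_of_isEmbeddingConst Metric.isOpen_ball hC hg
  have htop : (C : ℝ≥0∞) * sobolevNorm p unitDisc g ≠ ∞ :=
    ENNReal.mul_ne_top ENNReal.coe_ne_top (hg.sobolevNorm_ne_top Metric.isOpen_ball)
  refine Integrable.mul_bdd (c := ((C : ℝ≥0∞) * sobolevNorm p unitDisc g).toReal) hf hg.1.1 ?_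
  rw [eLpNorm_exponent_top] at h
  filter_upwards [ae_le_eLpNormEssSup (f := g) (μ := volume.restrict unitDisc)] with z hz
  rw [← toReal_enorm]
  exact ENNReal.toReal_mono htop (hz.trans h)

/-- The pointwise estimate of the oscillatory integral: subtracting from the amplitude its value
at `z₀` leaves the integral of the kernel against `q` alone, which is treated in `L²`, and
integrals over the pieces whose amplitude vanishes at `z₀`. -/
theorem enorm_integral_unitDisc_le (hp : 2 < p) {C : ℝ≥0} (hC : IsEmbeddingConst p unitDisc C)
    (hq : MemPiecewiseSobolev p U q) {g : ℂ → ℂ} (hg : MemSobolev p unitDisc g) {n : ℝ}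
    (hn : 0 < n) {ε : ℝ} (hε : 0 < ε) {z₀ : ℂ} (hz₀ : z₀ ∈ unitDisc) :
    ‖∫ z in unitDisc, phaseKernel n z₀ z * q z * g z‖ₑ ≤
      sobolevNorm p unitDisc g * (C * ‖∫ z in unitDisc, phaseKernel n z₀ z * q z‖ₑ +
        ∑ j, ((2 * (embeddingConst p (U j) * sobolevNorm p (U j) q * C) *
            singularIntegral (1 + 2 * (1 / p.toReal))
          + 2 * (2 * C * (holderConst p * sobolevNorm p (U j) q)
            + embeddingConst p (U j) * sobolevNorm p (U j) q * holderConst p)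
          + ENNReal.ofReal (2 * n / Real.pi) *
            (2 * (embeddingConst p (U j) * sobolevNorm p (U j) q * C) *
              volume (U j ∩ Metric.thickening (2 * ε) (frontier (U j)))))
          + ENNReal.ofReal (8 * Real.pi * rhoBound * ε⁻¹) *
            (embeddingConst p (U j) * sobolevNorm p (U j) q * C) *
            ∫⁻ z in U j ∩ Metric.thickening (2 * ε) (frontier (U j)),
              ‖z - z₀‖ₑ ^ (-(2 * (1 / p.toReal))))) := by
  have hU := hq.partition
  obtain ⟨G, hGg, hGc, hG1, hG2⟩ := hC.exists_holder hp Metric.isOpen_ball hg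
  have hcl : unitDisc ⊆ closure unitDisc := subset_closure
  set N := sobolevNorm p unitDisc g with hN
  have hL : (C : ℝ≥0∞) * N ≠ ∞ :=
    ENNReal.mul_ne_top ENNReal.coe_ne_top (hg.sobolevNorm_ne_top Metric.isOpen_ball)
  have iK := integrableOn_phaseKernel_mul hp hq.memLp hn z₀
  have iKG : IntegrableOn (fun z => phaseKernel n z₀ z * q z * G z) unitDisc := by
    refine (IntegrableOn.mul_memSobolev hp iK hg).congr ?_
    filter_upwards [hGg] with z hz
    rw [hz]
  have iKH : IntegrableOn (fun z => phaseKernel n z₀ z * q z * (G z - G z₀)) unitDisc := by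
    simp only [mul_sub]
    exact iKG.sub (iK.mul_const _)
  have hsplit : ∫ z in unitDisc, phaseKernel n z₀ z * q z * g z =
      (∫ z in unitDisc, phaseKernel n z₀ z * q z) * G z₀
        + ∑ j, ∫ z in U j, phaseKernel n z₀ z * q z * (G z - G z₀) := by
    rw [← hU.integral_eq_sum iKH, ← integral_mul_const, ← integral_add (iK.mul_const _) iKH]
    refine integral_congr_ae ?_
    filter_upwards [hGg] with z hz
    rw [← hz]
    ring
  rw [hsplit]
  refine (enorm_add_le _ _).trans ?_
  rw [mul_add, Finset.mul_sum]
  refine add_le_add ?_ ((enorm_sum_le _ _).trans (Finset.sum_le_sum fun j _ => ?_))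
  · rw [enorm_mul]
    calc _ ≤ ‖∫ z in unitDisc, phaseKernel n z₀ z * q z‖ₑ * (C * N) := by
          gcongr; exact hG1 z₀ (hcl hz₀)
      _ = _ := by ring
  · refine (enorm_integral_piece_le hp (hU.lipschitz j) (hU.subset_unitDisc j) (hq.memSobolev j)
      (hq.ae_enorm_le j) hg hL hGg (hGc.mono hcl) (fun z hz => hG1 z (hcl hz))
      (fun z hz w hw => hG2 z (hcl hz) w (hcl hw)) hn hε hz₀).trans (le_of_eq ?_)
    ring

theorem eLpNorm_const_mul_ennreal {μ : Measure ℂ} {f : ℂ → ℝ≥0∞} (hf : AEMeasurable f μ)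
    (c : ℝ≥0∞) : eLpNorm (fun x => c * f x) 2 μ = c * eLpNorm f 2 μ := by
  rw [eLpNorm_eq_lintegral_rpow_enorm_toReal (by norm_num) (by norm_num),
    eLpNorm_eq_lintegral_rpow_enorm_toReal (by norm_num) (by norm_num)]
  simp only [enorm_eq_self, ENNReal.toReal_ofNat]
  simp only [ENNReal.mul_rpow_of_nonneg _ _ (by norm_num : (0 : ℝ) ≤ 2)]
  rw [lintegral_const_mul'' _ (hf.pow_const _), ENNReal.mul_rpow_of_nonneg _ _ (by norm_num),
    ← ENNReal.rpow_mul]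
  norm_num

/-- Coefficient of the embedding constants in the bounding polynomial. -/
noncomputable def embeddingCoeff (p : ℝ≥0∞) (C : ℝ≥0) : ℝ≥0∞ :=
  volume unitDisc ^ (1 / 2 : ℝ) *
    (C + 2 * C * singularIntegral (1 + 2 * (1 / p.toReal)) + 2 * holderConst p)

/-- The share of each piece in the constant term of the bounding polynomial. -/
noncomputable def constCoeff (p : ℝ≥0∞) (C : ℝ≥0) : ℝ≥0∞ :=
  volume unitDisc ^ (1 / 2 : ℝ) * (4 * C * holderConst p)

/-- Coefficient of the products of embedding constants and boundary lengths in the bounding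
polynomial. -/
noncomputable def boundaryCoeff (p : ℝ≥0∞) (C : ℝ≥0) : ℝ≥0∞ :=
  ENNReal.ofReal (1600 * Real.pi * rhoBound) * C *
    singularIntegral (2 * (2 * (1 / p.toReal))) ^ (1 / 2 : ℝ)

theorem coeff_ne_top (hp : 2 < p) (C : ℝ≥0) :
    embeddingCoeff p C ≠ ∞ ∧ constCoeff p C ≠ ∞ ∧ boundaryCoeff p C ≠ ∞ := by
  obtain ⟨hb0, hb1⟩ := inv_toReal_nonneg_lt_half hp
  have hV : volume unitDisc ^ (1 / 2 : ℝ) ≠ ∞ :=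
    ENNReal.rpow_ne_top_of_nonneg (by norm_num) measure_ball_lt_top.ne
  have hH := holderConst_ne_top hp
  have hS : singularIntegral (1 + 2 * (1 / p.toReal)) ≠ ∞ :=
    singularIntegral_ne_top (by linarith)
  have hR : singularIntegral (2 * (2 * (1 / p.toReal))) ^ (1 / 2 : ℝ) ≠ ∞ :=
    ENNReal.rpow_ne_top_of_nonneg (by norm_num) (singularIntegral_ne_top (by linarith))
  refine ⟨?_, ?_, ?_⟩
  · unfold embeddingCoeff
    finiteness
  · unfold constCoeff
    finiteness
  · unfold boundaryCoeff
    finiteness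

/-- The `L²` estimate up to an error which is proportional to the width `ε` of the boundary layers
(with a factor depending on `n`). -/
theorem eLpNorm_integral_le_add (hp : 2 < p) {C : ℝ≥0} (hC : IsEmbeddingConst p unitDisc C)
    (hq : MemPiecewiseSobolev p U q) {g : ℂ → ℂ → ℂ}
    (hg : ∀ z₀ ∈ unitDisc, MemSobolev p unitDisc (g z₀)) {n : ℝ} (hn : 0 < n) {ε : ℝ}
    (hε : 0 < ε) (hA : ∀ j, volume (Metric.thickening (2 * ε) (frontier (U j)))
      ≤ ENNReal.ofReal (200 * ε) * boundaryLength (U j)) :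
    eLpNorm (fun z₀ => ∫ z in unitDisc, phaseKernel n z₀ z * q z * g z₀ z) 2
        (volume.restrict unitDisc) ≤
      essSup (fun z₀ => sobolevNorm p unitDisc (g z₀)) (volume.restrict unitDisc) *
        piecewiseSobolevNorm p U q *
        (∑ j, (embeddingCoeff p C * embeddingConst p (U j) + constCoeff p C
          + boundaryCoeff p C * (embeddingConst p (U j) * boundaryLength (U j)))
        + ENNReal.ofReal (200 * ε) * ∑ j, volume unitDisc ^ (1 / 2 : ℝ) *
          (ENNReal.ofReal (2 * n / Real.pi) *
            (2 * (embeddingConst p (U j) * C) * boundaryLength (U j)))) := by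
  have hp0 : 0 < p := lt_trans (by norm_num) hp
  have hU := hq.partition
  set M := essSup (fun z₀ => sobolevNorm p unitDisc (g z₀)) (volume.restrict unitDisc) with hM
  set W := piecewiseSobolevNorm p U q with hW
  set V := volume unitDisc ^ (1 / 2 : ℝ) with hV
  set S := singularIntegral (1 + 2 * (1 / p.toReal)) with hS
  set R := singularIntegral (2 * (2 * (1 / p.toReal))) ^ (1 / 2 : ℝ) with hR
  set Q : Fin m → ℝ≥0∞ := fun j => embeddingConst p (U j) * sobolevNorm p (U j) q with hQ
  set A : Fin m → Set ℂ := fun j => U j ∩ Metric.thickening (2 * ε) (frontier (U j)) with hAdef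
  set J : Fin m → ℂ → ℝ≥0∞ := fun j z₀ => ∫⁻ z in A j, ‖z - z₀‖ₑ ^ (-(2 * (1 / p.toReal)))
    with hJ
  set c : Fin m → ℝ≥0∞ := fun j => 2 * (Q j * C) * S
    + 2 * (2 * C * (holderConst p * sobolevNorm p (U j) q) + Q j * holderConst p)
    + ENNReal.ofReal (2 * n / Real.pi) * (2 * (Q j * C) * volume (A j)) with hc
  set d : Fin m → ℝ≥0∞ := fun j => ENNReal.ofReal (8 * Real.pi * rhoBound * ε⁻¹) * (Q j * C)
    with hd
  set Sq : ℂ → ℂ := fun z₀ => ∫ z in unitDisc, phaseKernel n z₀ z * q z with hSq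
  have hJm : ∀ j, Measurable (J j) := fun j =>
    Measurable.lintegral_prod_left' (f := fun w : ℂ × ℂ =>
      ‖w.1 - w.2‖ₑ ^ (-(2 * (1 / p.toReal)))) (measurable_enorm_sub_rpow _)
  have hSqm : AEStronglyMeasurable Sq (volume.restrict unitDisc) := by
    refine AEStronglyMeasurable.integral_prod_right' (f := fun w : ℂ × ℂ =>
      phaseKernel n w.1 w.2 * q w.2) ?_
    exact (continuous_phaseKernel n).aestronglyMeasurable.mul hq.memLp.1.comp_snd
  have hpt : ∀ᵐ z₀ ∂(volume.restrict unitDisc),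
      ‖∫ z in unitDisc, phaseKernel n z₀ z * q z * g z₀ z‖ₑ ≤
        ‖M * (C * ‖Sq z₀‖ₑ + ∑ j, (c j + d j * J j z₀))‖ₑ := by
    filter_upwards [ae_le_essSup (f := fun z₀ => sobolevNorm p unitDisc (g z₀))
      (μ := volume.restrict unitDisc), ae_restrict_mem Metric.isOpen_ball.measurableSet]
      with z₀ h1 h2
    rw [enorm_eq_self]
    exact (enorm_integral_unitDisc_le hp hC hq (hg z₀ h2) hn hε h2).trans
      (mul_le_mul' h1 le_rfl)
  have hm1 : AEMeasurable (fun z₀ => (C : ℝ≥0∞) * ‖Sq z₀‖ₑ) (volume.restrict unitDisc) :=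
    hSqm.enorm.const_mul _
  have hm2 : ∀ j, Measurable fun z₀ => c j + d j * J j z₀ := fun j =>
    ((hJm j).const_mul _).const_add _
  have hm3 : Measurable fun z₀ => ∑ j, (c j + d j * J j z₀) :=
    Finset.measurable_sum _ fun j _ => hm2 j
  have hE : ∀ j, Q j ≤ embeddingConst p (U j) * W := fun j =>
    mul_le_mul' le_rfl (sobolevNorm_le_piecewiseSobolevNorm hp0 U q j)
  -- the integral of the kernel against `q`, by Plancherel
  have hplanch : eLpNorm Sq 2 (volume.restrict unitDisc) ≤ (∑ j, Q j) * V := by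
    set q' := unitDisc.indicator q with hq'
    have iq : IntegrableOn q unitDisc :=
      IsOpen.integrableOn_of_memLp hp Metric.isBounded_ball hq.memLp
    have hq2 : MemLp q 2 (volume.restrict unitDisc) :=
      haveI : IsFiniteMeasure (volume.restrict unitDisc) := ⟨by
        rw [Measure.restrict_apply_univ]; exact measure_ball_lt_top⟩
      hq.memLp.mono_exponent hp.le
    have h1 : Integrable q' := (integrable_indicator_iff Metric.isOpen_ball.measurableSet).2 iq
    have h2 : MemLp q' 2 volume := (memLp_indicator_iff_restrict
      Metric.isOpen_ball.measurableSet).2 hq2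
    have h3 : Sq = fun z₀ => ∫ z, phaseKernel n z₀ z * q' z := by
      ext z₀
      simp only [hSq]
      rw [← integral_indicator Metric.isOpen_ball.measurableSet]
      congr 1
      ext z
      by_cases hz : z ∈ unitDisc
      · rw [indicator_of_mem hz, hq', indicator_of_mem hz]
      · rw [indicator_of_notMem hz, hq', indicator_of_notMem hz, mul_zero]
    refine (eLpNorm_mono_measure _ Measure.restrict_le_self).trans ?_
    rw [h3, eLpNorm_phaseKernel_integral_eq hn h1 h2, hq',
      eLpNorm_indicator_eq_eLpNorm_restrict Metric.isOpen_ball.measurableSet]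
    exact hq.eLpNorm_two_le
  have hconst : ∀ x : ℝ≥0∞, eLpNorm (fun _ : ℂ => x) 2 (volume.restrict unitDisc) ≤ x * V :=
    fun x => le_of_eq (by
      rw [eLpNorm_const' _ (by norm_num) (by norm_num), enorm_eq_self,
        Measure.restrict_apply_univ, ENNReal.toReal_ofNat])
  have hAv : ∀ j, volume (A j) ≤ ENNReal.ofReal (200 * ε) * boundaryLength (U j) := fun j =>
    (measure_mono inter_subset_right).trans (hA j)
  have hpiece : ∀ j, eLpNorm (fun z₀ => c j + d j * J j z₀) 2 (volume.restrict unitDisc) ≤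
      c j * V + d j * (R * volume (A j)) := fun j => by
    refine (eLpNorm_add_le (f := fun _ => c j) (g := fun z₀ => d j * J j z₀)
      measurable_const.aestronglyMeasurable
      ((hJm j).const_mul _).aestronglyMeasurable (by norm_num)).trans (add_le_add (hconst _) ?_)
    rw [eLpNorm_const_mul_ennreal (hJm j).aemeasurable]
    gcongr
    exact eLpNorm_potential_le (inter_subset_left.trans (hU.subset_unitDisc j))
  -- the factors `ε⁻¹` and `ε` from the cutoff and from the area of the boundary layer cancel
  have hcancel : ENNReal.ofReal (8 * Real.pi * rhoBound * ε⁻¹) * ENNReal.ofReal (200 * ε) =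
      ENNReal.ofReal (1600 * Real.pi * rhoBound) := by
    have := rhoBound_pos
    rw [← ENNReal.ofReal_mul (by positivity)]
    congr 1
    field_simp
    norm_num
  have hterm : ∀ j, C * (Q j * V) + (c j * V + d j * (R * volume (A j))) ≤
      W * (embeddingCoeff p C * embeddingConst p (U j) + constCoeff p C
          + boundaryCoeff p C * (embeddingConst p (U j) * boundaryLength (U j))
        + ENNReal.ofReal (200 * ε) * (V * (ENNReal.ofReal (2 * n / Real.pi) *
            (2 * (embeddingConst p (U j) * C) * boundaryLength (U j))))) := fun j => by
    simp only [hc, hd]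
    calc _ ≤ C * (embeddingConst p (U j) * W * V)
        + ((2 * (embeddingConst p (U j) * W * C) * S
          + 2 * (2 * C * (holderConst p * W) + embeddingConst p (U j) * W * holderConst p)
          + ENNReal.ofReal (2 * n / Real.pi) * (2 * (embeddingConst p (U j) * W * C) *
            (ENNReal.ofReal (200 * ε) * boundaryLength (U j)))) * V
          + ENNReal.ofReal (8 * Real.pi * rhoBound * ε⁻¹) * (embeddingConst p (U j) * W * C) *
            (R * (ENNReal.ofReal (200 * ε) * boundaryLength (U j)))) := by
          have := sobolevNorm_le_piecewiseSobolevNorm hp0 U q j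
          have := hE j
          have := hAv j
          gcongr
      _ = _ := by
          rw [embeddingCoeff, constCoeff, boundaryCoeff, ← hcancel]
          ring
  calc _ ≤ eLpNorm (fun z₀ => M * (C * ‖Sq z₀‖ₑ + ∑ j, (c j + d j * J j z₀))) 2
        (volume.restrict unitDisc) := eLpNorm_mono_enorm_ae hpt
    _ = M * eLpNorm (fun z₀ => C * ‖Sq z₀‖ₑ + ∑ j, (c j + d j * J j z₀)) 2
        (volume.restrict unitDisc) := eLpNorm_const_mul_ennreal (hm1.add hm3.aemeasurable) _
    _ ≤ M * (C * ((∑ j, Q j) * V) + ∑ j, (c j * V + d j * (R * volume (A j)))) := by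
        gcongr
        refine (eLpNorm_add_le (f := fun z₀ => (C : ℝ≥0∞) * ‖Sq z₀‖ₑ)
          (g := fun z₀ => ∑ j, (c j + d j * J j z₀)) hm1.aestronglyMeasurable
          hm3.aestronglyMeasurable (by norm_num)).trans (add_le_add ?_ ?_)
        · rw [eLpNorm_const_mul_ennreal hSqm.enorm]
          gcongr
          rw [eLpNorm_enorm]
          exact hplanch
        · have h := eLpNorm_sum_le (f := fun j z₀ => c j + d j * J j z₀) (s := Finset.univ)
            (p := 2) (μ := volume.restrict unitDisc)
            (fun j _ => (hm2 j).aestronglyMeasurable) (by norm_num)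
          have h' : (∑ j, fun z₀ => c j + d j * J j z₀) =
              fun z₀ => ∑ j, (c j + d j * J j z₀) := by
            ext z₀; simp
          rw [h'] at h
          exact h.trans (Finset.sum_le_sum fun j _ => hpiece j)
    _ = M * ∑ j, (C * (Q j * V) + (c j * V + d j * (R * volume (A j)))) := by
        rw [Finset.sum_mul, Finset.mul_sum, ← Finset.sum_add_distrib]
    _ ≤ M * ∑ j, W * (embeddingCoeff p C * embeddingConst p (U j) + constCoeff p C
          + boundaryCoeff p C * (embeddingConst p (U j) * boundaryLength (U j))
        + ENNReal.ofReal (200 * ε) * (V * (ENNReal.ofReal (2 * n / Real.pi) *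
            (2 * (embeddingConst p (U j) * C) * boundaryLength (U j))))) := by
        gcongr with j
        exact hterm j
    _ = _ := by
        rw [← Finset.mul_sum, Finset.sum_add_distrib, ← Finset.mul_sum, mul_assoc]

end

/-! ### The bounding polynomial and the limit of thin boundary layers -/

/-- The polynomial of the estimate; `inl j` stands for the length of the boundary of the piece `j`
and `inr j` for its embedding constant. The summand `1` keeps its values positive, so that the
estimate is trivial when the essential supremum of the norms of the amplitudes is infinite. -/
noncomputable def boundPolynomial (p : ℝ≥0∞) (C : ℝ≥0) (m : ℕ) :
    MvPolynomial (Fin m ⊕ Fin m) ℝ≥0 :=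
  1 + ∑ j, (MvPolynomial.C (embeddingCoeff p C).toNNReal * MvPolynomial.X (Sum.inr j)
    + MvPolynomial.C (constCoeff p C).toNNReal
    + MvPolynomial.C (boundaryCoeff p C).toNNReal *
      (MvPolynomial.X (Sum.inr j) * MvPolynomial.X (Sum.inl j)))

theorem eval_boundPolynomial {p : ℝ≥0∞} (hp : 2 < p) (C : ℝ≥0) {m : ℕ} {s e : Fin m → ℝ≥0∞}
    (hs : ∀ j, s j ≠ ∞) (he : ∀ j, e j ≠ ∞) :
    ((MvPolynomial.eval (Sum.elim (fun j => (s j).toNNReal) fun j => (e j).toNNReal)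
      (boundPolynomial p C m) : ℝ≥0) : ℝ≥0∞) =
      1 + ∑ j, (embeddingCoeff p C * e j + constCoeff p C
        + boundaryCoeff p C * (e j * s j)) := by
  obtain ⟨h1, h2, h3⟩ := coeff_ne_top hp C
  simp only [boundPolynomial, map_add, map_one, map_sum, map_mul, MvPolynomial.eval_C,
    MvPolynomial.eval_X, Sum.elim_inl, Sum.elim_inr, ENNReal.coe_add, ENNReal.coe_one,
    ENNReal.ofNNReal_finsetSum, ENNReal.coe_mul, ENNReal.coe_toNNReal h1, ENNReal.coe_toNNReal h2,
    ENNReal.coe_toNNReal h3, ENNReal.coe_toNNReal (hs _), ENNReal.coe_toNNReal (he _)]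

/-- A bound which holds up to errors proportional to a vanishing parameter holds without error. If
`M * W` is infinite the limit may fail, and the claim holds because of the added `1`. -/
theorem ennreal_le_of_le_add {T M W P τ : ℝ≥0∞} (hτ : τ ≠ ∞)
    (h : ∀ᶠ ε in nhdsWithin (0 : ℝ) (Ioi 0), T ≤ M * W * (P + ENNReal.ofReal (200 * ε) * τ)) :
    T ≤ (1 + P) * W * M := by
  by_cases hMW : M * W = ∞
  · rw [mul_assoc, mul_comm W, hMW, ENNReal.mul_top (by simp)]
    exact le_top
  · have hc : Continuous fun ε : ℝ => ENNReal.ofReal (200 * ε) :=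
      ENNReal.continuous_ofReal.comp (continuous_const.mul continuous_id)
    have h1 : Filter.Tendsto (fun ε : ℝ => ENNReal.ofReal (200 * ε)) (nhdsWithin 0 (Ioi 0))
        (nhds 0) := by
      have h2 := hc.tendsto 0
      simp only [mul_zero, ENNReal.ofReal_zero] at h2
      exact h2.mono_left nhdsWithin_le_nhds
    have h3 := ENNReal.Tendsto.const_mul (a := M * W)
      ((ENNReal.Tendsto.mul_const h1 (Or.inr hτ)).const_add P) (Or.inr hMW)
    refine (ge_of_tendsto h3 h).trans ?_
    rw [zero_mul, add_zero, mul_assoc (1 + P), mul_comm W, mul_comm (1 + P)]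
    gcongr
    exact le_add_self

end PiecewiseSobolev

open PiecewiseSobolev in
theorem theorem5p2p6 (p : ℝ≥0∞) (hp : 2 < p) (m : ℕ) :
    -- a polynomial in the boundary lengths and the embedding constants of the `m` pieces
    ∃ P : MvPolynomial (Fin m ⊕ Fin m) ℝ≥0,
      ∀ U : Fin m → Set ℂ, IsLipschitzPartition U →
        (∀ j, boundaryLength (U j) ≠ ∞ ∧ embeddingConst p (U j) ≠ ∞) ∧
        ∀ q : ℂ → ℂ, MemPiecewiseSobolev p U q →
        ∀ g : ℂ → ℂ → ℂ,
          AEStronglyMeasurable (fun w : ℂ × ℂ => g w.1 w.2)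
            ((volume.restrict unitDisc).prod (volume.restrict unitDisc)) →
          (∀ z₀ ∈ unitDisc, MemSobolev p unitDisc (g z₀)) →
        ∀ n : ℝ, 0 < n →
          (∀ z₀ ∈ unitDisc,
            IntegrableOn (fun z => phaseKernel n z₀ z * q z * g z₀ z) unitDisc volume) ∧
          AEStronglyMeasurable
            (fun z₀ => ∫ z in unitDisc, phaseKernel n z₀ z * q z * g z₀ z)
            (volume.restrict unitDisc) ∧
          eLpNorm (fun z₀ => ∫ z in unitDisc, phaseKernel n z₀ z * q z * g z₀ z) 2
              (volume.restrict unitDisc)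
            ≤ (MvPolynomial.eval
                (Sum.elim (fun j => (boundaryLength (U j)).toNNReal)
                  (fun j => (embeddingConst p (U j)).toNNReal)) P : ℝ≥0)
              * piecewiseSobolevNorm p U q
              * essSup (fun z₀ => sobolevNorm p unitDisc (g z₀)) (volume.restrict unitDisc) := by
  obtain ⟨C, hC⟩ := unitDisc_isOpenLipschitz.exists_isEmbeddingConst hp Metric.isBounded_ball
  refine ⟨boundPolynomial p C m, fun U hU => ?_⟩
  have hσ : ∀ j, boundaryLength (U j) ≠ ∞ := fun j =>
    (hU.lipschitz j).boundaryLength_ne_top (hU.isBounded j)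
  have hE : ∀ j, embeddingConst p (U j) ≠ ∞ := fun j =>
    embeddingConst_ne_top hp (hU.lipschitz j) (hU.isBounded j)
  refine ⟨fun j => ⟨hσ j, hE j⟩, fun q hq g hgm hg n hn => ⟨fun z₀ hz₀ => ?_, ?_, ?_⟩⟩
  · exact IntegrableOn.mul_memSobolev hp (integrableOn_phaseKernel_mul hp hq.memLp hn z₀)
      (hg z₀ hz₀)
  · refine AEStronglyMeasurable.integral_prod_right' (f := fun w : ℂ × ℂ =>
      phaseKernel n w.1 w.2 * q w.2 * g w.1 w.2) ?_
    exact ((continuous_phaseKernel n).aestronglyMeasurable.mul hq.memLp.1.comp_snd).mul hgm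
  · rw [eval_boundPolynomial hp C hσ hE]
    refine ennreal_le_of_le_add
      (τ := ∑ j, volume unitDisc ^ (1 / 2 : ℝ) * (ENNReal.ofReal (2 * n / Real.pi) *
        (2 * (embeddingConst p (U j) * C) * boundaryLength (U j)))) ?_ ?_
    · have hV : volume unitDisc ^ (1 / 2 : ℝ) ≠ ∞ :=
        ENNReal.rpow_ne_top_of_nonneg (by norm_num) measure_ball_lt_top.ne
      refine ENNReal.sum_ne_top.2 fun j _ => ?_
      have := hσ j
      have := hE j
      finiteness
    · choose δ hδ hvol using fun j =>
        (hU.lipschitz j).exists_volume_thickening_le (hU.isBounded j)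
      have hev : ∀ᶠ ε in nhdsWithin (0 : ℝ) (Ioi 0), ∀ j, ε ≤ δ j / 2 :=
        Filter.eventually_all.2 fun j =>
          Filter.mem_of_superset (Ioc_mem_nhdsGT (half_pos (hδ j))) fun ε hε => hε.2
      filter_upwards [hev, self_mem_nhdsWithin] with ε h1 h2
      have hε : 0 < ε := h2
      refine eLpNorm_integral_le_add hp hC hq hg hn hε fun j => ?_
      have h3 := hvol j (2 * ε) (by positivity) (by linarith [h1 j])
      rwa [← mul_assoc, show (100 : ℝ) * 2 = 200 by norm_num] at h3
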